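/- **Setting.** A planar bicycle vehicle with wheelbase $L>0$, constant driving speed $v_{rw}>0$ and steering angle $\delta\in[-\delta_{\max},\delta_{\max}]$ follows a reference path: a simple, properly embedded plane curve (closed or not) parametrized by arc length $s$, $C^1$ and $C^2$ off a locally finite set of abscissas, with continuous tangent $T(s)$, normal $N(s)=iT(s)$, signed curvature $\varkappa(s)$ (defined off this set), $\bar\varkappa=\sup|\varkappa|<\varkappa_{veh}:=L^{-1}\tan\delta_{\max}$. Let $\lambda\in(0,1)$ and $Z=\{z:\bar\varkappa|z|\le\lambda\}$; every point whose distance $d$ to the path satisfies $\bar\varkappa d\le\lambda$ has a unique closest point on the path. With $s$ the abscissa of the closest point, $z$ the $N(s)$-coordinate of the rear axle center and $\theta$ the (continuous in time) polar angle of $T(s)$ in the vehicle frame, $|\theta(0)|\le\pi$, the kinematics are $$\dot s=\frac{v\cos(\theta-\varphi)}{1-\varkappa(s)z},\quad \dot z=-v\sin(\theta-\varphi),\quad \dot\theta=\varkappa(s)\dot s-\frac vL[\tan(\delta+\beta)-\tan\varphi],\quad v=\frac{v_{rw}+v^s}{\cos\varphi}.$$ The slips $\varphi,\beta,v^s$ are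 unknown continuous functions of $t\ge 0$ with $|\varphi|\le\bar\varphi<\pi/2$, $|\beta|\le\bar\beta$, $|v^s|\le\bar v<v_{rw}$, $\bar\beta<\delta_{\max}$, $\delta_{\max}+\bar\beta<\pi/2$. Estimates $\hat\varphi$ (differentiable, $|\dot{\hat\varphi}|\le \bar d$) and $\hat\beta$ (continuous) are available with $|\varphi-\hat\varphi|\le\varphi_{err}\le\bar\varphi$, $|\beta-\hat\beta|\le\beta_{err}\le\bar\beta$, $|\hat\varphi|\le\bar\varphi$, $|\hat\beta|\le\bar\beta$. **Design function.** $\chi:\mathbb R\to\mathbb R$ is odd, non-decreasing, continuous, piecewise $C^2$ (its breakpoints are locally finite, and it is $C^2$ up to the ends of each piece). Put $\mu:=\sup_{Z}\chi$ ($=\chi(\lambda/\bar\varkappa)$ if $\bar\varkappa>0$); both one-sided derivatives of $\chi$ are positive wherever $|\chi(z)|<\mu$, and $\varphi_{err}<\mu<\pi/2-\varphi_{err}$. Moreover, for all $z\ge0$ in $Z$ and both one-sided derivatives, $$\frac{\tan(\delta_{\max}-\bar\beta)-\tan\bar\varphi}{L}-\frac{\bar d}{v_{rw}-\bar v}-\frac{2\bar\varkappa\varphi_{err}}{1-\lambda}>\frac{\bar\varkappa\cos[\chi(z)+\varphi_{err}]}{1-\bar\varkappa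 z}+\chi'(z\pm0)\sin[\chi(z)+\varphi_{err}].\tag{1}$$ **Initial state.** Let $S=\theta-\chi(z)-\hat\varphi$, $R=\varkappa_{veh}^{-1}$, $T=2\pi R/v_{rw}$, and let $\mathfrak D$ be the set of points of the plane whose distance $d$ to the path satisfies $\bar\varkappa d\le\lambda$ and is not furnished by an end-point of the path. The initial position lies in $\mathfrak D$. If $S(0)\ne0$, compare the motions from the initial state under $\delta\equiv\delta_{\max}\operatorname{sgn}S(0)$ without slip (a circle of radius $R$) and with all continuous slips obeying the above bounds; let $d_{dev}$ and $\alpha$ be the suprema of the deviations of position and of vehicle orientation over $t\in[0,2T]$. Then the closed $d_{dev}$-neighborhood of the disc encircled by this circle lies in $\mathfrak D$, and $\alpha<\pi$. **Control laws** (solutions are in the sense of Filippov). (A) $\delta=\delta_{\max}\operatorname{sgn}S$. (B) Let $\Xi=\frac{\varkappa(s)\cos(\theta-\hat\varphi)}{1-\varkappa(s)z}+\chi'(z)\sin(\theta-\hat\varphi)-\frac{\dot{\hat\varphi}}{v_{rw}}$, $\eta_\sigma(z)=\sup|\Xi|$, $\mu_\sigma(z)=\sup|v^{-1}\dot S+L^{-1}(\tan[\delta+\beta]-\tan\varphi)-\Xi|$,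 where, for given $z$, the suprema are over $|S|\le\sigma$ and all values of the other variables obeying the above constraints (at kinks of $\chi$, both one-sided derivatives are included). Numbers $\sigma,\varepsilon>0$ and a continuous function $\underline\varkappa$ are such that $\varphi_{err}+\sigma<\mu$ and, for all $z\in Z$, $$\mu_\sigma(z)+\eta_\sigma(z)+\frac{\tan\bar\varphi}L\le\frac{\tan(\delta_{\max}-\bar\beta)}L-\varepsilon,$$ $$\varkappa_{veh}>\underline\varkappa(z)\ge\mu_\sigma(z)+\frac{\sin\varphi_{err}}{L\cos^2\bar\varphi}+\frac{\tan\delta_{\max}-\tan(\delta_{\max}-\beta_{err})}{L}+\varepsilon.\tag{2}$$ A continuous $p(c,z)$, $c\ge0$, is such that for $z\in Z$: $p(0,z)=\underline\varkappa(z)$, $p(c,z)=\varkappa_{veh}$ for $c\ge\sigma$, $p(c,z)\in[\underline\varkappa(z),\varkappa_{veh}]$. The law is $\delta=\mathrm{SAT}[\arctan\Upsilon-\hat\beta]$, with saturation to $[-\delta_{\max},\delta_{\max}]$ and $$\Upsilon=\frac{\varkappa_{veh}-p(|S|,z)}{\varkappa_{veh}-\underline\varkappa(z)}(\tan\hat\varphi+L\Xi)+L\,p(|S|,z)\operatorname{sgn}S.$$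 **Claim.** Under (1) and the above assumptions, for law (A), and also for law (B) whenever (2) holds: the equation $\chi(z_{err})=\varphi_{err}$ has a unique root $z_{err}$; $\gamma:=\chi'(z_{err}+0)>0$; and there is a constant $c$ such that every motion from the given initial state, on any time interval starting at $0$ during which the vehicle does not reach an end of the path (if there is any), keeps $\bar\varkappa|z(t)|\le\lambda$, with $s(t)$ remaining the abscissa of the closest point of the path, and satisfies $$|z(t)|\le z_{err}+c\,e^{-\gamma(v_{rw}-\bar v)t}.$$ -/

import Mathlib

open Set MeasureTheory

noncomputable section

namespace BicycleTracking

/-! ### Constants -/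

/-- Constants of the vehicle, of the wheels slip, of its on-line estimation, and of the domain in
which the maneuvers are examined. -/
structure Params where
  /-- wheelbase -/
  L : ℝ
  /-- driving speed of the rear wheels -/
  vrw : ℝ
  /-- maximal steering angle -/
  dmax : ℝ
  /-- bound on the rear wheel slip angle `φ` -/
  phiBar : ℝ
  /-- bound on the bias `β` of the steering angle -/
  betaBar : ℝ
  /-- bound on the bias of the driving speed -/
  vBar : ℝ
  /-- bound on the error of estimation of `φ` -/
  ePhi : ℝ
  /-- bound on the error of estimation of `β` -/
  eBeta : ℝ
  /-- bound on the time derivative of the estimate of `φ` -/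
  dphiBar : ℝ
  /-- the parameter of the domain `|z| ≤ lam / (maximal curvature of the path)` -/
  lam : ℝ
  L_pos : 0 < L
  vBar_nonneg : 0 ≤ vBar
  vBar_lt : vBar < vrw
  phiBar_nonneg : 0 ≤ phiBar
  phiBar_lt : phiBar < Real.pi / 2
  betaBar_nonneg : 0 ≤ betaBar
  betaBar_lt : betaBar < dmax
  /-- together with `betaBar < dmax`: under the maximal steering angle, the actual direction
  `dmax + β` of the front wheels stays in `(0, π/2)` whatever the slip `|β| ≤ betaBar`. -/
  dmax_add_lt : dmax + betaBar < Real.pi / 2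
  ePhi_nonneg : 0 ≤ ePhi
  ePhi_le : ePhi ≤ phiBar
  eBeta_nonneg : 0 ≤ eBeta
  eBeta_le : eBeta ≤ betaBar
  dphiBar_nonneg : 0 ≤ dphiBar
  lam_pos : 0 < lam
  lam_lt : lam < 1

namespace Params

/-- Maximal curvature of the vehicle path, `tan δ_max / L`. -/
def kVeh (P : Params) : ℝ := Real.tan P.dmax / P.L

/-- Minimal turning radius, `L / tan δ_max`. -/
def R (P : Params) : ℝ := P.L / Real.tan P.dmax

/-- `tan (δ_max - betaBar) / L`. -/
def kV (P : Params) : ℝ := Real.tan (P.dmax - P.betaBar) / P.L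

/-- Duration of one revolution along the circle of the minimal turning radius. -/
def T (P : Params) : ℝ := 2 * Real.pi * P.R / P.vrw

end Params

/-! ### The reference path -/

/-- A simple plane curve, closed or not, parametrized by the arc length `s`, which is `C¹`,
and `C²` apart from a locally finite set `brk` of abscissas, with bounded curvature. The plane is
`ℂ`; `tang s` is a continuous polar angle of the tangent, `κ s` is the signed curvature.
The abscissa runs over a closed interval `dom`, bounded or not. A closed curve has `dom = univ` and
`period` equal to its length; otherwise `period = 0`, and so the parametrization is injective. -/
structure RefPath where
  dom : Set ℝ
  r : ℝ → ℂ
  tang : ℝ → ℝ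
  κ : ℝ → ℝ
  brk : Set ℝ
  period : ℝ
  dom_ordConnected : dom.OrdConnected
  dom_closed : IsClosed dom
  dom_interior : (interior dom).Nonempty
  hasDeriv_r : ∀ s ∈ dom, HasDerivWithinAt r (Complex.exp (tang s * Complex.I)) dom s
  tang_cont : ContinuousOn tang dom
  brk_locallyFinite : ∀ a b : ℝ, (brk ∩ Icc a b).Finite
  hasDeriv_tang : ∀ s ∈ dom \ brk, HasDerivWithinAt tang (κ s) dom s
  κ_cont : ∀ s ∈ dom \ brk, ContinuousWithinAt κ dom s
  κ_bdd : BddAbove ((fun s => |κ s|) '' (dom \ brk))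
  period_nonneg : 0 ≤ period
  period_dom : period = 0 ∨ dom = univ
  simple : ∀ s ∈ dom, ∀ s' ∈ dom, r s = r s' ↔ ∃ k : ℤ, s' = s + k * period
  /-- A bounded region of the plane contains only a bounded part of the path (this is automatic
  for a path of finite length and for a closed path). -/
  proper : ∀ B : ℝ, ∃ M : ℝ, ∀ s ∈ dom, ‖r s‖ ≤ B → ∃ k : ℤ, |s + k * period| ≤ M

namespace RefPath

/-- Maximal curvature of the path. -/
def kBar (C : RefPath) : ℝ := sSup ((fun s => |C.κ s|) '' (C.dom \ C.brk))

/-- The point with coordinate `z` along the unit normal at the point with abscissa `s`. -/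
def point (C : RefPath) (s z : ℝ) : ℂ :=
  C.r s + z * (Complex.I * Complex.exp (C.tang s * Complex.I))

/-- `s` is an abscissa of a point of the path which is closest to `ζ`. -/
def IsClosest (C : RefPath) (s : ℝ) (ζ : ℂ) : Prop :=
  s ∈ C.dom ∧ ∀ s' ∈ C.dom, dist ζ (C.r s) ≤ dist ζ (C.r s')

/-- Distance of a point of the plane to the path. -/
def distTo (C : RefPath) (ζ : ℂ) : ℝ := Metric.infDist ζ (C.r '' C.dom)

/-- The closest point of the path is well defined at all distances not exceeding `lam / kBar`
(at all distances if the path is straight, `kBar = 0`). -/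
def ClosestWellDefined (C : RefPath) (lam : ℝ) : Prop :=
  ∀ ζ : ℂ, C.kBar * C.distTo ζ ≤ lam → ∃! q : ℂ, ∃ s, q = C.r s ∧ C.IsClosest s ζ

/-- The set of points at the distance at most `lam / kBar` from the path such that this distance
is not furnished by an end-point of the path. -/
def domain (C : RefPath) (lam : ℝ) : Set ℂ :=
  {ζ | C.kBar * C.distTo ζ ≤ lam ∧ ∀ s, C.IsClosest s ζ → s ∈ interior C.dom}

end RefPath

/-! ### Slip and kinematics -/

/-- Slip signals, functions of time: rear wheel slip angle, bias of the steering angle, and bias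
of the driving speed. -/
structure Slip where
  φ : ℝ → ℝ
  β : ℝ → ℝ
  vs : ℝ → ℝ

structure Slip.Admissible (P : Params) (w : Slip) : Prop where
  φ_cont : ContinuousOn w.φ (Ici 0)
  β_cont : ContinuousOn w.β (Ici 0)
  vs_cont : ContinuousOn w.vs (Ici 0)
  φ_le : ∀ t, 0 ≤ t → |w.φ t| ≤ P.phiBar
  β_le : ∀ t, 0 ≤ t → |w.β t| ≤ P.betaBar
  vs_le : ∀ t, 0 ≤ t → |w.vs t| ≤ P.vBar

/-- The motion without slip. -/
def Slip.none : Slip := ⟨fun _ => 0, fun _ => 0, fun _ => 0⟩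

/-- On-line estimates of `φ` and `β`, along with the time derivative of the former. -/
structure Estimates where
  φh : ℝ → ℝ
  βh : ℝ → ℝ
  dφh : ℝ → ℝ

structure Estimates.Admissible (P : Params) (w : Slip) (e : Estimates) : Prop where
  φh_deriv : ∀ t, 0 ≤ t → HasDerivWithinAt e.φh (e.dφh t) (Ici 0) t
  βh_cont : ContinuousOn e.βh (Ici 0)
  dφh_le : ∀ t, 0 ≤ t → |e.dφh t| ≤ P.dphiBar
  φ_err : ∀ t, 0 ≤ t → |w.φ t - e.φh t| ≤ P.ePhi
  β_err : ∀ t, 0 ≤ t → |w.β t - e.βh t| ≤ P.eBeta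
  φh_le : ∀ t, 0 ≤ t → |e.φh t| ≤ P.phiBar
  βh_le : ∀ t, 0 ≤ t → |e.βh t| ≤ P.betaBar

/-- Speed of the center of the rear axle. -/
def speed (P : Params) (φ vs : ℝ) : ℝ := (P.vrw + vs) / Real.cos φ

/-- Angular velocity of the vehicle. -/
def turnRate (P : Params) (v φ β δ : ℝ) : ℝ :=
  v / P.L * (Real.tan (δ + β) - Real.tan φ)

/-- `ds/dt`, where `k` is the curvature of the path. -/
def sDot (k z θ φ v : ℝ) : ℝ := v * Real.cos (θ - φ) / (1 - k * z)

/-- `dz/dt`. -/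
def zDot (θ φ v : ℝ) : ℝ := -(v * Real.sin (θ - φ))

/-- `dθ/dt`. -/
def thetaDot (P : Params) (k z θ φ β v δ : ℝ) : ℝ :=
  k * sDot k z θ φ v - turnRate P v φ β δ

/-- The state `(s, z, θ)`: abscissa of the closest point of the path, signed distance to the path,
and polar angle of the tangent to the path in the vehicle frame. -/
abbrev State := ℝ × ℝ × ℝ

/-- The right-hand side of the kinematic equations under the steering law `u`. -/
def field (P : Params) (C : RefPath) (w : Slip) (u : ℝ → State → ℝ) (t : ℝ) (x : State) : State :=
  let v := speed P (w.φ t) (w.vs t)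
  let k := C.κ x.1
  (sDot k x.2.1 x.2.2 (w.φ t) v,
   zDot x.2.2 (w.φ t) v,
   thetaDot P k x.2.1 x.2.2 (w.φ t) (w.β t) v (u t x))

/-- Filippov's convexification of a discontinuous vector field. -/
def filippov (f : ℝ → State → State) (t : ℝ) (x : State) : Set State :=
  ⋂ (ρ : ℝ) (_ : 0 < ρ) (N : Set State) (_ : volume N = 0),
    closure (convexHull ℝ (f t '' (Metric.ball x ρ \ N)))

/-- `x` is a solution in the sense of Filippov of `dx/dt = f t x` on the interval `J ∋ 0`: it is
absolutely continuous on compact subintervals and `dx/dt ∈ filippov f t x` almost everywhere. -/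
def IsFilippovSolution (f : ℝ → State → State) (J : Set ℝ) (x : ℝ → State) : Prop :=
  ∃ y : ℝ → State,
    (∀ t ∈ J, IntervalIntegrable y volume 0 t ∧ x t = x 0 + ∫ τ in (0 : ℝ)..t, y τ) ∧
    ∀ᵐ t ∂(volume.restrict J), y t ∈ filippov f t (x t)

/-! ### The design function `χ` and the maximal-actuation law -/

def rightDeriv (χ : ℝ → ℝ) (z : ℝ) : ℝ := derivWithin χ (Ioi z) z

def leftDeriv (χ : ℝ → ℝ) (z : ℝ) : ℝ := derivWithin χ (Iio z) z

/-- `χ (lam / kBar)`, understood as the limit of `χ` at `+∞` if the path is straight. -/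
def chiMax (P : Params) (C : RefPath) (χ : ℝ → ℝ) : ℝ :=
  sSup (χ '' {z | C.kBar * |z| ≤ P.lam})

/-- General requirements to `χ`. -/
structure IsDesignFunction (P : Params) (C : RefPath) (χ : ℝ → ℝ) : Prop where
  odd : ∀ z, χ (-z) = -χ z
  mono : Monotone χ
  cont : Continuous χ
  /-- piecewise smoothness -/
  pieces : ∃ B : Set ℝ, (∀ a b : ℝ, (B ∩ Icc a b).Finite) ∧
    ∀ a b : ℝ, a < b → Ioo a b ∩ B = ∅ → ContDiffOn ℝ 2 χ (Icc a b)
  deriv_pos : ∀ z, -chiMax P C χ < χ z → χ z < chiMax P C χ →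
    0 < rightDeriv χ z ∧ 0 < leftDeriv χ z
  ePhi_lt : P.ePhi < chiMax P C χ
  chiMax_lt : chiMax P C χ < Real.pi / 2 - P.ePhi

/-- The left-hand side of the maintainability inequality. -/
def kVehLow (P : Params) (C : RefPath) : ℝ :=
  Real.tan (P.dmax - P.betaBar) / P.L - Real.tan P.phiBar / P.L
    - P.dphiBar / (P.vrw - P.vBar) - 2 * C.kBar / (1 - P.lam) * P.ePhi

/-- The strict maintainability inequality. -/
def StrictlyMaintainable (P : Params) (C : RefPath) (χ : ℝ → ℝ) : Prop :=
  ∀ z, 0 ≤ z → C.kBar * z ≤ P.lam → ∀ d : ℝ, d = rightDeriv χ z ∨ d = leftDeriv χ z →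
    C.kBar * Real.cos (χ z + P.ePhi) / (1 - C.kBar * z) + d * Real.sin (χ z + P.ePhi)
      < kVehLow P C

/-- The sliding variable `S = θ - χ(z) - φ̂`. -/
def slidingVar (χ : ℝ → ℝ) (e : Estimates) (t : ℝ) (x : State) : ℝ := x.2.2 - χ x.2.1 - e.φh t

/-- The steering law `δ = δ_max sgn S`. -/
def maxLaw (P : Params) (χ : ℝ → ℝ) (e : Estimates) (t : ℝ) (x : State) : ℝ :=
  P.dmax * Real.sign (slidingVar χ e t x)

/-! ### The mixed nonlinear/sliding-mode law -/

/-- The expression `Ξ`; here `k` is the curvature of the path and `d` is the derivative of `χ`. -/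
def Xi (P : Params) (k z θ φh dφh d : ℝ) : ℝ :=
  k * Real.cos (θ - φh) / (1 - k * z) + d * Real.sin (θ - φh) - dφh / P.vrw

/-- Values of all quantities involved in the formulas for `μ_σ(z)` and `η_σ(z)`. -/
structure Config where
  s : ℝ
  θ : ℝ
  φ : ℝ
  β : ℝ
  vs : ℝ
  φh : ℝ
  βh : ℝ
  dφh : ℝ
  δ : ℝ
  /-- (one-sided) derivative of `χ` at `z` -/
  d : ℝ

/-- The configuration satisfies all constraints, and `|S| ≤ σ`. -/
structure Config.Admissible (P : Params) (C : RefPath) (χ : ℝ → ℝ) (σ z : ℝ) (c : Config) :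
    Prop where
  s_mem : c.s ∈ C.dom \ C.brk
  S_le : |c.θ - χ z - c.φh| ≤ σ
  φ_le : |c.φ| ≤ P.phiBar
  β_le : |c.β| ≤ P.betaBar
  vs_le : |c.vs| ≤ P.vBar
  φ_err : |c.φ - c.φh| ≤ P.ePhi
  β_err : |c.β - c.βh| ≤ P.eBeta
  φh_le : |c.φh| ≤ P.phiBar
  βh_le : |c.βh| ≤ P.betaBar
  dφh_le : |c.dφh| ≤ P.dphiBar
  δ_le : |c.δ| ≤ P.dmax
  d_eq : c.d = rightDeriv χ z ∨ c.d = leftDeriv χ z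

def Config.Xi (P : Params) (C : RefPath) (z : ℝ) (c : Config) : ℝ :=
  BicycleTracking.Xi P (C.κ c.s) z c.θ c.φh c.dφh c.d

def Config.v (P : Params) (c : Config) : ℝ := speed P c.φ c.vs

/-- The time derivative of `S = θ - χ(z) - φ̂` by virtue of the kinematic equations. -/
def Config.SDot (P : Params) (C : RefPath) (z : ℝ) (c : Config) : ℝ :=
  thetaDot P (C.κ c.s) z c.θ c.φ c.β (c.v P) c.δ - c.d * zDot c.θ c.φ (c.v P) - c.dφh

/-- `η_σ(z) = sup |Ξ|`. -/
def eta (P : Params) (C : RefPath) (χ : ℝ → ℝ) (σ z : ℝ) : ℝ :=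
  sSup {a | ∃ c : Config, c.Admissible P C χ σ z ∧ a = |c.Xi P C z|}

/-- `μ_σ(z) = sup |v⁻¹ Ṡ + (tan(δ + β) - tan φ) / L - Ξ|`. -/
def mu (P : Params) (C : RefPath) (χ : ℝ → ℝ) (σ z : ℝ) : ℝ :=
  sSup {a | ∃ c : Config, c.Admissible P C χ σ z ∧
    a = |(c.v P)⁻¹ * c.SDot P C z
        + (Real.tan (c.δ + c.β) - Real.tan c.φ) / P.L - c.Xi P C z|}

/-- The requirements to `σ`, `ε` and to the function `kl` (the lower amplitude). -/
structure AmplitudeOK (P : Params) (C : RefPath) (χ : ℝ → ℝ) (σ ε : ℝ) (kl : ℝ → ℝ) : Prop where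
  σ_pos : 0 < σ
  ε_pos : 0 < ε
  cont : Continuous kl
  σ_lt : P.ePhi + σ < chiMax P C χ
  room : ∀ z, C.kBar * |z| ≤ P.lam →
    mu P C χ σ z + eta P C χ σ z + Real.tan P.phiBar / P.L ≤ P.kV - ε
  kl_lt : ∀ z, C.kBar * |z| ≤ P.lam → kl z < P.kVeh
  kl_ge : ∀ z, C.kBar * |z| ≤ P.lam →
    mu P C χ σ z + Real.sin P.ePhi / (P.L * Real.cos P.phiBar ^ 2)
      + (Real.tan P.dmax - Real.tan (P.dmax - P.eBeta)) / P.L + ε ≤ kl z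

/-- The requirements to the function `p(c, z)`, `c ≥ 0`. -/
structure MixingOK (P : Params) (C : RefPath) (σ : ℝ) (kl : ℝ → ℝ) (p : ℝ → ℝ → ℝ) : Prop where
  cont : ContinuousOn (fun q : ℝ × ℝ => p q.1 q.2) (Ici 0 ×ˢ univ)
  at_zero : ∀ z, C.kBar * |z| ≤ P.lam → p 0 z = kl z
  at_large : ∀ c z, σ ≤ c → C.kBar * |z| ≤ P.lam → p c z = P.kVeh
  mem : ∀ c z, 0 ≤ c → C.kBar * |z| ≤ P.lam → p c z ∈ Icc (kl z) P.kVeh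

/-- Saturation at the maximal steering angle. -/
def sat (P : Params) (δ : ℝ) : ℝ := max (-P.dmax) (min P.dmax δ)

/-- The mixed nonlinear/sliding-mode steering law. -/
def mixedLaw (P : Params) (C : RefPath) (χ kl : ℝ → ℝ) (p : ℝ → ℝ → ℝ) (e : Estimates)
    (t : ℝ) (x : State) : ℝ :=
  let S := slidingVar χ e t x
  let z := x.2.1
  let Ξ := Xi P (C.κ x.1) z x.2.2 (e.φh t) (e.dφh t) (deriv χ z)
  let Υ := (P.kVeh - p |S| z) / (P.kVeh - kl z) * (Real.tan (e.φh t) + P.L * Ξ)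
    + P.L * p |S| z * Real.sign S
  sat P (Real.arctan Υ - e.βh t)

/-! ### Initial circle and initial deviations -/

/-- Orientation of the vehicle at time `t` under the constant steering angle `δ`. -/
def heading (P : Params) (w : Slip) (δ ψ₀ t : ℝ) : ℝ :=
  ψ₀ + ∫ τ in (0 : ℝ)..t, turnRate P (speed P (w.φ τ) (w.vs τ)) (w.φ τ) (w.β τ) δ

/-- Position of the vehicle at time `t` under the constant steering angle `δ`. -/
def position (P : Params) (w : Slip) (δ ψ₀ : ℝ) (ζ₀ : ℂ) (t : ℝ) : ℂ :=
  ζ₀ + ∫ τ in (0 : ℝ)..t, (speed P (w.φ τ) (w.vs τ) : ℂ) *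
    Complex.exp ((heading P w δ ψ₀ τ + w.φ τ : ℝ) * Complex.I)

/-- Maximal positional deviation over `[0, 2T]` that may be caused by slip. -/
def devPos (P : Params) (δ ψ₀ : ℝ) (ζ₀ : ℂ) : ℝ :=
  sSup {a | ∃ w : Slip, w.Admissible P ∧ ∃ t ∈ Icc 0 (2 * P.T),
    a = ‖position P Slip.none δ ψ₀ ζ₀ t - position P w δ ψ₀ ζ₀ t‖}

/-- Maximal angular deviation over `[0, 2T]` that may be caused by slip. -/
def devAng (P : Params) (δ ψ₀ : ℝ) : ℝ :=
  sSup {a | ∃ w : Slip, w.Admissible P ∧ ∃ t ∈ Icc 0 (2 * P.T),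
    a = |heading P Slip.none δ ψ₀ t - heading P w δ ψ₀ t|}

/-- The disc encircled by the trajectory of the motion without slip under the steering angle
`g * δ_max`, `g = ±1`, from the position `ζ₀` and orientation `ψ₀`. -/
def initialDisc (P : Params) (g ψ₀ : ℝ) (ζ₀ : ℂ) : Set ℂ :=
  Metric.closedBall (ζ₀ + (g * P.R : ℝ) * (Complex.I * Complex.exp (ψ₀ * Complex.I))) P.R

/-- Assumptions on the initial state `x₀ = (s₀, z₀, θ₀)`; `S₀` is the initial value of `S`. -/
structure InitialOK (P : Params) (C : RefPath) (x₀ : State) (S₀ : ℝ) : Prop where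
  closest : C.IsClosest x₀.1 (C.point x₀.1 x₀.2.1)
  angle : |x₀.2.2| ≤ Real.pi
  pos_mem : C.point x₀.1 x₀.2.1 ∈ C.domain P.lam
  disc_subset : S₀ ≠ 0 →
    Metric.cthickening
      (devPos P (P.dmax * Real.sign S₀) (C.tang x₀.1 - x₀.2.2) (C.point x₀.1 x₀.2.1))
      (initialDisc P (Real.sign S₀) (C.tang x₀.1 - x₀.2.2) (C.point x₀.1 x₀.2.1))
    ⊆ C.domain P.lam
  angle_dev : S₀ ≠ 0 → devAng P (P.dmax * Real.sign S₀) (C.tang x₀.1 - x₀.2.2) < Real.pi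

/-! ### The conclusion -/

/-- The vehicle driven by the steering law `u` from the initial state `x₀` converges to the path at
no less than the exponential rate and tracks it with the precision `ez`, the only root of
`χ ez = ePhi`. The constant `c` serves all motions, on finite and infinite time intervals `J`, while
the vehicle does not reach an end of the path (if any); `z` is indeed the signed distance. -/
def TracksExponentially (P : Params) (C : RefPath) (χ : ℝ → ℝ) (w : Slip) (u : ℝ → State → ℝ)
    (x₀ : State) : Prop :=
  ∃ ez : ℝ, (∀ z, χ z = P.ePhi ↔ z = ez) ∧ 0 < rightDeriv χ ez ∧
    ∃ c : ℝ, ∀ (J : Set ℝ) (x : ℝ → State), J.OrdConnected → (0 : ℝ) ∈ J → J ⊆ Ici 0 →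
      IsFilippovSolution (field P C w u) J x → x 0 = x₀ →
      (∀ t ∈ J, (x t).1 ∈ interior C.dom) →
      ∀ t ∈ J,
        C.IsClosest (x t).1 (C.point (x t).1 (x t).2.1) ∧
        C.kBar * |(x t).2.1| ≤ P.lam ∧
        |(x t).2.1| ≤ ez + c * Real.exp (-(rightDeriv χ ez * (P.vrw - P.vBar)) * t)

end BicycleTracking

end

noncomputable section

namespace BicycleTracking
open Filter Topology

/-! ### Absolutely continuous functions -/

/-! A motion passes through three stages, treated alike for both laws through the two abstract
properties `OuterLaw` and `InnerLaw` with a threshold `σ` on `|S|` (`σ = 0` for the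
maximal-actuation law).

While `|S| > σ`, the law acts as the constant steering angle `±δ_max`, up to an admissible change of
the bias `β`. In the plane this is one of the motions over which the deviations `d_dev` and `α` are
taken (`Motion.heading_position`), so the position stays in the disc of radius `R + d_dev` inside
the domain. To conclude that the coordinates `(s, z)` remain those of the closest point, one must
see what happens when the boundary of the domain is touched. Every admissible continuation of the
slip also stays in the disc; hence at the contact the velocity either points strictly inwards, or is
tangent, with an extreme slip angle and with the sense of rotation that turns it inwards
(`touching`, `Motion.inward_of_touching`). The stage ends by time `2T`: by then the vehicle has
turned by more than `4π - π`, while over a convex part of the domain the direction of the path at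
the closest point varies by at most `π` (`exists_angle`), which is incompatible with an unchanged
sign of `S` (`no_two_revolutions`).

The set `|S| ≤ σ` is then invariant: the steering term dominates the other terms of `dS/dt`, by the
maintainability inequality or by the choice of amplitudes. On the boundary of the domain `|χ|`
equals its maximum, which exceeds `φ_err + σ`, so `|z|` decreases there (`Motion.inner_invariant`).
Moreover, `S` vanishes within the time `σ / ε` and remains zero (`Motion.sliding_eq_zero`).

Once `S = 0`, `θ - φ = χ(z) - (φ - φ̂)`, so beyond the final zone `|z|` decays at the speed at least
`(v_rw - v̄) sin(χ(|z|) - φ_err)`. With `D = |z| - z_err`, the quantity `D exp(M D)` decays with the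
exact exponent `γ (v_rw - v̄)` (`exists_rate`, `Motion.tail`); this uses that `χ` is `C²` up to the
ends of its pieces. All bounds used for `c` are common to all motions.

Filippov's inclusion is used only by testing it on linear functionals (`filippov_le`).
Discontinuities of the curvature and kinks of `χ` are harmless: at almost every time when `s` or `z`
sits at one of them, its derivative is zero (`ae_hasDerivAt_eq_zero`). -/

theorem ac_sub_le {f : ℝ → ℝ} {a b m : ℝ} (hab : a ≤ b) (hf : AbsolutelyContinuousOnInterval f a b)
    (h : ∀ᵐ t, t ∈ Ioo a b → ∃ f', HasDerivAt f f' t ∧ f' ≤ m) : f b - f a ≤ m * (b - a) := by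
  rw [← hf.integral_deriv_eq_sub]
  have h1 : ∫ x in a..b, deriv f x ≤ ∫ _ in a..b, m := by
    apply intervalIntegral.integral_mono_ae_restrict hab hf.intervalIntegrable_deriv
      intervalIntegrable_const
    have h2 : ∀ᵐ t, t ≠ a := by simp [ae_iff, measure_singleton]
    have h3 : ∀ᵐ t, t ≠ b := by simp [ae_iff, measure_singleton]
    rw [EventuallyLE, ae_restrict_iff' measurableSet_Icc]
    filter_upwards [h, h2, h3] with t ht h2 h3 hm
    obtain ⟨f', h5, h6⟩ := ht ⟨lt_of_le_of_ne hm.1 (Ne.symm h2), lt_of_le_of_ne hm.2 h3⟩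
    rw [h5.deriv]; exact h6
  simpa [mul_comm] using h1

theorem ac_mono {X : Type*} [PseudoMetricSpace X] {f : ℝ → X} {a b c d : ℝ}
    (hf : AbsolutelyContinuousOnInterval f a b)
    (hac : a ≤ c) (hcd : c ≤ d) (hdb : d ≤ b) : AbsolutelyContinuousOnInterval f c d := by
  apply hf.mono
  rw [uIcc_of_le hcd, uIcc_of_le (hac.trans (hcd.trans hdb))]
  exact Icc_subset_Icc hac hdb

/-- A level which cannot be crossed upwards. -/
theorem ac_barrier {f : ℝ → ℝ} {a b c : ℝ} (hab : a ≤ b)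
    (hf : AbsolutelyContinuousOnInterval f a b) (ha : f a ≤ c)
    (h : ∀ᵐ t, t ∈ Ioo a b → c < f t → ∃ f', HasDerivAt f f' t ∧ f' ≤ 0) : f b ≤ c := by
  by_contra! hb
  have hcont : ContinuousOn f (Icc a b) := by
    have := hf.continuousOn; rwa [uIcc_of_le hab] at this
  -- After the last time at which `f ≤ c`, the hypothesis applies throughout, so `f` cannot grow.
  set A : Set ℝ := Icc a b ∩ f ⁻¹' Iic c with hA
  have hAc : IsClosed A := hcont.preimage_isClosed_of_isClosed isClosed_Icc isClosed_Iic
  have hAk : IsCompact A := isCompact_Icc.of_isClosed_subset hAc inter_subset_left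
  obtain ⟨t, htA, htm⟩ := hAk.exists_isGreatest ⟨a, ⟨le_rfl, hab⟩, ha⟩
  have hgt : ∀ x ∈ Ioc t b, c < f x := by
    intro x hx
    by_contra! hc
    exact absurd (htm ⟨⟨htA.1.1.trans hx.1.le, hx.2⟩, hc⟩) (not_le.2 hx.1)
  have := ac_sub_le (m := 0) htA.1.2 (ac_mono hf htA.1.1 htA.1.2 le_rfl) (by
    filter_upwards [h] with x hx hxm
    exact hx ⟨htA.1.1.trans_lt hxm.1, hxm.2⟩ (hgt x ⟨hxm.1, hxm.2.le⟩))
  have h2 : f t ≤ c := htA.2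
  linarith

theorem ac_comp_lipschitz {X Y : Type*} [PseudoMetricSpace X] [PseudoMetricSpace Y] {f : ℝ → X}
    {h : X → Y} {a b K : ℝ} {s : Set X} (hK : 0 ≤ K)
    (hf : AbsolutelyContinuousOnInterval f a b)
    (hs : ∀ t ∈ uIcc a b, f t ∈ s) (hh : ∀ x ∈ s, ∀ y ∈ s, dist (h x) (h y) ≤ K * dist x y) :
    AbsolutelyContinuousOnInterval (fun t => h (f t)) a b := by
  rw [absolutelyContinuousOnInterval_iff] at hf ⊢
  intro ε hε
  -- The divisor is `K + 1` because `K` may be zero.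
  obtain ⟨δ, hδ, H⟩ := hf (ε / (K + 1)) (by positivity)
  refine ⟨δ, hδ, fun E hE hE2 => ?_⟩
  have h1 := H E hE hE2
  calc _ ≤ ∑ i ∈ Finset.range E.1, K * dist (f (E.2 i).1) (f (E.2 i).2) := by
        apply Finset.sum_le_sum
        intro i hi
        have := hE.1 i hi
        exact hh _ (hs _ this.1) _ (hs _ this.2)
    _ = K * ∑ i ∈ Finset.range E.1, dist (f (E.2 i).1) (f (E.2 i).2) := by rw [Finset.mul_sum]
    _ ≤ K * (ε / (K + 1)) := by gcongr
    _ < ε := by rw [mul_div_assoc', div_lt_iff₀ (by positivity)]; nlinarith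

theorem countable_of_finite_Icc {B : Set ℝ} (h : ∀ a b : ℝ, (B ∩ Icc a b).Finite) :
    B.Countable := by
  have : B = ⋃ n : ℕ, B ∩ Icc (-(n : ℝ)) n := by
    ext x
    simp only [mem_iUnion, mem_inter_iff, mem_Icc]
    refine ⟨fun hx => ?_, fun ⟨n, hn⟩ => hn.1⟩
    obtain ⟨n, hn⟩ := exists_nat_ge |x|
    exact ⟨n, hx, by linarith [neg_abs_le x], by linarith [le_abs_self x]⟩
  rw [this]
  exact countable_iUnion fun n => (h _ _).countable

/-- Almost everywhere, a function with values in a countable set has zero derivative. -/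
theorem ae_hasDerivAt_eq_zero (f : ℝ → ℝ) {B : Set ℝ} (hB : B.Countable) :
    ∀ᵐ t, f t ∈ B → ∀ f', HasDerivAt f f' t → f' = 0 := by
  -- Points of a level set at which the derivative is nonzero are isolated from each other, and a
  -- discrete subset of the line is countable.
  have key : ∀ b : ℝ, {t | f t = b ∧ ∃ f', f' ≠ 0 ∧ HasDerivAt f f' t}.Countable := by
    intro b
    set A := {t | f t = b ∧ ∃ f', f' ≠ 0 ∧ HasDerivAt f f' t}
    have : DiscreteTopology A := by
      rw [discreteTopology_subtype_iff]
      rintro t ⟨ht, f', hf', hd⟩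
      rw [inf_principal_eq_bot]
      filter_upwards [hd.eventually_ne (c := b) hf'] with x hx hxA
      exact hx hxA.1
    exact Set.countable_coe_iff.1 (TopologicalSpace.separableSpace_iff_countable.1 inferInstance)
  have h2 : (⋃ b ∈ B, {t | f t = b ∧ ∃ f', f' ≠ 0 ∧ HasDerivAt f f' t}).Countable :=
    hB.biUnion fun b _ => key b
  filter_upwards [h2.ae_notMem volume] with t ht htB f' hf'
  by_contra hne
  exact ht (mem_biUnion htB ⟨rfl, f', hne, hf'⟩)

/-- The interval is cut at the exceptional points, which continuity bridges. This carries mean value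
estimates across breakpoints of the curvature and kinks of `χ`. -/
theorem le_of_hasDerivAt_off_finite {f : ℝ → ℝ} {F : Set ℝ} (hF : F.Finite) :
    ∀ {a b : ℝ}, a ≤ b → ContinuousOn f (Icc a b) →
      (∀ u ∈ Ioo a b \ F, ∃ f', HasDerivAt f f' u ∧ 0 ≤ f') → f a ≤ f b := by
  induction F, hF using Set.Finite.induction_on with
  | empty =>
    intro a b hab hc hd
    have : MonotoneOn f (Icc a b) := by
      apply monotoneOn_of_deriv_nonneg (convex_Icc a b) hc
      · rw [interior_Icc]
        intro x hx
        obtain ⟨f', h, _⟩ := hd x ⟨hx, by simp⟩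
        exact h.differentiableAt.differentiableWithinAt
      · rw [interior_Icc]
        intro x hx
        obtain ⟨f', h, h0⟩ := hd x ⟨hx, by simp⟩
        rw [h.deriv]; exact h0
    exact this (left_mem_Icc.2 hab) (right_mem_Icc.2 hab) hab
  | @insert c F _ _ ih =>
    intro a b hab hc hd
    by_cases hcm : c ∈ Ioo a b
    · have h1 : f a ≤ f c := ih hcm.1.le (hc.mono (Icc_subset_Icc le_rfl hcm.2.le))
        fun u hu => hd u ⟨⟨hu.1.1, hu.1.2.trans hcm.2⟩, by
          rintro (h | h)
          · exact absurd hu.1.2 (by rw [h]; exact lt_irrefl c)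
          · exact hu.2 h⟩
      have h2 : f c ≤ f b := ih hcm.2.le (hc.mono (Icc_subset_Icc hcm.1.le le_rfl))
        fun u hu => hd u ⟨⟨hcm.1.trans hu.1.1, hu.1.2⟩, by
          rintro (h | h)
          · exact absurd hu.1.1 (by rw [h]; exact lt_irrefl c)
          · exact hu.2 h⟩
      exact h1.trans h2
    · exact ih hab hc fun u hu => hd u ⟨hu.1, by
        rintro (h | h)
        · exact hcm (h ▸ hu.1)
        · exact hu.2 h⟩

/-! ### Geometry of the path -/

namespace RefPath

/-- Unit tangent. -/
def dir (C : RefPath) (s : ℝ) : ℂ := Complex.exp (C.tang s * Complex.I)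

theorem norm_dir (C : RefPath) (s : ℝ) : ‖C.dir s‖ = 1 := Complex.norm_exp_ofReal_mul_I _

theorem point_eq (C : RefPath) (s z : ℝ) : C.point s z = C.r s + z * (Complex.I * C.dir s) := rfl

theorem abs_κ_le (C : RefPath) {s : ℝ} (hs : s ∈ C.dom \ C.brk) : |C.κ s| ≤ C.kBar :=
  le_csSup C.κ_bdd ⟨s, hs, rfl⟩

theorem brk_countable (C : RefPath) : C.brk.Countable :=
  countable_of_finite_Icc C.brk_locallyFinite

theorem Icc_subset_dom (C : RefPath) {a b : ℝ} (ha : a ∈ C.dom) (hb : b ∈ C.dom) :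
    Icc a b ⊆ C.dom := C.dom_ordConnected.out ha hb

theorem Ioo_subset_interior (C : RefPath) {a b : ℝ} (ha : a ∈ C.dom) (hb : b ∈ C.dom) :
    Ioo a b ⊆ interior C.dom :=
  interior_maximal (Ioo_subset_Icc_self.trans (C.Icc_subset_dom ha hb)) isOpen_Ioo

theorem exists_regular (C : RefPath) : (C.dom \ C.brk).Nonempty := by
  by_contra! h
  have h1 : C.dom ⊆ C.brk := by rwa [sdiff_eq_empty] at h
  have h2 : (interior C.dom).Countable := C.brk_countable.mono (interior_subset.trans h1)
  obtain ⟨x, hx⟩ := C.dom_interior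
  have h3 := (h2.measure_zero volume)
  exact (isOpen_interior.measure_pos volume ⟨x, hx⟩).ne' h3

theorem kBar_nonneg (C : RefPath) : 0 ≤ C.kBar := by
  obtain ⟨s, hs⟩ := C.exists_regular
  exact (abs_nonneg _).trans (C.abs_κ_le hs)

theorem hasDerivAt_tang (C : RefPath) {s : ℝ} (hs : s ∈ interior C.dom) (hb : s ∉ C.brk) :
    HasDerivAt C.tang (C.κ s) s :=
  (C.hasDeriv_tang s ⟨interior_subset hs, hb⟩).hasDerivAt (mem_interior_iff_mem_nhds.1 hs)

theorem hasDerivAt_r (C : RefPath) {s : ℝ} (hs : s ∈ interior C.dom) :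
    HasDerivAt C.r (C.dir s) s :=
  (C.hasDeriv_r s (interior_subset hs)).hasDerivAt (mem_interior_iff_mem_nhds.1 hs)

theorem r_cont (C : RefPath) : ContinuousOn C.r C.dom :=
  fun s hs => (C.hasDeriv_r s hs).continuousWithinAt

theorem dir_cont (C : RefPath) : ContinuousOn C.dir C.dom := by
  unfold dir
  have := C.tang_cont
  fun_prop

theorem dist_r_le (C : RefPath) {s s' : ℝ} (hs : s ∈ C.dom) (hs' : s' ∈ C.dom) :
    dist (C.r s) (C.r s') ≤ |s - s'| := by
  have := C.dom_ordConnected.convex.norm_image_sub_le_of_norm_hasDerivWithin_le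
    (fun x hx => C.hasDeriv_r x hx) (C := 1)
    (fun x _ => (C.norm_dir x).le) hs' hs
  simpa [dist_eq_norm] using this

theorem tang_sub_le (C : RefPath) {a b : ℝ} (ha : a ∈ C.dom) (hb : b ∈ C.dom) (hab : a ≤ b) :
    |C.tang b - C.tang a| ≤ C.kBar * (b - a) := by
  have hsub := C.Icc_subset_dom ha hb
  have hbrk : ∀ u ∈ Ioo a b \ (C.brk ∩ Icc a b), u ∈ interior C.dom ∧ u ∉ C.brk := fun u hu =>
    ⟨C.Ioo_subset_interior ha hb hu.1, fun h => hu.2 ⟨h, Ioo_subset_Icc_self hu.1⟩⟩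
  have hc := C.tang_cont.mono hsub
  have h1 := le_of_hasDerivAt_off_finite (f := fun u => C.kBar * u - C.tang u)
    (C.brk_locallyFinite a b) hab (by fun_prop) (fun u hu => by
      obtain ⟨h1, h2⟩ := hbrk u hu
      refine ⟨_, ((hasDerivAt_id u).const_mul C.kBar).sub (C.hasDerivAt_tang h1 h2), ?_⟩
      have := C.abs_κ_le ⟨interior_subset h1, h2⟩
      linarith [le_abs_self (C.κ u)])
  have h2 := le_of_hasDerivAt_off_finite (f := fun u => C.kBar * u + C.tang u)
    (C.brk_locallyFinite a b) hab (by fun_prop) (fun u hu => by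
      obtain ⟨h1, h2⟩ := hbrk u hu
      refine ⟨_, ((hasDerivAt_id u).const_mul C.kBar).add (C.hasDerivAt_tang h1 h2), ?_⟩
      have := C.abs_κ_le ⟨interior_subset h1, h2⟩
      linarith [neg_abs_le (C.κ u)])
  rw [abs_le]
  constructor <;> linarith

theorem abs_tang_sub_le (C : RefPath) {a b : ℝ} (ha : a ∈ C.dom) (hb : b ∈ C.dom) :
    |C.tang a - C.tang b| ≤ C.kBar * |a - b| := by
  rcases le_total a b with h | h
  · rw [abs_sub_comm, abs_sub_comm a, abs_of_nonneg (sub_nonneg.2 h)]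
    exact C.tang_sub_le ha hb h
  · rw [abs_of_nonneg (sub_nonneg.2 h)]
    exact C.tang_sub_le hb ha h

theorem dist_point_r (C : RefPath) (s z : ℝ) : dist (C.point s z) (C.r s) = |z| := by
  simp [point_eq, dist_eq_norm, C.norm_dir]

theorem hasDerivAt_dir (C : RefPath) {s : ℝ} (hs : s ∈ interior C.dom) (hb : s ∉ C.brk) :
    HasDerivAt C.dir (C.κ s * (Complex.I * C.dir s)) s := by
  have h := (((C.hasDerivAt_tang hs hb).ofReal_comp).mul_const Complex.I).cexp
  unfold dir
  convert! h using 1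
  ring

theorem inner_dir_I (C : RefPath) (s : ℝ) : inner ℝ (Complex.I * C.dir s) (C.dir s) = 0 := by
  rw [Complex.inner]; simp; ring

/-- A piece of the path does not enter the circle of radius `|z|` tangent to this piece. -/
theorem le_dist_point (C : RefPath) {s s' z δ : ℝ} (hs : s ∈ C.dom) (hs' : s' ∈ C.dom)
    (hδ : C.kBar * (|z| + δ) ≤ 1) (hss : |s' - s| ≤ δ) : |z| ≤ dist (C.point s z) (C.r s') := by
  set p := C.point s z with hp
  -- `2 * h` is the derivative of the squared distance to `p`. It vanishes at `s`, as `p` lies on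
  -- the normal, and `h' = 1 + κ ⟪r - p, I * dir⟫ ≥ 1 - kBar * (|z| + δ) ≥ 0`, so the distance does
  -- not decrease on going away from `s` in either direction.
  set h : ℝ → ℝ := fun u => inner ℝ (C.r u - p) (C.dir u) with hh
  have hs0 : h s = 0 := by
    have : C.r s - p = (-z : ℝ) • (Complex.I * C.dir s) := by
      rw [hp, point_eq, Complex.real_smul]; push_cast; ring
    simp only [hh]
    rw [this, inner_smul_left, inner_dir_I]; simp
  have hder : ∀ u ∈ interior C.dom, u ∉ C.brk → |u - s| ≤ δ →
      ∃ h', HasDerivAt h h' u ∧ 0 ≤ h' := by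
    intro u hu hb hus
    refine ⟨_, ((C.hasDerivAt_r hu).sub_const p).inner ℝ (C.hasDerivAt_dir hu hb), ?_⟩
    have h1 : ‖C.r u - p‖ ≤ |z| + δ := by
      have h2 := dist_triangle (C.r u) (C.r s) p
      have h3 := C.dist_r_le (interior_subset hu) hs
      have h4 : dist (C.r s) p = |z| := by rw [dist_comm]; exact C.dist_point_r s z
      rw [← dist_eq_norm]; linarith
    have h5 := abs_real_inner_le_norm (C.r u - p) (C.κ u * (Complex.I * C.dir u))
    have h6 : ‖(C.κ u : ℂ) * (Complex.I * C.dir u)‖ ≤ C.kBar := by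
      simpa [C.norm_dir] using C.abs_κ_le ⟨interior_subset hu, hb⟩
    have h7 : ‖C.r u - p‖ * ‖(C.κ u : ℂ) * (Complex.I * C.dir u)‖ ≤ (|z| + δ) * C.kBar := by
      gcongr
      exact (norm_nonneg _).trans h1
    rw [real_inner_self_eq_norm_sq, C.norm_dir]
    linarith [neg_abs_le (inner ℝ (C.r u - p) (C.κ u * (Complex.I * C.dir u)))]
  have hcont : ContinuousOn h C.dom :=
    (C.r_cont.sub continuousOn_const).inner C.dir_cont
  have hg : ∀ u ∈ interior C.dom,
      HasDerivAt (fun u => ‖C.r u - p‖ ^ 2) (2 * h u) u := fun u hu =>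
    ((C.hasDerivAt_r hu).sub_const p).norm_sq
  have hgc : ContinuousOn (fun u => ‖C.r u - p‖ ^ 2) C.dom :=
    ((C.r_cont.sub continuousOn_const).norm).pow 2
  have hfin : ‖C.r s - p‖ ^ 2 ≤ ‖C.r s' - p‖ ^ 2 := by
    rcases le_total s s' with hle | hle
    · have hsub := C.Icc_subset_dom hs hs'
      refine le_of_hasDerivAt_off_finite finite_empty hle (hgc.mono hsub) fun u hu => ?_
      have hui := C.Ioo_subset_interior hs hs' hu.1
      refine ⟨_, hg u hui, ?_⟩
      have : h s ≤ h u := by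
        refine le_of_hasDerivAt_off_finite (C.brk_locallyFinite s u) hu.1.1.le
          (hcont.mono ((Icc_subset_Icc le_rfl hu.1.2.le).trans hsub)) fun x hx => ?_
        refine hder x (C.Ioo_subset_interior hs (interior_subset hui) hx.1)
          (fun hb => hx.2 ⟨hb, Ioo_subset_Icc_self hx.1⟩) ?_
        rw [abs_of_nonneg (by linarith [hx.1.1])]
        rw [abs_of_nonneg (by linarith)] at hss
        linarith [hx.1.2, hu.1.2]
      linarith
    · have hsub := C.Icc_subset_dom hs' hs
      have := le_of_hasDerivAt_off_finite (f := fun u => -‖C.r u - p‖ ^ 2)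
        finite_empty hle (hgc.mono hsub).neg fun u hu => by
        have hui := C.Ioo_subset_interior hs' hs hu.1
        refine ⟨_, (hg u hui).neg, ?_⟩
        have : h u ≤ h s := by
          refine le_of_hasDerivAt_off_finite (C.brk_locallyFinite u s) hu.1.2.le
            (hcont.mono ((Icc_subset_Icc hu.1.1.le le_rfl).trans hsub)) fun x hx => ?_
          refine hder x (C.Ioo_subset_interior (interior_subset hui) hs hx.1)
            (fun hb => hx.2 ⟨hb, Ioo_subset_Icc_self hx.1⟩) ?_
          rw [abs_of_nonpos (by linarith [hx.1.2])]
          rw [abs_of_nonpos (by linarith)] at hss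
          linarith [hx.1.1, hu.1.1]
        linarith
      simpa using this
  have h8 := abs_le_of_sq_le_sq hfin (norm_nonneg _)
  rw [abs_of_nonneg (norm_nonneg _), ← dist_eq_norm, ← dist_eq_norm, dist_comm, C.dist_point_r,
    dist_comm] at h8
  exact h8

/-! ### Closest points -/

theorem IsClosest.distTo_eq {C : RefPath} {s : ℝ} {ζ : ℂ} (h : C.IsClosest s ζ) :
    C.distTo ζ = dist ζ (C.r s) := by
  apply le_antisymm
  · exact Metric.infDist_le_dist_of_mem ⟨s, h.1, rfl⟩
  · rw [distTo, Metric.le_infDist ⟨_, mem_image_of_mem _ h.1⟩]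
    rintro _ ⟨s', hs', rfl⟩
    exact h.2 s' hs'

theorem IsClosest.distTo_point {C : RefPath} {s z : ℝ} (h : C.IsClosest s (C.point s z)) :
    C.distTo (C.point s z) = |z| := by rw [h.distTo_eq, C.dist_point_r]

theorem distTo_le (C : RefPath) {s : ℝ} (hs : s ∈ C.dom) (ζ : ℂ) : C.distTo ζ ≤ dist ζ (C.r s) :=
  Metric.infDist_le_dist_of_mem ⟨s, hs, rfl⟩

theorem isClosest_of_le {C : RefPath} {s : ℝ} {ζ : ℂ} (hs : s ∈ C.dom)
    (h : dist ζ (C.r s) ≤ C.distTo ζ) : C.IsClosest s ζ :=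
  ⟨hs, fun _ hs' => h.trans (C.distTo_le hs' ζ)⟩

theorem distTo_le_add (C : RefPath) (ζ ζ' : ℂ) : C.distTo ζ ≤ C.distTo ζ' + dist ζ ζ' :=
  Metric.infDist_le_infDist_add_dist

theorem shift_mem (C : RefPath) {s : ℝ} (hs : s ∈ C.dom) (k : ℤ) : s + k * C.period ∈ C.dom := by
  rcases C.period_dom with h | h
  · simpa [h] using hs
  · rw [h]; trivial

theorem r_shift (C : RefPath) {s : ℝ} (hs : s ∈ C.dom) (k : ℤ) :
    C.r (s + k * C.period) = C.r s :=
  ((C.simple s hs _ (C.shift_mem hs k)).2 ⟨k, rfl⟩).symm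

/-- Differentiating the periodic `r`; the angle `tang` itself need not be periodic. -/
theorem dir_shift (C : RefPath) (s : ℝ) (k : ℤ) :
    C.dir (s + k * C.period) = C.dir s := by
  rcases C.period_dom with h | h
  · simp [h]
  · have hall : ∀ x, HasDerivAt C.r (C.dir x) x := fun x => C.hasDerivAt_r (by simp [h])
    have h1 : HasDerivAt (fun x => C.r (x + k * C.period)) (C.dir (s + k * C.period)) s :=
      (hall _).comp_add_const s (k * C.period)
    have h2 : (fun x => C.r (x + k * C.period)) = C.r := by
      ext1 x; exact C.r_shift (by simp [h]) k
    rw [h2] at h1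
    exact h1.unique (hall s)

theorem dir_eq_of_r_eq (C : RefPath) {s s' : ℝ} (hs : s ∈ C.dom) (hs' : s' ∈ C.dom)
    (h : C.r s = C.r s') : C.dir s = C.dir s' := by
  obtain ⟨k, rfl⟩ := (C.simple s hs s' hs').1 h
  exact (C.dir_shift s k).symm

theorem ClosestWellDefined.exists_isClosest {C : RefPath} {lam : ℝ}
    (hC : C.ClosestWellDefined lam) {ζ : ℂ} (hζ : C.kBar * C.distTo ζ ≤ lam) :
    ∃ s, C.IsClosest s ζ := by
  obtain ⟨_, ⟨s, _, h⟩, _⟩ := hC ζ hζ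
  exact ⟨s, h⟩

theorem ClosestWellDefined.r_eq {C : RefPath} {lam : ℝ}
    (hC : C.ClosestWellDefined lam) {ζ : ℂ} (hζ : C.kBar * C.distTo ζ ≤ lam) {s s' : ℝ}
    (hs : C.IsClosest s ζ) (hs' : C.IsClosest s' ζ) : C.r s = C.r s' := by
  obtain ⟨q, _, h⟩ := hC ζ hζ
  rw [h _ ⟨s, rfl, hs⟩, h _ ⟨s', rfl, hs'⟩]

/-- Points which are almost closest are near the closest one. -/
theorem ClosestWellDefined.stable {C : RefPath} {lam : ℝ}
    (hC : C.ClosestWellDefined lam) {ζ : ℂ} (hζ : C.kBar * C.distTo ζ ≤ lam) {s : ℝ}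
    (hs : C.IsClosest s ζ) {δ : ℝ} (hδ : 0 < δ) :
    ∃ ρ > 0, ∀ ζ' s', s' ∈ C.dom → dist ζ' ζ < ρ → dist ζ' (C.r s') < C.distTo ζ + ρ →
      ∃ k : ℤ, |s' + k * C.period - s| < δ := by
  -- The final radius is at most 1, so almost closest points lie within `distTo ζ + 2` of `ζ`;
  -- properness then confines their abscissas to a compact set modulo the period.
  obtain ⟨M, hM⟩ := C.proper (‖ζ‖ + C.distTo ζ + 2)
  set Q : Set ℝ := Icc (-M) M ∩ C.dom ∩ {u | ∀ k : ℤ, δ ≤ |u + k * C.period - s|} with hQ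
  have hQc : IsCompact Q := by
    apply (isCompact_Icc.inter_right C.dom_closed).inter_right
    simp only [ofPred_forall]
    exact isClosed_iInter fun k => isClosed_le continuous_const (by fun_prop)
  -- On the compact set of abscissas that are `δ`-far from `s` modulo the period, the distance
  -- attains its minimum, which exceeds `distTo ζ` by uniqueness of the closest point.
  have hgap : ∃ ρ > 0, ∀ u ∈ Q, C.distTo ζ + 2 * ρ ≤ dist ζ (C.r u) := by
    rcases Q.eq_empty_or_nonempty with h | h
    · exact ⟨1, one_pos, by simp [h]⟩
    · obtain ⟨m, hm, hmin⟩ := hQc.exists_isMinOn h (f := fun u => dist ζ (C.r u))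
        ((continuous_const.dist continuous_id).comp_continuousOn (C.r_cont.mono fun u hu => hu.1.2))
      have hpos : C.distTo ζ < dist ζ (C.r m) := by
        by_contra! hle
        have h1 := hC.r_eq hζ (isClosest_of_le hm.1.2 hle) hs
        obtain ⟨k, hk⟩ := (C.simple m hm.1.2 s hs.1).1 h1
        have := hm.2 k
        rw [← hk] at this
        simp at this
        linarith
      refine ⟨(dist ζ (C.r m) - C.distTo ζ) / 2, by linarith, fun u hu => ?_⟩
      have := hmin hu
      simp only [mem_ofPred_eq] at this
      linarith
  obtain ⟨ρ, hρ, hgap⟩ := hgap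
  refine ⟨min ρ 1, by positivity, fun ζ' s' hs' h1 h2 => ?_⟩
  have hd : dist ζ (C.r s') < C.distTo ζ + 2 * ρ ∧ dist ζ (C.r s') < C.distTo ζ + 2 := by
    have := dist_triangle_left ζ (C.r s') ζ'
    constructor <;> linarith [min_le_left ρ 1, min_le_right ρ 1]
  obtain ⟨k, hk⟩ := hM s' hs' (by
    have := dist_triangle_left 0 (C.r s') ζ
    rw [dist_zero_left, dist_zero_right] at this
    linarith)
  by_contra! hcon
  have hmem : s' + k * C.period ∈ Q := by
    refine ⟨⟨abs_le.1 hk, C.shift_mem hs' k⟩, fun j => ?_⟩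
    have := hcon (k + j)
    push_cast at this
    rwa [show s' + k * C.period + j * C.period - s = s' + (k + j) * C.period - s by ring]
  have := hgap _ hmem
  rw [C.r_shift hs'] at this
  linarith

/-- The normal coordinates furnish the closest point nearby. -/
theorem ClosestWellDefined.eventually_isClosest {C : RefPath} {lam : ℝ} (hlam : lam < 1)
    (hC : C.ClosestWellDefined lam) {s z : ℝ} (hs : s ∈ interior C.dom)
    (hz : C.kBar * |z| ≤ lam) (h : C.IsClosest s (C.point s z)) :
    ∀ᶠ q : ℝ × ℝ in 𝓝 (s, z), C.IsClosest q.1 (C.point q.1 q.2) := by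
  have hk := C.kBar_nonneg
  -- A competitor closer than `|z'|` is placed by `stable` within `δ` of `s`, hence within `2 * δ`
  -- of `s'`. As `|z'| ≤ |z| + δ`, this choice gives `kBar * (|z'| + 2 * δ) ≤ 1`, and
  -- `le_dist_point` excludes the competitor.
  set δ := (1 - lam) / (4 * (C.kBar + 1)) with hδ
  have hδ0 : 0 < δ := div_pos (by linarith) (by positivity)
  have hδ1 : C.kBar * (4 * δ) ≤ 1 - lam := by
    have : (C.kBar + 1) * (4 * δ) = 1 - lam := by rw [hδ]; field_simp
    nlinarith
  have hd := h.distTo_point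
  obtain ⟨ρ, hρ, H⟩ := hC.stable (by rwa [hd]) h hδ0
  have hcont : Tendsto (fun q : ℝ × ℝ => C.point q.1 q.2) (𝓝 (s, z)) (𝓝 (C.point s z)) := by
    have h1 : ContinuousAt C.r s := C.r_cont.continuousAt (mem_interior_iff_mem_nhds.1 hs)
    have h2 : ContinuousAt C.dir s := C.dir_cont.continuousAt (mem_interior_iff_mem_nhds.1 hs)
    simp only [point_eq]
    have h3 : ContinuousAt (fun q : ℝ × ℝ => C.r q.1) (s, z) := h1.comp (f := Prod.fst) (x := (s, z)) continuousAt_fst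
    have h4 : ContinuousAt (fun q : ℝ × ℝ => C.dir q.1) (s, z) :=
      h2.comp (f := Prod.fst) (x := (s, z)) continuousAt_fst
    have h5 : ContinuousAt (fun q : ℝ × ℝ => (q.2 : ℂ)) (s, z) := by fun_prop
    exact h3.add (h5.mul (continuousAt_const.mul h4))
  have e1 : ∀ᶠ q : ℝ × ℝ in 𝓝 (s, z), dist (C.point q.1 q.2) (C.point s z) < ρ :=
    hcont (Metric.ball_mem_nhds _ hρ)
  have e2 : ∀ᶠ q : ℝ × ℝ in 𝓝 (s, z), q.1 ∈ interior C.dom :=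
    continuous_fst.continuousAt (isOpen_interior.mem_nhds hs)
  have e3 : ∀ᶠ q : ℝ × ℝ in 𝓝 (s, z), |q.1 - s| < δ := by
    have : ContinuousAt (fun q : ℝ × ℝ => |q.1 - s|) (s, z) := by fun_prop
    exact this.eventually_lt continuousAt_const (by simpa using hδ0)
  have e4 : ∀ᶠ q : ℝ × ℝ in 𝓝 (s, z), |(|q.2| - |z|)| < min δ ρ := by
    have : ContinuousAt (fun q : ℝ × ℝ => |(|q.2| - |z|)|) (s, z) := by fun_prop
    exact this.eventually_lt continuousAt_const (by simpa using ⟨hδ0, hρ⟩)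
  filter_upwards [e1, e2, e3, e4] with ⟨s', z'⟩ h1 h2 h3 h4
  simp only at h1 h2 h3 h4
  refine ⟨interior_subset h2, fun u hu => ?_⟩
  rw [C.dist_point_r]
  by_contra! hlt
  have h5 := abs_lt.1 (h4.trans_le (min_le_left _ _))
  have h6 := abs_lt.1 (h4.trans_le (min_le_right _ _))
  obtain ⟨k, hk'⟩ := H _ u hu h1 (by rw [hd]; linarith)
  have h7 := C.le_dist_point (z := z') (δ := 2 * δ) (interior_subset h2) (C.shift_mem hu k) (by
      nlinarith) (by
      have := abs_sub_le (u + k * C.period) s s'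
      rw [abs_sub_comm s s'] at this
      linarith)
  rw [C.r_shift hu] at h7
  linarith

end RefPath

/-! ### Direction of the path at the closest point, and exit from the domain. -/

theorem eq_inner_add_inner {d : ℂ} (hd : ‖d‖ = 1) (w : ℂ) :
    w = (inner ℝ d w : ℝ) * d + (inner ℝ (Complex.I * d) w : ℝ) * (Complex.I * d) := by
  have h1 : (starRingEnd ℂ) d * d = 1 := by
    rw [mul_comm, Complex.mul_conj, Complex.normSq_eq_norm_sq, hd]; simp
  have h2 : (inner ℝ (Complex.I * d) w : ℝ) = ((starRingEnd ℂ) d * w).im := by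
    rw [Complex.inner]; simp; ring
  have h3 : (inner ℝ d w : ℝ) = ((starRingEnd ℂ) d * w).re := by rw [Complex.inner, mul_comm]
  have h4 := Complex.re_add_im ((starRingEnd ℂ) d * w)
  rw [h2, h3]
  calc w = ((starRingEnd ℂ) d * w) * d := by linear_combination (-w) * h1
    _ = _ := by rw [← h4]; simp; ring

/-- A continuous function without zeros on a convex set has a continuous logarithm. -/
theorem exists_log_of_convex {K : Set ℂ} (hK : Convex ℝ K) (hne : K.Nonempty) {g : ℂ → ℂ}
    (hg : ContinuousOn g K) (h0 : ∀ x ∈ K, g x ≠ 0) :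
    ∃ f : ℂ → ℂ, ContinuousOn f K ∧ ∀ x ∈ K, Complex.exp (f x) = g x := by
  classical
  have := hK.locallyPathConnectedSpace
  have := hK.contractibleSpace hne
  obtain ⟨x₀, hx₀⟩ := hne
  -- A convex set is simply connected and locally path connected, so the map lifts through the
  -- covering `exp` of the punctured plane.
  rcases Complex.isCoveringMapOn_exp.existsUnique_continuousMap_lifts
    ⟨K.domRestrict g, continuousOn_iff_continuous_domRestrict.mp hg⟩
    (a₀ := ⟨x₀, hx₀⟩) (Complex.exp_log (h0 x₀ hx₀))
    (fun x ↦ h0 x x.2) with ⟨f, ⟨-, hf⟩, -⟩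
  refine ⟨fun z => if hz : z ∈ K then f ⟨z, hz⟩ else 0, ?_, fun x hx => ?_⟩
  · rw [continuousOn_iff_continuous_domRestrict]
    convert! map_continuous f
    ext z
    simp [domRestrict]
  · simpa [hx] using congr($hf ⟨x, hx⟩)

namespace RefPath

/-- First-order condition: at an interior abscissa, `ζ - r s` has no tangential component. -/
theorem IsClosest.eq_point {C : RefPath} {s : ℝ} {ζ : ℂ} (h : C.IsClosest s ζ)
    (hs : s ∈ interior C.dom) :
    ζ = C.point s (inner ℝ (Complex.I * C.dir s) (ζ - C.r s)) := by
  have hd : HasDerivAt (fun u => ‖C.r u - ζ‖ ^ 2) (2 * inner ℝ (C.r s - ζ) (C.dir s)) s :=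
    ((C.hasDerivAt_r hs).sub_const ζ).norm_sq
  have hm : IsLocalMin (fun u => ‖C.r u - ζ‖ ^ 2) s := by
    filter_upwards [mem_interior_iff_mem_nhds.1 hs] with u hu
    have := h.2 u hu
    rw [dist_eq_norm, dist_eq_norm, norm_sub_rev, norm_sub_rev ζ] at this
    gcongr
  have h0 : inner ℝ (C.dir s) (ζ - C.r s) = 0 := by
    have := hm.hasDerivAt_eq_zero hd
    rw [← neg_sub, inner_neg_right, real_inner_comm]
    linarith
  have := eq_inner_add_inner (C.norm_dir s) (ζ - C.r s)
  rw [h0, Complex.ofReal_zero, zero_mul, zero_add] at this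
  rw [point_eq]
  linear_combination this

theorem domain_interior {C : RefPath} {lam : ℝ} {ζ : ℂ} (h : ζ ∈ C.domain lam) {s : ℝ}
    (hs : C.IsClosest s ζ) : s ∈ interior C.dom := h.2 s hs

/-- Direction of the path at the point closest to `ζ`. -/
def closestDir (C : RefPath) (ζ : ℂ) : ℂ := C.dir (Classical.epsilon fun s => C.IsClosest s ζ)

/-- The choice of the abscissa in `closestDir` is immaterial, because closest abscissas differ by
multiples of the period. -/
theorem ClosestWellDefined.closestDir_eq {C : RefPath} {lam : ℝ}
    (hC : C.ClosestWellDefined lam) {ζ : ℂ} (hζ : C.kBar * C.distTo ζ ≤ lam) {s : ℝ}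
    (hs : C.IsClosest s ζ) : C.closestDir ζ = C.dir s := by
  have h : C.IsClosest (Classical.epsilon fun s => C.IsClosest s ζ) ζ :=
    Classical.epsilon_spec (p := fun s => C.IsClosest s ζ) ⟨s, hs⟩
  exact C.dir_eq_of_r_eq h.1 hs.1 (hC.r_eq hζ h hs)

theorem ClosestWellDefined.closestDir_cont {C : RefPath} {lam : ℝ}
    (hC : C.ClosestWellDefined lam) :
    ContinuousOn C.closestDir {ζ | C.kBar * C.distTo ζ ≤ lam} := by
  intro ζ hζ
  obtain ⟨s, hs⟩ := hC.exists_isClosest hζ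
  rw [Metric.continuousWithinAt_iff]
  intro ε hε
  have h1 := Metric.continuousOn_iff.1 C.dir_cont s hs.1 ε hε
  obtain ⟨δ, hδ, h1⟩ := h1
  obtain ⟨ρ, hρ, H⟩ := hC.stable hζ hs hδ
  refine ⟨ρ / 2, by linarith, fun ζ' hζ' hd => ?_⟩
  obtain ⟨s', hs'⟩ := hC.exists_isClosest hζ'
  rw [hC.closestDir_eq hζ hs, hC.closestDir_eq hζ' hs']
  obtain ⟨k, hk⟩ := H ζ' s' hs'.1 (by linarith) (by
    rw [← hs'.distTo_eq]
    linarith [C.distTo_le_add ζ' ζ])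
  rw [← C.dir_shift s' k]
  exact h1 _ (C.shift_mem hs'.1 k) hk

/-- Along a normal to the path, the closest point does not alter. -/
theorem ClosestWellDefined.isClosest_along_normal {C : RefPath} {lam : ℝ} (hlam : lam < 1)
    (hC : C.ClosestWellDefined lam) {s z z' : ℝ}
    (hdom : ∀ x ∈ Icc (0 : ℝ) 1, C.point s (z + x * (z' - z)) ∈ C.domain lam)
    (h : C.IsClosest s (C.point s z)) : C.IsClosest s (C.point s z') := by
  have hcont : Continuous fun x : ℝ => C.point s (z + x * (z' - z)) := by
    simp only [point_eq]; fun_prop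
  -- Continuous induction along the segment: the property is closed, and `eventually_isClosest`
  -- extends it past each point, since in the domain the closest abscissa is interior.
  have key : Icc (0 : ℝ) 1 ⊆ {x | C.IsClosest s (C.point s (z + x * (z' - z)))} := by
    apply IsClosed.Icc_subset_of_forall_exists_gt
    · apply IsClosed.inter _ isClosed_Icc
      simp only [IsClosest, ofPred_and, ofPred_forall]
      exact (isClosed_const).inter (isClosed_iInter fun s' => isClosed_iInter fun hs' =>
        isClosed_le (hcont.dist continuous_const) (hcont.dist continuous_const))
    · simpa using h
    · rintro x ⟨hx, hx1⟩ y hy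
      have hx' := hdom x ⟨hx1.1, hx1.2.le⟩
      have hin := domain_interior hx' hx
      have hz : C.kBar * |z + x * (z' - z)| ≤ lam := by rw [← hx.distTo_point]; exact hx'.1
      have h1 := hC.eventually_isClosest hlam hin hz hx
      have h2 : Tendsto (fun u : ℝ => (s, z + u * (z' - z))) (𝓝[>] x) (𝓝 (s, z + x * (z' - z))) :=
        (Continuous.tendsto (by fun_prop) x).mono_left nhdsWithin_le_nhds
      obtain ⟨u, hu1, hu2⟩ := ((h2.eventually h1).and (Ioc_mem_nhdsGT hy)).exists
      exact ⟨u, hu1, hu2⟩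
  simpa using key (right_mem_Icc.2 zero_le_one)

/-- In a convex part of the domain, the direction of the path at the closest point admits a
continuous polar angle, which varies by no more than `π`. -/
theorem ClosestWellDefined.exists_angle {C : RefPath} {lam : ℝ} (hlam : lam < 1)
    (hC : C.ClosestWellDefined lam) {K : Set ℂ} (hK : Convex ℝ K) (hne : K.Nonempty)
    (hKd : K ⊆ C.domain lam) :
    ∃ A : ℂ → ℝ, ContinuousOn A K ∧ (∀ ζ ∈ K, Complex.exp (A ζ * Complex.I) = C.closestDir ζ) ∧
      ∀ ζ₁ ∈ K, ∀ ζ₂ ∈ K, A ζ₂ - A ζ₁ ≤ Real.pi := by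
  have hnorm : ∀ ζ, ‖C.closestDir ζ‖ = 1 := fun ζ => C.norm_dir _
  obtain ⟨f, hf, hfe⟩ := exists_log_of_convex hK hne
    (hC.closestDir_cont.mono fun ζ hζ => (hKd hζ).1)
    (fun x _ h => by have := hnorm x; rw [h] at this; simp at this)
  have hre : ∀ ζ ∈ K, (f ζ).re = 0 := by
    intro ζ hζ
    have := hnorm ζ
    rw [← hfe ζ hζ, Complex.norm_exp] at this
    simpa using this
  have hAe : ∀ ζ ∈ K, Complex.exp (((f ζ).im : ℝ) * Complex.I) = C.closestDir ζ := by
    intro ζ hζ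
    rw [← hfe ζ hζ]
    congr 1
    apply Complex.ext <;> simp [hre ζ hζ]
  refine ⟨fun ζ => (f ζ).im, Complex.continuous_im.comp_continuousOn hf, hAe, ?_⟩
  intro ζ₁ h₁ ζ₂ h₂
  -- If the angle grew by more than `π` along the segment, it would take a value orthogonal to the
  -- segment, since `q` changes sign over a half-turn. The segment would then lie on a normal to the
  -- path, along which the closest point, hence the direction, is constant.
  by_contra! hlt
  set E := ζ₂ - ζ₁ with hE
  have hseg : ∀ x ∈ Icc (0 : ℝ) 1, ζ₁ + x * E ∈ K := by
    intro x hx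
    have := hK h₁ h₂ (sub_nonneg.2 hx.2) hx.1 (by ring)
    convert this using 1
    simp only [Complex.real_smul, hE]; push_cast; ring
  set a : ℝ → ℝ := fun x => (f (ζ₁ + x * E)).im with ha
  have hac : ContinuousOn a (Icc 0 1) := by
    apply Complex.continuous_im.comp_continuousOn
    exact hf.comp (by fun_prop) hseg
  have hivt := intermediate_value_Icc zero_le_one hac
  have ha0 : a 0 = (f ζ₁).im := by simp [ha]
  have ha1 : a 1 = (f ζ₂).im := by simp [ha, hE]
  rw [ha0, ha1] at hivt
  set a₀ := (f ζ₁).im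
  set q : ℝ → ℝ := fun x => inner ℝ (Complex.exp (x * Complex.I)) E with hq
  have hqc : Continuous q := by simp only [hq]; fun_prop
  have hqpi : q (a₀ + Real.pi) = - q a₀ := by
    simp only [hq]
    push_cast
    rw [add_mul, Complex.exp_add, Complex.exp_pi_mul_I]
    simp
  obtain ⟨y, hy, hqy⟩ : ∃ y ∈ Icc a₀ (a₀ + Real.pi), q y = 0 := by
    have hpi := Real.pi_pos
    rcases le_total (q a₀) 0 with h | h
    · exact intermediate_value_Icc (by linarith) hqc.continuousOn ⟨h, by rw [hqpi]; linarith⟩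
    · exact intermediate_value_Icc' (by linarith) hqc.continuousOn ⟨by rw [hqpi]; linarith, h⟩
  obtain ⟨x, hx, hxy⟩ := hivt (show y ∈ _ from ⟨hy.1, by linarith [hy.2]⟩)
  have hstar := hKd (hseg x hx)
  obtain ⟨s, hs⟩ := hC.exists_isClosest hstar.1
  have hin := domain_interior hstar hs
  have hdir : Complex.exp (y * Complex.I) = C.dir s := by
    rw [← hxy]
    simp only [ha]
    rw [hAe _ (hseg x hx), hC.closestDir_eq hstar.1 hs]
  have hEn := eq_inner_add_inner (C.norm_dir s) E
  rw [← hdir] at hEn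
  have hqy' : inner ℝ (Complex.exp (y * Complex.I)) E = 0 := hqy
  rw [hqy', hdir, Complex.ofReal_zero, zero_mul, zero_add] at hEn
  set e : ℝ := inner ℝ (Complex.I * C.dir s) E
  set z : ℝ := inner ℝ (Complex.I * C.dir s) (ζ₁ + x * E - C.r s)
  have hzeq : ζ₁ + x * E = C.point s z := hs.eq_point hin
  have hline : ∀ x' : ℝ, ζ₁ + x' * E = C.point s (z + (x' - x) * e) := by
    intro x'
    rw [point_eq] at hzeq ⊢
    push_cast
    linear_combination hzeq + (x' - x) * hEn
  have hconst : ∀ x' ∈ Icc (0 : ℝ) 1, C.closestDir (ζ₁ + x' * E) = C.dir s := by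
    intro x' hx'
    have hcl : C.IsClosest s (C.point s (z + (x' - x) * e)) := by
      apply hC.isClosest_along_normal hlam (z := z)
      · intro u hu
        have := hKd (hseg (x + u * (x' - x)) (by
          constructor
          · nlinarith [hx.1, hx'.1, hu.1, hu.2, mul_nonneg hu.1 hx'.1, mul_nonneg (sub_nonneg.2 hu.2) hx.1]
          · nlinarith [mul_nonneg hu.1 (sub_nonneg.2 hx'.2), mul_nonneg (sub_nonneg.2 hu.2) (sub_nonneg.2 hx.2)]))
        rw [hline] at this
        convert this using 2
        ring
      · rw [← hzeq]; exact hs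
    rw [← hline] at hcl
    exact hC.closestDir_eq (hKd (hseg x' hx')).1 hcl
  have hcontra : ∀ y' ∈ Icc a₀ (f ζ₂).im, Complex.exp (y' * Complex.I) = Complex.exp (y * Complex.I) := by
    intro y' hy'
    obtain ⟨x', hx', hxy'⟩ := hivt hy'
    rw [hdir, ← hconst x' hx', ← hxy']
    exact hAe _ (hseg x' hx')
  have hI : ∀ v : ℂ, Complex.exp (y * Complex.I) * v = Complex.exp (y * Complex.I) → v = 1 :=
    fun v hv => mul_left_cancel₀ (Complex.exp_ne_zero _) (by rw [hv, mul_one])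
  -- The range of the angle is longer than `π`, so it contains `y + π / 2` or `y - π / 2`, where the
  -- exponential takes another value.
  rcases le_total y (a₀ + Real.pi / 2) with h | h
  · have := hcontra (y + Real.pi / 2) ⟨by linarith [hy.1, Real.pi_pos], by linarith⟩
    push_cast at this
    rw [add_mul, Complex.exp_add, Complex.exp_pi_div_two_mul_I] at this
    have := congrArg Complex.im (hI _ this)
    simp at this
  · have := hcontra (y - Real.pi / 2) ⟨by linarith, by linarith [hy.2, Real.pi_pos]⟩
    push_cast at this
    rw [sub_mul, sub_eq_add_neg, Complex.exp_add, ← neg_mul, ← neg_div, Complex.exp_neg_pi_div_two_mul_I] at this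
    have := congrArg Complex.im (hI _ this)
    simp at this

/-- A curve which leaves outwards a point at the maximal distance from the path leaves the set of
points at no greater distance. -/
theorem ClosestWellDefined.exit {C : RefPath} {lam : ℝ}
    (hC : C.ClosestWellDefined lam) {s z : ℝ} (hz : C.kBar * |z| = lam) (hlam : 0 < lam)
    (h : C.IsClosest s (C.point s z)) {V : ℂ}
    (hV : 0 < inner ℝ V (z * (Complex.I * C.dir s))) :
    ∃ η > 0, ∃ h₀ > 0, ∀ x : ℝ, 0 < x → x < h₀ → ∀ ζ : ℂ, ‖ζ - C.point s z - x * V‖ ≤ η * x →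
      lam < C.kBar * C.distTo ζ := by
  have hk : 0 < C.kBar := by
    refine C.kBar_nonneg.lt_of_ne fun h0 => ?_
    rw [← h0] at hz; simp at hz; linarith
  have hd := h.distTo_point
  set p := C.point s z with hp
  set c := inner ℝ V (z * (Complex.I * C.dir s)) with hc
  have hps : p - C.r s = z * (Complex.I * C.dir s) := by rw [hp, point_eq]; ring
  have hcont : ContinuousOn (fun u => inner ℝ V (p - C.r u)) C.dom :=
    continuousOn_const.inner (continuousOn_const.sub C.r_cont)
  obtain ⟨δ, hδ, h1⟩ := Metric.continuousOn_iff.1 hcont s h.1 (c / 2) (by linarith)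
  obtain ⟨ρ, hρ, H⟩ := hC.stable (by rw [hd, hz]) h hδ
  set M := |z| + 1 with hM
  have hM0 : 0 < M := by positivity
  -- The point `r u` closest to `ζ` is near `r s`, so `2 * x * ⟪V, p - r u⟫ > c * x`, while the
  -- deviation from the ray costs at most `2 * M * η * x = c * x / 2`. Hence `‖ζ - r u‖` would
  -- exceed `‖p - r u‖ ≥ |z|`.
  set η := c / (4 * M) with hη
  have hη0 : 0 < η := by positivity
  refine ⟨η, hη0, min 1 (min ρ 2 / (2 * (‖V‖ + η))), by positivity, ?_⟩
  intro x hx hx0 ζ hζ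
  have hx2 : x < min ρ 2 / (2 * (‖V‖ + η)) := hx0.trans_le (min_le_right _ _)
  have hx3 : x < 1 := hx0.trans_le (min_le_left _ _)
  by_contra! hle
  obtain ⟨s', hs'⟩ := hC.exists_isClosest hle
  have hdist : dist ζ p < min ρ 2 / 2 := by
    have h2 : ‖ζ - p‖ ≤ ‖ζ - p - x * V‖ + ‖(x : ℂ) * V‖ := by
      have := norm_add_le (ζ - p - x * V) (x * V)
      rwa [sub_add_cancel] at this
    rw [norm_mul, Complex.norm_real, Real.norm_of_nonneg hx.le] at h2
    rw [lt_div_iff₀ (by positivity)] at hx2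
    rw [dist_eq_norm]
    nlinarith
  obtain ⟨k, hk'⟩ := H ζ s' hs'.1 (by linarith [min_le_left ρ 2]) (by
    rw [← hs'.distTo_eq]; linarith [C.distTo_le_add ζ p, min_le_left ρ 2])
  set u := s' + k * C.period with hu
  have hudom : u ∈ C.dom := C.shift_mem hs'.1 k
  have hru : C.r u = C.r s' := C.r_shift hs'.1 k
  have h3 := h1 u hudom hk'
  rw [hps, ← hc, Real.dist_eq] at h3
  have h4 : c / 2 < inner ℝ V (p - C.r u) := by linarith [(abs_lt.1 h3).1]
  have h5 : |z| ≤ ‖p - C.r u‖ := by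
    have := h.2 u hudom
    rwa [C.dist_point_r, dist_eq_norm] at this
  have h6 : ‖ζ - C.r u‖ ≤ |z| := by
    have : C.kBar * C.distTo ζ ≤ C.kBar * |z| := by rw [hz]; exact hle
    have := le_of_mul_le_mul_left this hk
    rwa [hs'.distTo_eq, dist_eq_norm, ← hru] at this
  have h7 : ‖p - C.r u‖ ≤ M := by
    have h8 := dist_triangle_left p (C.r u) ζ
    rw [← dist_eq_norm]
    rw [← dist_eq_norm] at h6
    linarith [min_le_right ρ 2]
  have h8 : ζ - C.r u = (p - C.r u) + ((x : ℂ) * V + (ζ - p - x * V)) := by ring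
  have h9 : ‖ζ - C.r u‖ ^ 2 ≥ ‖p - C.r u‖ ^ 2 +
      2 * inner ℝ (p - C.r u) ((x : ℂ) * V + (ζ - p - x * V)) := by
    rw [h8, norm_add_sq_real]
    linarith [sq_nonneg ‖(x : ℂ) * V + (ζ - p - x * V)‖]
  rw [inner_add_right, ← Complex.real_smul, inner_smul_right, real_inner_comm] at h9
  have h10 := abs_real_inner_le_norm (p - C.r u) (ζ - p - x • V)
  rw [Complex.real_smul] at h9 h10
  have h11 : ‖p - C.r u‖ * ‖ζ - p - x * V‖ ≤ M * (η * x) := by gcongr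
  have h12 : M * (η * x) = c / 4 * x := by rw [hη]; field_simp
  have h13 := neg_abs_le (inner ℝ (p - C.r u) (ζ - p - x * V))
  have h14 : x * (c / 2) < x * inner ℝ V (p - C.r u) := by gcongr
  have h15 : ‖ζ - C.r u‖ ^ 2 ≤ |z| ^ 2 := by gcongr
  have h16 : |z| ^ 2 ≤ ‖p - C.r u‖ ^ 2 := by gcongr
  nlinarith

end RefPath

/-! ### Consequences of Filippov's inclusion -/

/-- A closed half-space is closed and convex, so it contains the Filippov set as soon as it contains
almost all nearby values of the field. The inclusion is used in no other way. -/
theorem filippov_le {f : ℝ → State → State} {t : ℝ} {x y : State} (hy : y ∈ filippov f t x)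
    (a b c B : ℝ)
    (h : ∀ ε > 0, ∃ ρ > 0, ∃ N : Set State, volume N = 0 ∧ ∀ x' ∈ Metric.ball x ρ \ N,
      a * (f t x').1 + b * (f t x').2.1 + c * (f t x').2.2 ≤ B + ε) :
    a * y.1 + b * y.2.1 + c * y.2.2 ≤ B := by
  refine le_of_forall_pos_le_add fun ε hε => ?_
  obtain ⟨ρ, hρ, N, hN, h⟩ := h ε hε
  set H : Set State := {y | a * y.1 + b * y.2.1 + c * y.2.2 ≤ B + ε} with hH
  have hconv : Convex ℝ H := by
    intro p hp q hq m n hm hn hmn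
    simp only [hH, mem_ofPred_eq, Prod.fst_add, Prod.smul_fst, Prod.snd_add, Prod.smul_snd,
      smul_eq_mul] at hp hq ⊢
    have : B + ε = m * (B + ε) + n * (B + ε) := by rw [← add_mul, hmn, one_mul]
    nlinarith [mul_le_mul_of_nonneg_left hp hm, mul_le_mul_of_nonneg_left hq hn]
  have hcl : IsClosed H := isClosed_le (by fun_prop) continuous_const
  have h1 := mem_iInter₂.1 (mem_iInter₂.1 hy ρ hρ) N hN
  exact closure_minimal (convexHull_min (by rintro _ ⟨x', hx', rfl⟩; exact h x' hx') hconv) hcl h1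

theorem volume_fst_mem {B : Set ℝ} (hB : B.Countable) : volume {x : State | x.1 ∈ B} = 0 :=
  (Measure.quasiMeasurePreserving_fst (μ := (volume : Measure ℝ))
    (ν := (volume : Measure (ℝ × ℝ)))).preimage_null (hB.measure_zero _)

theorem volume_snd_mem {B : Set ℝ} (hB : B.Countable) : volume {x : State | x.2.1 ∈ B} = 0 :=
  (Measure.quasiMeasurePreserving_snd (μ := (volume : Measure ℝ))
    (ν := (volume : Measure (ℝ × ℝ)))).preimage_null
    ((Measure.quasiMeasurePreserving_fst (μ := (volume : Measure ℝ))
      (ν := (volume : Measure ℝ))).preimage_null (hB.measure_zero _))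

/-- Uniformity of continuity with respect to a parameter from a compact set. -/
theorem eventually_forall_abs_sub_lt {X Y : Type*} [TopologicalSpace X] [TopologicalSpace Y]
    {F : X → Y → ℝ} {x₀ : X} {K : Set Y} (hK : IsCompact K)
    (hF : ∀ k ∈ K, ContinuousAt (fun q : X × Y => F q.1 q.2) (x₀, k))
    {ε : ℝ} (hε : 0 < ε) : ∀ᶠ x in 𝓝 x₀, ∀ k ∈ K, |F x k - F x₀ k| < ε := by
  apply hK.eventually_forall_of_forall_eventually
  intro k hk
  have h1 := hF k hk
  have h2 : ContinuousAt (fun q : X × Y => F x₀ q.2) (x₀, k) :=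
    h1.comp (f := fun q : X × Y => (x₀, q.2)) (x := (x₀, k)) (by fun_prop)
  have h3 : ContinuousAt (fun q : X × Y => |F q.1 q.2 - F x₀ q.2|) (x₀, k) := (h1.sub h2).abs
  exact h3.eventually_lt continuousAt_const (by simpa using hε)

/-! ### Vehicle constants -/

namespace Params
variable (P : Params)

/-- The least speed of the vehicle. -/
def vMin : ℝ := P.vrw - P.vBar

/-- The greatest speed of the vehicle. -/
def vMax : ℝ := (P.vrw + P.vBar) / Real.cos P.phiBar

theorem vMin_pos : 0 < P.vMin := sub_pos.2 P.vBar_lt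

theorem vrw_pos : 0 < P.vrw := P.vBar_nonneg.trans_lt P.vBar_lt

theorem cos_phiBar_pos : 0 < Real.cos P.phiBar :=
  Real.cos_pos_of_mem_Ioo ⟨by linarith [P.phiBar_nonneg, Real.pi_pos], P.phiBar_lt⟩

theorem dmax_pos : 0 < P.dmax := P.betaBar_nonneg.trans_lt P.betaBar_lt

theorem dmax_lt : P.dmax < Real.pi / 2 := by linarith [P.dmax_add_lt, P.betaBar_nonneg]

theorem tan_dmax_pos : 0 < Real.tan P.dmax := Real.tan_pos_of_pos_of_lt_pi_div_two P.dmax_pos P.dmax_lt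

theorem R_pos : 0 < P.R := div_pos P.L_pos P.tan_dmax_pos

theorem T_pos : 0 < P.T := div_pos (mul_pos (mul_pos two_pos Real.pi_pos) P.R_pos) P.vrw_pos

end Params

theorem cos_le_of_abs_le {x y : ℝ} (h : |x| ≤ y) (hy : y < Real.pi / 2) :
    Real.cos y ≤ Real.cos x := by
  rw [← Real.cos_abs x]
  exact Real.cos_le_cos_of_nonneg_of_le_pi (abs_nonneg _) (by linarith [Real.pi_pos]) h

theorem cos_pos_of_abs_le {P : Params} {φ : ℝ} (h : |φ| ≤ P.phiBar) : 0 < Real.cos φ :=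
  P.cos_phiBar_pos.trans_le (cos_le_of_abs_le h P.phiBar_lt)

theorem speed_bounds {P : Params} {φ vs : ℝ} (h : |φ| ≤ P.phiBar) (hv : |vs| ≤ P.vBar) :
    P.vMin ≤ speed P φ vs ∧ speed P φ vs ≤ P.vMax := by
  have hc := cos_pos_of_abs_le h
  have hv' := abs_le.1 hv
  have := P.vMin_pos
  unfold Params.vMin at this
  constructor
  · rw [speed, le_div_iff₀ hc, Params.vMin]
    nlinarith [Real.cos_le_one φ]
  · rw [speed, Params.vMax]
    have := P.vBar_nonneg
    have := P.cos_phiBar_pos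
    have := P.vrw_pos
    have := cos_le_of_abs_le h P.phiBar_lt
    gcongr
    linarith

theorem speed_pos {P : Params} {φ vs : ℝ} (h : |φ| ≤ P.phiBar) (hv : |vs| ≤ P.vBar) :
    0 < speed P φ vs := P.vMin_pos.trans_le (speed_bounds h hv).1

/-- Speed of the vehicle under the given slip. -/
def Slip.v (P : Params) (w : Slip) (t : ℝ) : ℝ := speed P (w.φ t) (w.vs t)

theorem Slip.Admissible.v_pos {P : Params} {w : Slip} (hw : w.Admissible P) {t : ℝ} (ht : 0 ≤ t) :
    0 < w.v P t := speed_pos (hw.φ_le t ht) (hw.vs_le t ht)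

theorem Slip.Admissible.v_cont {P : Params} {w : Slip} (hw : w.Admissible P) :
    ContinuousOn (w.v P) (Ici 0) := by
  unfold Slip.v speed
  exact (continuousOn_const.add hw.vs_cont).div (Real.continuous_cos.comp_continuousOn hw.φ_cont)
    fun t ht => (cos_pos_of_abs_le (hw.φ_le t ht)).ne'

/-- The angular velocity of the vehicle has the limit `D` at the instant `t` and state `x`. -/
def TurnLim (P : Params) (w : Slip) (u : ℝ → State → ℝ) (t : ℝ) (x : State) (D : ℝ) : Prop :=
  ∀ ε > 0, ∃ ρ > 0, ∃ N : Set State, volume N = 0 ∧ ∀ τ, 0 ≤ τ → |τ - t| < ρ →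
    ∀ x' ∈ Metric.ball x ρ \ N,
      |turnRate P (w.v P τ) (w.φ τ) (w.β τ) (u τ x') - D| < ε

theorem mem_ball_state {x x' : State} {ρ : ℝ} : x' ∈ Metric.ball x ρ ↔
    |x'.1 - x.1| < ρ ∧ |x'.2.1 - x.2.1| < ρ ∧ |x'.2.2 - x.2.2| < ρ := by
  rw [Metric.mem_ball, Prod.dist_eq, Prod.dist_eq, max_lt_iff, max_lt_iff]
  simp [Real.dist_eq]

theorem one_sub_mul_pos {k₀ k z : ℝ} (hk : |k| ≤ k₀) (hz : k₀ * |z| < 1) : 0 < 1 - k * z := by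
  have : k * z ≤ k₀ * |z| := (le_abs_self _).trans (by rw [abs_mul]; gcongr)
  linarith

/-- Filippov's inclusion tested on a linear functional; the curvature of the path ranges over
`[k₁, k₂]` near the current point. -/
theorem filippov_field_le {P : Params} {C : RefPath} {w : Slip}
    {u : ℝ → State → ℝ} {t : ℝ} (ht : 0 ≤ t) {x y : State}
    (hy : y ∈ filippov (field P C w u) t x) {k₁ k₂ : ℝ}
    (hk : ∃ ρ > 0, ∃ N : Set State, volume N = 0 ∧ ∀ x' ∈ Metric.ball x ρ \ N,
      C.κ x'.1 ∈ Icc k₁ k₂)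
    (hx : ∀ k ∈ Icc k₁ k₂, 1 - k * x.2.1 ≠ 0) {a b c M D : ℝ}
    (hD : c = 0 ∨ TurnLim P w u t x D)
    (hM : ∀ k ∈ Icc k₁ k₂, a * sDot k x.2.1 x.2.2 (w.φ t) (w.v P t)
      + b * zDot x.2.2 (w.φ t) (w.v P t) + c * (k * sDot k x.2.1 x.2.2 (w.φ t) (w.v P t)) ≤ M) :
    a * y.1 + b * y.2.1 + c * (y.2.2 + D) ≤ M := by
  -- The steering enters `dθ/dt` additively, so its limit `D` splits off; the rest is continuous in
  -- `(z, θ)` uniformly in the curvature.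
  have key : a * y.1 + b * y.2.1 + c * y.2.2 ≤ M - c * D := by
    apply filippov_le hy
    intro ε hε
    set F : ℝ × ℝ → ℝ → ℝ := fun q k => a * sDot k q.1 q.2 (w.φ t) (w.v P t)
      + b * zDot q.2 (w.φ t) (w.v P t) + c * (k * sDot k q.1 q.2 (w.φ t) (w.v P t)) with hF
    have hcont : ∀ k ∈ Icc k₁ k₂, ContinuousAt (fun q : (ℝ × ℝ) × ℝ => F q.1 q.2) (x.2, k) := by
      intro k hk
      have := hx k hk
      simp only [hF, sDot, zDot]
      fun_prop (disch := exact this)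
    have h1 := eventually_forall_abs_sub_lt isCompact_Icc hcont (half_pos hε)
    obtain ⟨ρ₁, hρ₁, h1⟩ := Metric.eventually_nhds_iff_ball.1 h1
    obtain ⟨ρ₂, hρ₂, N₂, hN₂, h2⟩ := hk
    obtain ⟨ρ₃, hρ₃, N₃, hN₃, h3⟩ : ∃ ρ > 0, ∃ N : Set State, volume N = 0 ∧
        ∀ x' ∈ Metric.ball x ρ \ N,
        |c * (turnRate P (w.v P t) (w.φ t) (w.β t) (u t x') - D)| ≤ ε / 2 := by
      rcases hD with h | h
      · exact ⟨1, one_pos, ∅, measure_empty, fun x' _ => by simpa [h] using (half_pos hε).le⟩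
      · obtain ⟨ρ, hρ, N, hN, h⟩ := h (ε / 2 / (|c| + 1)) (by positivity)
        refine ⟨ρ, hρ, N, hN, fun x' hx' => ?_⟩
        have := h t ht (by simpa using hρ) x' hx'
        rw [abs_mul]
        rw [lt_div_iff₀ (by positivity)] at this
        nlinarith [abs_nonneg (turnRate P (w.v P t) (w.φ t) (w.β t) (u t x') - D)]
    refine ⟨min ρ₁ (min ρ₂ ρ₃), by positivity, N₂ ∪ N₃, measure_union_null hN₂ hN₃, ?_⟩
    rintro x' ⟨hx', hxN⟩
    rw [mem_union, not_or] at hxN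
    have e2 := h2 x' ⟨Metric.ball_subset_ball ((min_le_right _ _).trans (min_le_left _ _)) hx', hxN.1⟩
    have e3 := h3 x' ⟨Metric.ball_subset_ball ((min_le_right _ _).trans (min_le_right _ _)) hx', hxN.2⟩
    have e1 := h1 x'.2 (by
      have := Metric.ball_subset_ball (min_le_left _ _) hx'
      rw [mem_ball_state] at this
      rw [Metric.mem_ball, Prod.dist_eq, max_lt_iff]
      exact this.2) _ e2
    have e4 := hM _ e2
    have e1' := (abs_lt.1 e1).2
    have e3' := (abs_le.1 e3).1
    simp only [hF] at e1'
    have e5 : a * (field P C w u t x').1 + b * (field P C w u t x').2.1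
        + c * (field P C w u t x').2.2
        = (a * sDot (C.κ x'.1) x'.2.1 x'.2.2 (w.φ t) (w.v P t)
      + b * zDot x'.2.2 (w.φ t) (w.v P t)
      + c * (C.κ x'.1 * sDot (C.κ x'.1) x'.2.1 x'.2.2 (w.φ t) (w.v P t)))
      - c * turnRate P (w.v P t) (w.φ t) (w.β t) (u t x') := by
      simp only [field, thetaDot, Slip.v]; ring
    rw [e5]
    linarith
  linarith

theorem RefPath.κ_mem_near (C : RefPath) {x : State} (hx : x.1 ∈ interior C.dom) :
    ∃ ρ > 0, ∃ N : Set State, volume N = 0 ∧ ∀ x' ∈ Metric.ball x ρ \ N,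
      x'.1 ∈ C.dom \ C.brk := by
  obtain ⟨ρ, hρ, h⟩ := Metric.mem_nhds_iff.1 (mem_interior_iff_mem_nhds.1 hx)
  refine ⟨ρ, hρ, _, volume_fst_mem C.brk_countable, fun x' hx' => ⟨h ?_, hx'.2⟩⟩
  have := (mem_ball_state.1 hx'.1).1
  rwa [Metric.mem_ball, Real.dist_eq]

theorem RefPath.κ_near (C : RefPath) {x : State} (hx : x.1 ∈ interior C.dom) :
    ∃ ρ > 0, ∃ N : Set State, volume N = 0 ∧ ∀ x' ∈ Metric.ball x ρ \ N,
      C.κ x'.1 ∈ Icc (-C.kBar) C.kBar := by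
  obtain ⟨ρ, hρ, N, hN, h⟩ := C.κ_mem_near hx
  exact ⟨ρ, hρ, N, hN, fun x' hx' => abs_le.1 (C.abs_κ_le (h x' hx'))⟩

theorem RefPath.κ_near_of_regular (C : RefPath) {x : State} (hx : x.1 ∈ interior C.dom)
    (hb : x.1 ∉ C.brk) {δ : ℝ} (hδ : 0 < δ) :
    ∃ ρ > 0, ∃ N : Set State, volume N = 0 ∧ ∀ x' ∈ Metric.ball x ρ \ N,
      C.κ x'.1 ∈ Icc (C.κ x.1 - δ) (C.κ x.1 + δ) := by
  have h1 := (C.κ_cont x.1 ⟨interior_subset hx, hb⟩).continuousAt (mem_interior_iff_mem_nhds.1 hx)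
  obtain ⟨ρ, hρ, h⟩ := Metric.continuousAt_iff.1 h1 δ hδ
  refine ⟨ρ, hρ, ∅, measure_empty, fun x' hx' => ?_⟩
  have h2 := h (by rw [Real.dist_eq]; exact (mem_ball_state.1 hx'.1).1)
  rw [Real.dist_eq, abs_lt] at h2
  constructor <;> linarith

section
variable {P : Params} {C : RefPath} {w : Slip} {u : ℝ → State → ℝ} {t : ℝ} {x y : State}

/-- `dz/dt` involves neither the curvature nor the steering, so the Filippov set is single-valued in
this coordinate. -/
theorem filippov_zDot (ht : 0 ≤ t) (hx : x.1 ∈ interior C.dom) (hz : C.kBar * |x.2.1| < 1)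
    (hy : y ∈ filippov (field P C w u) t x) : y.2.1 = zDot x.2.2 (w.φ t) (w.v P t) := by
  have h := fun b M hM => filippov_field_le ht hy (C.κ_near hx)
    (fun k hk => (one_sub_mul_pos (abs_le.2 hk) hz).ne') (a := 0) (b := b) (c := 0) (D := 0) (M := M)
    (Or.inl rfl) hM
  have h1 := h 1 (zDot x.2.2 (w.φ t) (w.v P t)) (fun k _ => by simp)
  have h2 := h (-1) (-zDot x.2.2 (w.φ t) (w.v P t)) (fun k _ => by simp)
  simp at h1 h2
  linarith

/-- The curvature drops out of this combination, because `(1 - k * z) * sDot = v * cos (θ - φ)`. So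
the identity survives at the discontinuities of the curvature. -/
theorem filippov_normal (ht : 0 ≤ t) (hx : x.1 ∈ interior C.dom) (hz : C.kBar * |x.2.1| < 1)
    (hy : y ∈ filippov (field P C w u) t x) {D : ℝ} (hD : TurnLim P w u t x D) :
    y.1 - x.2.1 * (y.2.2 + D) = w.v P t * Real.cos (x.2.2 - w.φ t) := by
  have h := fun a c M hM => filippov_field_le ht hy (C.κ_near hx)
    (fun k hk => (one_sub_mul_pos (abs_le.2 hk) hz).ne') (a := a) (b := 0) (c := c) (M := M)
    (Or.inr hD) hM
  have e : ∀ k ∈ Icc (-C.kBar) C.kBar, sDot k x.2.1 x.2.2 (w.φ t) (w.v P t)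
      - x.2.1 * (k * sDot k x.2.1 x.2.2 (w.φ t) (w.v P t)) =
      w.v P t * Real.cos (x.2.2 - w.φ t) := by
    intro k hk
    have := (one_sub_mul_pos (abs_le.2 hk) hz).ne'
    unfold sDot
    field_simp
  have h1 := h 1 (-x.2.1) (w.v P t * Real.cos (x.2.2 - w.φ t)) (fun k hk => by
    rw [← e k hk]; ring_nf; rfl)
  have h2 := h (-1) (x.2.1) (-(w.v P t * Real.cos (x.2.2 - w.φ t))) (fun k hk => by
    rw [← e k hk]; ring_nf; rfl)
  linarith

/-- Serves breakpoints of the curvature: when the cosine vanishes there, it forces `dθ/dt = -D`. -/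
theorem filippov_turn (ht : 0 ≤ t) (hx : x.1 ∈ interior C.dom) (hz : C.kBar * |x.2.1| < 1)
    (hy : y ∈ filippov (field P C w u) t x) {D : ℝ} (hD : TurnLim P w u t x D) :
    |y.2.2 + D| ≤ C.kBar / (1 - C.kBar * |x.2.1|) * |w.v P t * Real.cos (x.2.2 - w.φ t)| := by
  have h := fun c M hM => filippov_field_le ht hy (C.κ_near hx)
    (fun k hk => (one_sub_mul_pos (abs_le.2 hk) hz).ne') (a := 0) (b := 0) (c := c) (M := M)
    (Or.inr hD) hM
  have e : ∀ k ∈ Icc (-C.kBar) C.kBar, |k * sDot k x.2.1 x.2.2 (w.φ t) (w.v P t)| ≤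
      C.kBar / (1 - C.kBar * |x.2.1|) * |w.v P t * Real.cos (x.2.2 - w.φ t)| := by
    intro k hk
    have h1 := one_sub_mul_pos (abs_le.2 hk) hz
    have h2 : k * x.2.1 ≤ C.kBar * |x.2.1| :=
      (le_abs_self _).trans (by rw [abs_mul]; have := abs_le.2 hk; gcongr)
    have h3 : |k| ≤ C.kBar := abs_le.2 hk
    unfold sDot
    rw [abs_mul, abs_div, abs_of_pos h1, mul_div_assoc', div_mul_eq_mul_div]
    have : 0 < 1 - C.kBar * |x.2.1| := by linarith
    have := mul_nonneg C.kBar_nonneg (abs_nonneg (w.v P t * Real.cos (x.2.2 - w.φ t)))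
    gcongr
  rw [abs_le]
  have h1 := h 1 _ (fun k hk => by
    simp only [zero_mul, zero_add, one_mul]; exact (le_abs_self _).trans (e k hk))
  have h2 := h (-1) _ (fun k hk => by
    simp only [zero_mul, zero_add, neg_mul, one_mul]; exact (neg_le_abs _).trans (e k hk))
  constructor <;> linarith

/-- Where the curvature is continuous, its range near the point shrinks to one value, which
determines `dθ/dt + D`; `filippov_normal` then relates it to `ds/dt`. -/
theorem filippov_turn_regular (ht : 0 ≤ t) (hx : x.1 ∈ interior C.dom)
    (hz : C.kBar * |x.2.1| < 1) (hb : x.1 ∉ C.brk)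
    (hy : y ∈ filippov (field P C w u) t x) {D : ℝ} (hD : TurnLim P w u t x D) :
    y.2.2 + D = C.κ x.1 * y.1 := by
  have hκ := one_sub_mul_pos (C.abs_κ_le ⟨interior_subset hx, hb⟩) hz
  set G : ℝ → ℝ := fun k => k * sDot k x.2.1 x.2.2 (w.φ t) (w.v P t) with hG
  have hGc : ContinuousAt G (C.κ x.1) := by
    simp only [hG, sDot]
    fun_prop (disch := exact hκ.ne')
  have hne : ∀ᶠ k in 𝓝 (C.κ x.1), 1 - k * x.2.1 ≠ 0 := by
    have : ContinuousAt (fun k => 1 - k * x.2.1) (C.κ x.1) := by fun_prop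
    exact this.eventually_ne hκ.ne'
  have key : ∀ c M : ℝ, c * G (C.κ x.1) = M → c * (y.2.2 + D) ≤ M := by
    intro c M hcM
    refine le_of_forall_pos_le_add fun ε hε => ?_
    have h1 : ∀ᶠ k in 𝓝 (C.κ x.1), c * G k < M + ε :=
      (continuousAt_const.mul hGc).eventually_lt continuousAt_const
        (by change c * G (C.κ x.1) < M + ε; linarith)
    obtain ⟨δ, hδ, h⟩ := Metric.nhds_basis_closedBall.eventually_iff.1 (h1.and hne)
    rw [Real.closedBall_eq_Icc] at h
    have := filippov_field_le ht hy (C.κ_near_of_regular hx hb hδ) (fun k hk => (h hk).2)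
      (a := 0) (b := 0) (c := c) (M := M + ε) (Or.inr hD) (fun k hk => by
        have := (h hk).1.le
        simpa [hG] using this)
    linarith
  have h1 := key 1 _ rfl
  have h2 := key (-1) _ rfl
  have h3 : y.2.2 + D = G (C.κ x.1) := by linarith
  have h4 := filippov_normal ht hx hz hy hD
  have h5 : G (C.κ x.1) * (1 - C.κ x.1 * x.2.1)
      = C.κ x.1 * (w.v P t * Real.cos (x.2.2 - w.φ t)) := by
    simp only [hG, sDot]
    field_simp
  rw [h3] at h4 ⊢
  linear_combination h5 - C.κ x.1 * h4

/-- The denominators `1 - k * z` are positive and bounded, so a nonzero cosine keeps all Filippov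
values of `ds/dt` away from zero. -/
theorem filippov_sDot_ne_zero (hw : w.Admissible P) (ht : 0 ≤ t) (hx : x.1 ∈ interior C.dom)
    (hz : C.kBar * |x.2.1| < 1)
    (hy : y ∈ filippov (field P C w u) t x) (hy0 : y.1 = 0) :
    Real.cos (x.2.2 - w.φ t) = 0 := by
  have hv := hw.v_pos ht
  have h := fun a M hM => filippov_field_le ht hy (C.κ_near hx)
    (fun k hk => (one_sub_mul_pos (abs_le.2 hk) hz).ne') (a := a) (b := 0) (c := 0) (D := 0) (M := M)
    (Or.inl rfl) hM
  have e : ∀ k ∈ Icc (-C.kBar) C.kBar, 1 - k * x.2.1 ≤ 1 + C.kBar * |x.2.1| ∧ 0 < 1 - k * x.2.1 := by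
    intro k hk
    have h1 := one_sub_mul_pos (abs_le.2 hk) hz
    have h2 : -(k * x.2.1) ≤ C.kBar * |x.2.1| :=
      (neg_le_abs _).trans (by rw [abs_mul]; have := abs_le.2 hk; gcongr)
    exact ⟨by linarith, h1⟩
  have hp : 0 < 1 + C.kBar * |x.2.1| := by
    have := mul_nonneg C.kBar_nonneg (abs_nonneg x.2.1); linarith
  set A := w.v P t * Real.cos (x.2.2 - w.φ t) with hA
  by_contra hne
  have hA0 : A ≠ 0 := mul_ne_zero hv.ne' hne
  rcases lt_or_gt_of_ne hA0 with hneg | hpos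
  · have := h 1 (A / (1 + C.kBar * |x.2.1|)) (fun k hk => by
      obtain ⟨h1, h2⟩ := e k hk
      simp only [sDot, one_mul, zero_mul, add_zero, ← hA]
      rw [div_le_div_iff₀ h2 hp]
      exact mul_le_mul_of_nonpos_left h1 hneg.le)
    have h5 := div_neg_of_neg_of_pos hneg hp
    simp [hy0] at this
    linarith
  · have := h (-1) (-(A / (1 + C.kBar * |x.2.1|))) (fun k hk => by
      obtain ⟨h1, h2⟩ := e k hk
      simp only [sDot, neg_mul, one_mul, zero_mul, add_zero, ← hA, neg_le_neg_iff]
      rw [div_le_div_iff₀ hp h2]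
      exact mul_le_mul_of_nonneg_left h1 hpos.le)
    have h5 := div_pos hpos hp
    simp [hy0] at this
    linarith
end

/-! ### Motions -/

/-- Absolutely continuous functions which satisfy Filippov's inclusion on `[0, b]`. -/
structure Motion (P : Params) (C : RefPath) (w : Slip) (u : ℝ → State → ℝ) (b : ℝ)
    (s z θ : ℝ → ℝ) : Prop where
  b_nonneg : 0 ≤ b
  s_ac : AbsolutelyContinuousOnInterval s 0 b
  z_ac : AbsolutelyContinuousOnInterval z 0 b
  θ_ac : AbsolutelyContinuousOnInterval θ 0 b
  incl : ∀ᵐ t, t ∈ Ioo 0 b → ∃ y ∈ filippov (field P C w u) t (s t, z t, θ t),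
    HasDerivAt s y.1 t ∧ HasDerivAt z y.2.1 t ∧ HasDerivAt θ y.2.2 t
  mem : ∀ t ∈ Icc 0 b, s t ∈ interior C.dom

/-- The coordinates are replaced by indefinite integrals of the components of `y`, which agree with
`x` on `[0, b]` and are absolutely continuous there. -/
theorem IsFilippovSolution.exists_motion {P : Params} {C : RefPath} {w : Slip}
    {u : ℝ → State → ℝ} {J : Set ℝ} {x : ℝ → State} (hJ : J.OrdConnected) (h0 : (0 : ℝ) ∈ J)
    (hx : IsFilippovSolution (field P C w u) J x) (hdom : ∀ t ∈ J, (x t).1 ∈ interior C.dom)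
    {b : ℝ} (hb : b ∈ J) (hb0 : 0 ≤ b) :
    ∃ s z θ : ℝ → ℝ, Motion P C w u b s z θ ∧ ∀ t ∈ Icc 0 b, x t = (s t, z t, θ t) := by
  obtain ⟨y, h1, h2⟩ := hx
  have hsub : Icc 0 b ⊆ J := hJ.out h0 hb
  have hi := (h1 b hb).1
  have hi1 : IntervalIntegrable (fun t => (y t).1) volume 0 b := ⟨hi.1.fst, hi.2.fst⟩
  have hi2 : IntervalIntegrable (fun t => (y t).2.1) volume 0 b := ⟨hi.1.snd.fst, hi.2.snd.fst⟩
  have hi3 : IntervalIntegrable (fun t => (y t).2.2) volume 0 b := ⟨hi.1.snd.snd, hi.2.snd.snd⟩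
  have hac : ∀ {f : ℝ → ℝ} (c : ℝ), IntervalIntegrable f volume 0 b →
      AbsolutelyContinuousOnInterval (fun t => c + ∫ τ in (0 : ℝ)..t, f τ) 0 b := by
    intro f c hf
    have hc : AbsolutelyContinuousOnInterval (fun _ : ℝ => c) 0 b :=
      (LipschitzWith.const c).lipschitzOnWith.absolutelyContinuousOnInterval
    exact hc.fun_add (hf.absolutelyContinuousOnInterval_intervalIntegral left_mem_uIcc)
  have heq : ∀ t ∈ Icc 0 b, x t = ((x 0).1 + ∫ τ in (0 : ℝ)..t, (y τ).1,
      (x 0).2.1 + ∫ τ in (0 : ℝ)..t, (y τ).2.1, (x 0).2.2 + ∫ τ in (0 : ℝ)..t, (y τ).2.2) := by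
    intro t ht
    obtain ⟨h3, h4⟩ := h1 t (hsub ht)
    rw [h4]
    have e1 := (ContinuousLinearMap.fst ℝ ℝ (ℝ × ℝ)).intervalIntegral_comp_comm h3
    have e2 := ((ContinuousLinearMap.fst ℝ ℝ ℝ).comp
      (ContinuousLinearMap.snd ℝ ℝ (ℝ × ℝ))).intervalIntegral_comp_comm h3
    have e3 := ((ContinuousLinearMap.snd ℝ ℝ ℝ).comp
      (ContinuousLinearMap.snd ℝ ℝ (ℝ × ℝ))).intervalIntegral_comp_comm h3
    simp only [ContinuousLinearMap.coe_fst', ContinuousLinearMap.coe_snd',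
      ContinuousLinearMap.comp_apply] at e1 e2 e3
    rw [e1, e2, e3]
    rfl
  refine ⟨_, _, _, ⟨hb0, hac _ hi1, hac _ hi2, hac _ hi3, ?_, ?_⟩, heq⟩
  · have h3 : ∀ᵐ t, t ∈ J → y t ∈ filippov (field P C w u) t (x t) :=
      (ae_restrict_iff' hJ.measurableSet).1 h2
    filter_upwards [h3, hi1.ae_hasDerivAt_integral, hi2.ae_hasDerivAt_integral,
      hi3.ae_hasDerivAt_integral] with t h3 d1 d2 d3 ht
    have ht' : t ∈ uIcc 0 b := by rw [uIcc_of_le hb0]; exact Ioo_subset_Icc_self ht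
    have h4 := h3 (hsub (Ioo_subset_Icc_self ht))
    rw [heq t (Ioo_subset_Icc_self ht)] at h4
    exact ⟨y t, h4, (d1 ht' 0 left_mem_uIcc).const_add _, (d2 ht' 0 left_mem_uIcc).const_add _,
      (d3 ht' 0 left_mem_uIcc).const_add _⟩
  · intro t ht
    have := hdom t (hsub ht)
    rw [heq t ht] at this
    exact this

section
variable {P : Params} {C : RefPath} {w : Slip} {u : ℝ → State → ℝ} {b : ℝ} {s z θ : ℝ → ℝ}

theorem Motion.restrict (m : Motion P C w u b s z θ) {b' : ℝ} (h0 : 0 ≤ b') (hb : b' ≤ b) :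
    Motion P C w u b' s z θ where
  b_nonneg := h0
  s_ac := ac_mono m.s_ac le_rfl h0 hb
  z_ac := ac_mono m.z_ac le_rfl h0 hb
  θ_ac := ac_mono m.θ_ac le_rfl h0 hb
  incl := by
    filter_upwards [m.incl] with t h ht
    exact h ⟨ht.1, ht.2.trans_le hb⟩
  mem t ht := m.mem t ⟨ht.1, ht.2.trans hb⟩

theorem Motion.s_cont (m : Motion P C w u b s z θ) : ContinuousOn s (Icc 0 b) := by
  simpa [uIcc_of_le m.b_nonneg] using m.s_ac.continuousOn

theorem Motion.z_cont (m : Motion P C w u b s z θ) : ContinuousOn z (Icc 0 b) := by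
  simpa [uIcc_of_le m.b_nonneg] using m.z_ac.continuousOn

theorem Motion.θ_cont (m : Motion P C w u b s z θ) : ContinuousOn θ (Icc 0 b) := by
  simpa [uIcc_of_le m.b_nonneg] using m.θ_ac.continuousOn

theorem ac_integral_of_continuousOn {E : Type*} [NormedAddCommGroup E] [NormedSpace ℝ E]
    [CompleteSpace E] {f : ℝ → E} {b : ℝ} (hb : 0 ≤ b) (hf : ContinuousOn f (Icc 0 b)) (c : E) :
    AbsolutelyContinuousOnInterval (fun t => c + ∫ τ in (0 : ℝ)..t, f τ) 0 b ∧
      ∀ t ∈ Ioo 0 b, HasDerivAt (fun t => c + ∫ τ in (0 : ℝ)..t, f τ) (f t) t := by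
  have hii : ∀ t₁ ∈ Icc 0 b, ∀ t₂ ∈ Icc 0 b, IntervalIntegrable f volume t₁ t₂ := by
    intro t₁ h₁ t₂ h₂
    apply ContinuousOn.intervalIntegrable
    exact hf.mono (uIcc_subset_Icc h₁ h₂)
  constructor
  · obtain ⟨M, hM⟩ := isCompact_Icc.exists_bound_of_continuousOn hf
    have hM0 : 0 ≤ M := (norm_nonneg _).trans (hM 0 ⟨le_rfl, hb⟩)
    have : LipschitzOnWith (Real.toNNReal M) (fun t => c + ∫ τ in (0 : ℝ)..t, f τ) (uIcc 0 b) := by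
      apply LipschitzOnWith.of_dist_le_mul
      rw [uIcc_of_le hb]
      intro t₁ h₁ t₂ h₂
      rw [dist_add_left, dist_eq_norm, intervalIntegral.integral_interval_sub_left
        (hii _ ⟨le_rfl, hb⟩ _ h₁) (hii _ ⟨le_rfl, hb⟩ _ h₂), Real.coe_toNNReal _ hM0, Real.dist_eq]
      apply intervalIntegral.norm_integral_le_of_norm_le_const
      intro x hx
      exact hM x (uIcc_subset_Icc h₂ h₁ (uIoc_subset_uIcc hx))
    exact this.absolutelyContinuousOnInterval
  · intro t ht
    apply HasDerivAt.const_add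
    have hn : Icc 0 b ∈ 𝓝 t := Icc_mem_nhds ht.1 ht.2
    exact intervalIntegral.integral_hasDerivAt_right
      (hii _ ⟨le_rfl, hb⟩ _ (Ioo_subset_Icc_self ht))
      (hf.stronglyMeasurableAtFilter_nhdsWithin measurableSet_Icc t |>.filter_mono
        (by rw [nhdsWithin_eq_nhds.2 hn]))
      (hf.continuousAt hn)

/-- With zero inner derivative, the chain rule asks only a Lipschitz bound of the outer function.
Used where `tang` or `χ` is not differentiable. -/
theorem hasDerivAt_zero_of_lipschitz {F : Type*} [NormedAddCommGroup F] [NormedSpace ℝ F]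
    {f : ℝ → ℝ} {h : ℝ → F} {t K : ℝ} (hf : HasDerivAt f 0 t)
    (hh : ∀ᶠ τ in 𝓝 t, ‖h (f τ) - h (f t)‖ ≤ K * |f τ - f t|) :
    HasDerivAt (fun τ => h (f τ)) 0 t := by
  rw [hasDerivAt_iff_isLittleO] at hf ⊢
  simp only [smul_zero, sub_zero] at hf ⊢
  exact (Asymptotics.IsBigO.of_bound K (by simpa using hh)).trans_isLittleO hf

theorem norm_exp_mul_I_sub_le (a b : ℝ) :
    ‖Complex.exp (a * Complex.I) - Complex.exp (b * Complex.I)‖ ≤ |a - b| := by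
  have := Convex.norm_image_sub_le_of_norm_hasDerivWithin_le (s := univ)
    (f := fun x : ℝ => Complex.exp (x * Complex.I)) (f' := fun x : ℝ => Complex.exp (x * Complex.I) * (1 * Complex.I))
    (C := 1) (x := b) (y := a)
    (fun x _ => (((Complex.ofRealCLM.hasDerivAt (x := x)).mul_const Complex.I).cexp).hasDerivWithinAt)
    (fun x _ => by simp [Complex.norm_exp_ofReal_mul_I]) convex_univ trivial trivial
  simpa using this

/-- Replacement of the bias of the steering angle. -/
def Slip.withBias (w : Slip) (β : ℝ → ℝ) : Slip := ⟨w.φ, β, w.vs⟩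

theorem Slip.Admissible.withBias (hw : w.Admissible P) {β : ℝ → ℝ} (hβ : ContinuousOn β (Ici 0))
    (hβb : ∀ t, 0 ≤ t → |β t| ≤ P.betaBar) : (w.withBias β).Admissible P :=
  ⟨hw.φ_cont, hβ, hw.vs_cont, hw.φ_le, hβb, hw.vs_le⟩

theorem cos_add_pos {δ β : ℝ} (hδ : |δ| ≤ P.dmax) (hβ : |β| ≤ P.betaBar) :
    0 < Real.cos (δ + β) := by
  have h1 := abs_le.1 hδ
  have h2 := abs_le.1 hβ
  have := P.dmax_add_lt
  exact Real.cos_pos_of_mem_Ioo ⟨by linarith, by linarith⟩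

theorem Slip.Admissible.turnRate_cont (hw : w.Admissible P) {δ : ℝ} (hδ : |δ| ≤ P.dmax) :
    ContinuousOn (fun t => turnRate P (w.v P t) (w.φ t) (w.β t) δ) (Ici 0) := by
  unfold turnRate
  refine ((hw.v_cont).div_const _).mul (ContinuousOn.sub ?_ ?_)
  · intro t ht
    have := (cos_add_pos hδ (hw.β_le t ht)).ne'
    exact ContinuousAt.comp_continuousWithinAt (f := fun t => δ + w.β t)
      (Real.continuousAt_tan.2 this) (continuousWithinAt_const.add (hw.β_cont t ht))
  · intro t ht
    have := (cos_pos_of_abs_le (hw.φ_le t ht)).ne'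
    exact (Real.continuousAt_tan.2 this).comp_continuousWithinAt (hw.φ_cont t ht)

theorem heading_cont (hw : w.Admissible P) {δ : ℝ} (hδ : |δ| ≤ P.dmax) (ψ₀ : ℝ) :
    ContinuousOn (heading P w δ ψ₀) (Ici 0) := by
  intro t ht
  have h1 := (ac_integral_of_continuousOn (b := t + 1) (by linarith [mem_Ici.1 ht])
    ((hw.turnRate_cont hδ).mono Icc_subset_Ici_self) ψ₀).1.continuousOn
  rw [uIcc_of_le (by linarith [mem_Ici.1 ht])] at h1
  refine (h1 t ⟨ht, by linarith⟩).mono_of_mem_nhdsWithin ?_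
  rw [mem_nhdsWithin]
  exact ⟨Iio (t + 1), isOpen_Iio, by simp, fun x hx => ⟨hx.2, hx.1.le⟩⟩

/-- The velocity of the vehicle under a constant steering angle. -/
def velocity (P : Params) (w : Slip) (δ ψ₀ t : ℝ) : ℂ :=
  (w.v P t : ℂ) * Complex.exp ((heading P w δ ψ₀ t + w.φ t : ℝ) * Complex.I)

theorem velocity_cont (hw : w.Admissible P) {δ : ℝ} (hδ : |δ| ≤ P.dmax) (ψ₀ : ℝ) :
    ContinuousOn (velocity P w δ ψ₀) (Ici 0) := by
  unfold velocity
  have h1 := hw.v_cont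
  have h2 := (heading_cont hw hδ ψ₀).add hw.φ_cont
  have h3 := Complex.continuous_ofReal.comp_continuousOn h1
  have h4 := Complex.continuous_ofReal.comp_continuousOn h2
  exact h3.mul (Complex.continuous_exp.comp_continuousOn (h4.mul continuousOn_const))

theorem position_eq (δ ψ₀ : ℝ) (ζ₀ : ℂ) (t : ℝ) :
    position P w δ ψ₀ ζ₀ t = ζ₀ + ∫ τ in (0 : ℝ)..t, velocity P w δ ψ₀ τ := rfl

/-- While the steering angle effectively equals `δ`, the motion obeys the plane kinematics. -/
theorem Motion.heading_position (hw : w.Admissible P) (m : Motion P C w u b s z θ)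
    {β : ℝ → ℝ} (hβ : ContinuousOn β (Ici 0)) (hβb : ∀ t, 0 ≤ t → |β t| ≤ P.betaBar)
    {δ : ℝ} (hδ : |δ| ≤ P.dmax) (hz : ∀ t ∈ Icc 0 b, C.kBar * |z t| < 1)
    (hD : ∀ t ∈ Ioo 0 b, TurnLim P w u t (s t, z t, θ t)
      (turnRate P (w.v P t) (w.φ t) (β t) δ)) :
    ∀ t ∈ Icc 0 b, heading P (w.withBias β) δ (C.tang (s 0) - θ 0) t = C.tang (s t) - θ t ∧
      position P (w.withBias β) δ (C.tang (s 0) - θ 0) (C.point (s 0) (z 0)) t =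
        C.point (s t) (z t) := by
  have hb := m.b_nonneg
  set w' := w.withBias β with hw'
  have hw'a : w'.Admissible P := hw.withBias hβ hβb
  set ψ₀ := C.tang (s 0) - θ 0 with hψ₀
  set ζ₀ := C.point (s 0) (z 0) with hζ₀
  set D : ℝ → ℝ := fun t => turnRate P (w.v P t) (w.φ t) (β t) δ with hDdef
  have hDc : ContinuousOn D (Icc 0 b) := (hw'a.turnRate_cont hδ).mono Icc_subset_Ici_self
  have hH := ac_integral_of_continuousOn hb hDc ψ₀
  have hHeq : heading P w' δ ψ₀ = fun t => ψ₀ + ∫ τ in (0 : ℝ)..t, D τ := rfl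
  have hsmem : ∀ t ∈ uIcc 0 b, s t ∈ C.dom := fun t ht =>
    interior_subset (m.mem t (by rwa [uIcc_of_le hb] at ht))
  have htang : AbsolutelyContinuousOnInterval (fun t => C.tang (s t)) 0 b :=
    ac_comp_lipschitz C.kBar_nonneg m.s_ac hsmem fun x hx y hy => by
      simpa [Real.dist_eq] using C.abs_tang_sub_le hx hy
  have hnear : ∀ t ∈ Ioo 0 b, ∀ᶠ τ in 𝓝 t, s τ ∈ C.dom := by
    intro t ht
    filter_upwards [Ioo_mem_nhds ht.1 ht.2] with τ hτ
    exact interior_subset (m.mem τ (Ioo_subset_Icc_self hτ))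
  have main : ∀ᵐ t, t ∈ Ioo 0 b → ∃ y ∈ filippov (field P C w u) t (s t, z t, θ t),
      HasDerivAt s y.1 t ∧ HasDerivAt z y.2.1 t ∧ HasDerivAt θ y.2.2 t ∧
      HasDerivAt (fun t => C.tang (s t)) (y.2.2 + D t) t := by
    filter_upwards [m.incl, ae_hasDerivAt_eq_zero s C.brk_countable] with t h1 h2 ht
    obtain ⟨y, hy, d1, d2, d3⟩ := h1 ht
    have htI := Ioo_subset_Icc_self ht
    refine ⟨y, hy, d1, d2, d3, ?_⟩
    -- At almost every time spent at a breakpoint, `ds/dt = 0`; then the cosine vanishes, and `dθ/dt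
    -- + D = 0` agrees with the zero derivative of the tangent angle.
    by_cases hb : s t ∈ C.brk
    · have hy0 := h2 hb _ d1
      have hc := filippov_sDot_ne_zero hw ht.1.le (m.mem t htI) (hz t htI) hy hy0
      have h3 := filippov_turn ht.1.le (m.mem t htI) (hz t htI) hy (hD t ht)
      simp only at hc h3
      rw [hc] at h3
      simp only [mul_zero, abs_zero] at h3
      have h4 : y.2.2 + D t = 0 := abs_eq_zero.1 (le_antisymm h3 (abs_nonneg _))
      rw [h4]
      rw [hy0] at d1
      refine hasDerivAt_zero_of_lipschitz (K := C.kBar) d1 ?_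
      filter_upwards [hnear t ht] with τ hτ
      exact C.abs_tang_sub_le hτ (interior_subset (m.mem t htI))
    · have h3 := filippov_turn_regular ht.1.le (m.mem t htI) (hz t htI) hb hy (hD t ht)
      have h4 := (C.hasDerivAt_tang (m.mem t htI) hb).comp t d1
      rw [← h3] at h4
      exact h4
  have hends : ∀ᵐ t, t ∈ uIcc 0 b → t ∈ Ioo 0 b := by
    have h2 : ∀ᵐ t : ℝ, t ≠ 0 := by simp [ae_iff, measure_singleton]
    have h3 : ∀ᵐ t, t ≠ b := by simp [ae_iff, measure_singleton]
    filter_upwards [h2, h3] with t h2 h3 ht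
    rw [uIcc_of_le hb] at ht
    exact ⟨lt_of_le_of_ne ht.1 (Ne.symm h2), lt_of_le_of_ne ht.2 h3⟩
  have hhead : ∀ t ∈ Icc 0 b, heading P w' δ ψ₀ t = C.tang (s t) - θ t := by
    -- `tang - θ` and the heading have equal derivatives almost everywhere; absolute continuity
    -- makes their difference constant.
    obtain ⟨c, hc⟩ := ((htang.fun_sub m.θ_ac).fun_sub hH.1).const_of_ae_hasDerivAt_zero (by
      filter_upwards [main, hends] with t h1 h2 ht
      obtain ⟨y, _, _, _, d3, d4⟩ := h1 (h2 ht)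
      exact ((d4.sub d3).sub (hH.2 t (h2 ht))).congr_deriv (by ring))
    rw [uIcc_of_le hb] at hc
    intro t ht
    have h0 := hc 0 ⟨le_rfl, hb⟩
    have h1 := hc t ht
    simp only [intervalIntegral.integral_same] at h0
    rw [hHeq]
    simp only
    linarith
  refine fun t ht => ⟨hhead t ht, ?_⟩
  have hVc : ContinuousOn (velocity P w' δ ψ₀) (Icc 0 b) :=
    (velocity_cont hw'a hδ ψ₀).mono Icc_subset_Ici_self
  have hpos := ac_integral_of_continuousOn hb hVc ζ₀
  have hr : AbsolutelyContinuousOnInterval (fun t => C.r (s t)) 0 b :=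
    ac_comp_lipschitz (K := 1) zero_le_one m.s_ac hsmem fun x hx y hy => by
      simpa [Real.dist_eq] using C.dist_r_le hx hy
  have hdir : AbsolutelyContinuousOnInterval (fun t => Complex.I * C.dir (s t)) 0 b :=
    ac_comp_lipschitz (K := 1) (s := univ) (h := fun x : ℝ => Complex.I * Complex.exp (x * Complex.I))
      zero_le_one htang (fun _ _ => trivial) fun x _ y _ => by
      simp only [dist_eq_norm, ← mul_sub, norm_mul, Complex.norm_I, one_mul]
      simpa using norm_exp_mul_I_sub_le x y
  have hpt : AbsolutelyContinuousOnInterval (fun t => C.r (s t) + z t • (Complex.I * C.dir (s t))) 0 b :=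
    hr.fun_add (m.z_ac.fun_smul hdir)
  obtain ⟨c, hc⟩ := (hpt.fun_sub hpos.1).const_of_ae_hasDerivAt_zero (by
    filter_upwards [main, hends] with t h1 h2 ht
    have ht' := h2 ht
    have htI := Ioo_subset_Icc_self ht'
    obtain ⟨y, hy, d1, d2, d3, d4⟩ := h1 ht'
    have e1 := (C.hasDerivAt_r (m.mem t htI)).scomp t d1
    have e2 : HasDerivAt (fun t => Complex.I * C.dir (s t))
        (Complex.I * (C.dir (s t) * (((y.2.2 + D t : ℝ) : ℂ) * Complex.I))) t :=
      ((d4.ofReal_comp.mul_const Complex.I).cexp).const_mul Complex.I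
    have e3 := d2.smul e2
    have e4 := (e1.add e3).sub (hpos.2 t ht')
    have e5 := filippov_normal ht'.1.le (m.mem t htI) (hz t htI) hy (hD t ht')
    have e6 := filippov_zDot ht'.1.le (m.mem t htI) (hz t htI) hy
    simp only at e5 e6
    convert! e4 using 1
    have e7 : velocity P w' δ ψ₀ t = C.dir (s t) *
        (w.v P t * (Real.cos (θ t - w.φ t) - Real.sin (θ t - w.φ t) * Complex.I)) := by
      unfold velocity RefPath.dir
      rw [hhead t htI]
      have : ((C.tang (s t) - θ t + w'.φ t : ℝ) : ℂ) * Complex.I =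
          C.tang (s t) * Complex.I + ((-(θ t - w.φ t) : ℝ) : ℂ) * Complex.I := by
        simp only [hw', Slip.withBias]; push_cast; ring
      rw [this, Complex.exp_add, Complex.exp_ofReal_mul_I (-(θ t - w.φ t)), Real.cos_neg, Real.sin_neg]
      have : w'.v P t = w.v P t := rfl
      rw [this]
      push_cast
      ring
    have e8 : (y.1 : ℂ) = z t * (y.2.2 + D t : ℝ) + w.v P t * Real.cos (θ t - w.φ t) := by
      rw [← Complex.ofReal_mul, ← Complex.ofReal_mul, ← Complex.ofReal_add]
      congr 1
      simp only [hDdef]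
      linarith
    rw [e7, e6]
    simp only [Complex.real_smul, zDot]
    rw [e8]
    push_cast
    linear_combination (-(z t) * C.dir (s t) * (y.2.2 + D t)) * Complex.I_sq)
  rw [uIcc_of_le hb] at hc
  have h0 := hc 0 ⟨le_rfl, hb⟩
  have h1 := hc t ht
  simp only [intervalIntegral.integral_same, hζ₀, RefPath.point_eq, Complex.real_smul] at h0 h1
  rw [position_eq, RefPath.point_eq, hζ₀, RefPath.point_eq]
  rw [← h0] at h1
  linear_combination -h1
end

/-! ### The design function: elementary properties -/

section
variable {P : Params} {C : RefPath} {χ : ℝ → ℝ}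

theorem IsDesignFunction.chiMax_pos (h : IsDesignFunction P C χ) : 0 < chiMax P C χ :=
  P.ePhi_nonneg.trans_lt h.ePhi_lt

/-- The supremum of an unbounded set is zero by convention, whereas `chiMax` is positive. -/
theorem IsDesignFunction.bddAbove (h : IsDesignFunction P C χ) :
    BddAbove (χ '' {z | C.kBar * |z| ≤ P.lam}) := by
  by_contra hn
  have := h.chiMax_pos
  rw [chiMax, Real.sSup_of_not_bddAbove hn] at this
  exact lt_irrefl _ this

theorem IsDesignFunction.le_chiMax (h : IsDesignFunction P C χ) {z : ℝ}
    (hz : C.kBar * |z| ≤ P.lam) : χ z ≤ chiMax P C χ :=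
  le_csSup h.bddAbove ⟨z, hz, rfl⟩

theorem IsDesignFunction.abs_le_chiMax (h : IsDesignFunction P C χ) {z : ℝ}
    (hz : C.kBar * |z| ≤ P.lam) : |χ z| ≤ chiMax P C χ := by
  rw [abs_le']
  refine ⟨h.le_chiMax hz, ?_⟩
  rw [← h.odd]
  exact h.le_chiMax (by rwa [abs_neg])

theorem IsDesignFunction.zero (h : IsDesignFunction P C χ) : χ 0 = 0 := by
  have := h.odd 0
  rw [neg_zero] at this
  linarith

theorem IsDesignFunction.nonneg (h : IsDesignFunction P C χ) {z : ℝ} (hz : 0 ≤ z) : 0 ≤ χ z := by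
  rw [← h.zero]; exact h.mono hz

theorem IsDesignFunction.abs (h : IsDesignFunction P C χ) (z : ℝ) : χ |z| = |χ z| := by
  rcases le_total 0 z with hz | hz
  · rw [abs_of_nonneg hz, abs_of_nonneg (h.nonneg hz)]
  · rw [abs_of_nonpos hz, h.odd, abs_of_nonpos]
    have := h.nonneg (neg_nonneg.2 hz)
    rw [h.odd] at this; linarith

theorem IsDesignFunction.apply_eq_chiMax (h : IsDesignFunction P C χ) {z : ℝ} (hz : 0 ≤ z)
    (hzl : C.kBar * z = P.lam) : χ z = chiMax P C χ := by
  apply le_antisymm (h.le_chiMax (by rw [abs_of_nonneg hz, hzl]))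
  apply csSup_le ⟨χ z, mem_image_of_mem χ (by simp [abs_of_nonneg hz, hzl])⟩
  rintro _ ⟨y, hy, rfl⟩
  apply h.mono
  have hk : 0 < C.kBar := by
    refine C.kBar_nonneg.lt_of_ne fun h0 => ?_
    rw [← h0] at hzl
    linarith [P.lam_pos]
  have : C.kBar * |y| ≤ C.kBar * z := by rw [hzl]; exact hy
  exact (le_abs_self y).trans (le_of_mul_le_mul_left this hk)

end

/-! ### The circle traversed without slip, and deviations from it -/

section
variable {P : Params} {w : Slip} {g ψ₀ : ℝ} {ζ₀ : ℂ}

theorem tan_mul_sign (hg : g = 1 ∨ g = -1) (x : ℝ) : Real.tan (x * g) = g * Real.tan x := by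
  rcases hg with rfl | rfl <;> simp

theorem abs_dmax_mul (hg : g = 1 ∨ g = -1) : |P.dmax * g| ≤ P.dmax := by
  have := P.dmax_pos
  rcases hg with rfl | rfl <;> simp [abs_of_pos this]

theorem Slip.none_admissible : Slip.none.Admissible P where
  φ_cont := continuousOn_const
  β_cont := continuousOn_const
  vs_cont := continuousOn_const
  φ_le _ _ := by simpa [Slip.none] using P.phiBar_nonneg
  β_le _ _ := by simpa [Slip.none] using P.betaBar_nonneg
  vs_le _ _ := by simpa [Slip.none] using P.vBar_nonneg

theorem heading_none (hg : g = 1 ∨ g = -1) (t : ℝ) :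
    heading P Slip.none (P.dmax * g) ψ₀ t = ψ₀ + g * (P.vrw / P.R) * t := by
  have hL := P.L_pos.ne'
  have ht := P.tan_dmax_pos.ne'
  simp only [heading, turnRate, Slip.none, speed, Real.cos_zero, Real.tan_zero, add_zero, sub_zero,
    tan_mul_sign hg, intervalIntegral.integral_const, smul_eq_mul, Params.R, div_one]
  field_simp

theorem position_none (hg : g = 1 ∨ g = -1) (t : ℝ) :
    position P Slip.none (P.dmax * g) ψ₀ ζ₀ t =
      ζ₀ + (g * P.R : ℝ) * (Complex.I * Complex.exp (ψ₀ * Complex.I)) -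
        (g * P.R : ℝ) * (Complex.I * Complex.exp ((ψ₀ + g * (P.vrw / P.R) * t : ℝ) * Complex.I)) := by
  have hR := P.R_pos.ne'
  have hg2 : g * g = 1 := by rcases hg with rfl | rfl <;> norm_num
  set F : ℝ → ℂ := fun t => -((g * P.R : ℝ) * (Complex.I *
    Complex.exp ((ψ₀ + g * (P.vrw / P.R) * t : ℝ) * Complex.I))) with hF
  have hder : ∀ τ ∈ uIcc 0 t, HasDerivAt F (velocity P Slip.none (P.dmax * g) ψ₀ τ) τ := by
    intro τ _
    have h1 : HasDerivAt (fun t : ℝ => ψ₀ + g * (P.vrw / P.R) * t) (g * (P.vrw / P.R)) τ := by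
      simpa using ((hasDerivAt_id τ).const_mul (g * (P.vrw / P.R))).const_add ψ₀
    have h2 := ((((h1.ofReal_comp).mul_const Complex.I).cexp.const_mul Complex.I).const_mul
      ((g * P.R : ℝ) : ℂ)).neg
    convert! h2 using 1
    rw [velocity, heading_none hg]
    have : (P.vrw : ℂ) = (g * P.R * (g * (P.vrw / P.R)) : ℝ) := by
      rw [show g * P.R * (g * (P.vrw / P.R)) = g * g * P.vrw by field_simp, hg2, one_mul]
    simp only [Slip.v, Slip.none, speed, Real.cos_zero, div_one, add_zero]
    rw [this]
    push_cast
    linear_combination ((g : ℂ) * P.R * (g * (P.vrw / P.R)) *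
      Complex.exp ((ψ₀ + g * (P.vrw / P.R) * τ) * Complex.I)) * Complex.I_sq
  have hint := intervalIntegral.integral_eq_sub_of_hasDerivAt hder (by
    apply ContinuousOn.intervalIntegrable
    have : velocity P Slip.none (P.dmax * g) ψ₀ =
        fun τ => (P.vrw : ℂ) * Complex.exp ((ψ₀ + g * (P.vrw / P.R) * τ : ℝ) * Complex.I) := by
      ext τ
      rw [velocity, heading_none hg]
      simp [Slip.v, Slip.none, speed]
    rw [this]
    fun_prop)
  rw [position_eq, hint]
  simp only [hF, mul_zero, add_zero]
  ring

theorem dist_position_none (hg : g = 1 ∨ g = -1) (t : ℝ) :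
    position P Slip.none (P.dmax * g) ψ₀ ζ₀ t ∈ initialDisc P g ψ₀ ζ₀ := by
  rw [initialDisc, Metric.mem_closedBall, position_none hg, dist_eq_norm, sub_sub_cancel_left,
    norm_neg, norm_mul, norm_mul, Complex.norm_I, Complex.norm_exp_ofReal_mul_I, Complex.norm_real,
    norm_mul, Real.norm_of_nonneg P.R_pos.le]
  rcases hg with rfl | rfl <;> simp

/-- A bound on the angular velocity. -/
def Params.turnMax (P : Params) : ℝ :=
  P.vMax / P.L * (Real.tan (P.dmax + P.betaBar) + Real.tan P.phiBar)

theorem abs_tan_le {x y : ℝ} (h : |x| ≤ y) (hy : y < Real.pi / 2) : |Real.tan x| ≤ Real.tan y := by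
  have h1 := abs_le.1 h
  have hm := Real.strictMonoOn_tan.monotoneOn
  rw [abs_le]
  constructor
  · rw [← Real.tan_neg]
    exact hm ⟨by linarith, by linarith [Real.pi_pos]⟩ ⟨by linarith, by linarith⟩ h1.1
  · exact hm ⟨by linarith, by linarith⟩ ⟨by linarith, by linarith⟩ h1.2

theorem Params.vMax_pos (P : Params) : 0 < P.vMax :=
  div_pos (by linarith [P.vrw_pos, P.vBar_nonneg]) P.cos_phiBar_pos

theorem Params.turnMax_nonneg (P : Params) : 0 ≤ P.turnMax := by
  have h1 : 0 ≤ Real.tan (P.dmax + P.betaBar) :=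
    Real.tan_nonneg_of_nonneg_of_le_pi_div_two (by linarith [P.dmax_pos, P.betaBar_nonneg])
      P.dmax_add_lt.le
  have h2 : 0 ≤ Real.tan P.phiBar :=
    Real.tan_nonneg_of_nonneg_of_le_pi_div_two P.phiBar_nonneg P.phiBar_lt.le
  have := P.vMax_pos
  have := P.L_pos
  unfold turnMax
  positivity

theorem abs_turnRate_le {φ β vs δ : ℝ} (hφ : |φ| ≤ P.phiBar) (hβ : |β| ≤ P.betaBar)
    (hvs : |vs| ≤ P.vBar) (hδ : |δ| ≤ P.dmax) : |turnRate P (speed P φ vs) φ β δ| ≤ P.turnMax := by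
  have h1 : |Real.tan (δ + β)| ≤ Real.tan (P.dmax + P.betaBar) :=
    abs_tan_le ((abs_add_le _ _).trans (add_le_add hδ hβ)) P.dmax_add_lt
  have h2 : |Real.tan φ| ≤ Real.tan P.phiBar := abs_tan_le hφ P.phiBar_lt
  have h3 := speed_pos hφ hvs
  have h4 := (speed_bounds hφ hvs).2
  have hL := P.L_pos
  unfold turnRate Params.turnMax
  rw [abs_mul, abs_div, abs_of_pos h3, abs_of_pos hL]
  have := P.vMax_pos
  gcongr
  exact (abs_sub _ _).trans (add_le_add h1 h2)

theorem norm_velocity_le (hw : w.Admissible P) {δ t : ℝ} (ht : 0 ≤ t) :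
    ‖velocity P w δ ψ₀ t‖ ≤ P.vMax := by
  rw [velocity, norm_mul, Complex.norm_exp_ofReal_mul_I, mul_one, Complex.norm_real,
    Real.norm_of_nonneg (hw.v_pos ht).le]
  exact (speed_bounds (hw.φ_le t ht) (hw.vs_le t ht)).2

theorem norm_integral_velocity_le (hw : w.Admissible P) {δ a b : ℝ} (ha : 0 ≤ a) (hab : a ≤ b) :
    ‖∫ τ in a..b, velocity P w δ ψ₀ τ‖ ≤ P.vMax * (b - a) := by
  have := intervalIntegral.norm_integral_le_of_norm_le_const (a := a) (b := b)
    (f := velocity P w δ ψ₀) (C := P.vMax) (fun x hx => by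
      rw [uIoc_of_le hab] at hx
      exact norm_velocity_le hw (ha.trans hx.1.le))
  rwa [abs_of_nonneg (sub_nonneg.2 hab)] at this

theorem abs_heading_sub_le (hw : w.Admissible P) {δ t₁ t₂ : ℝ} (hδ : |δ| ≤ P.dmax) (h₁ : 0 ≤ t₁)
    (h₂ : t₁ ≤ t₂) : |heading P w δ ψ₀ t₂ - heading P w δ ψ₀ t₁| ≤ P.turnMax * (t₂ - t₁) := by
  have hii : ∀ t, 0 ≤ t → IntervalIntegrable
      (fun τ => turnRate P (speed P (w.φ τ) (w.vs τ)) (w.φ τ) (w.β τ) δ) volume 0 t := by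
    intro t ht
    apply ContinuousOn.intervalIntegrable
    rw [uIcc_of_le ht]
    exact (hw.turnRate_cont hδ).mono Icc_subset_Ici_self
  unfold heading
  rw [add_sub_add_left_eq_sub, intervalIntegral.integral_interval_sub_left (hii _ (h₁.trans h₂))
    (hii _ h₁)]
  have := intervalIntegral.norm_integral_le_of_norm_le_const (a := t₁) (b := t₂) (C := P.turnMax)
    (f := fun τ => turnRate P (speed P (w.φ τ) (w.vs τ)) (w.φ τ) (w.β τ) δ) (fun x hx => by
      rw [uIoc_of_le h₂] at hx
      have hx0 : 0 ≤ x := h₁.trans hx.1.le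
      exact abs_turnRate_le (hw.φ_le x hx0) (hw.β_le x hx0) (hw.vs_le x hx0) hδ)
  rwa [abs_of_nonneg (sub_nonneg.2 h₂)] at this

theorem le_devAng (hw : w.Admissible P) {δ t : ℝ} (hδ : |δ| ≤ P.dmax) (ht : t ∈ Icc 0 (2 * P.T)) :
    |heading P Slip.none δ ψ₀ t - heading P w δ ψ₀ t| ≤ devAng P δ ψ₀ := by
  -- A bound common to all slips: without boundedness, the supremum would be the default zero and
  -- bound nothing.
  refine le_csSup ⟨2 * (P.turnMax * (2 * P.T)), ?_⟩ ⟨w, hw, t, ht, rfl⟩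
  rintro _ ⟨w, hw, t, ht, rfl⟩
  have h1 := abs_heading_sub_le (ψ₀ := ψ₀) hw hδ le_rfl ht.1
  have h2 := abs_heading_sub_le (ψ₀ := ψ₀) (Slip.none_admissible (P := P)) hδ le_rfl ht.1
  have h0 : ∀ w : Slip, heading P w δ ψ₀ 0 = ψ₀ := fun w => by simp [heading]
  rw [h0] at h1 h2
  have h3 : P.turnMax * (t - 0) ≤ P.turnMax * (2 * P.T) := by
    have := P.turnMax_nonneg
    have := ht.2
    gcongr
    linarith
  have h4 := abs_le.1 h1
  have h5 := abs_le.1 h2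
  rw [abs_le]
  constructor <;> linarith

theorem le_devPos (hw : w.Admissible P) {δ t : ℝ} (ht : t ∈ Icc 0 (2 * P.T)) :
    ‖position P Slip.none δ ψ₀ ζ₀ t - position P w δ ψ₀ ζ₀ t‖ ≤ devPos P δ ψ₀ ζ₀ := by
  refine le_csSup ⟨2 * (P.vMax * (2 * P.T)), ?_⟩ ⟨w, hw, t, ht, rfl⟩
  rintro _ ⟨w, hw, t, ht, rfl⟩
  have h1 := norm_integral_velocity_le (ψ₀ := ψ₀) (δ := δ) hw le_rfl ht.1
  have h2 := norm_integral_velocity_le (ψ₀ := ψ₀) (δ := δ) (Slip.none_admissible (P := P)) le_rfl ht.1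
  have h3 : P.vMax * (t - 0) ≤ P.vMax * (2 * P.T) := by
    have := P.vMax_pos
    have := ht.2
    gcongr
    linarith
  rw [position_eq, position_eq, add_sub_add_left_eq_sub]
  exact (norm_sub_le _ _).trans (by linarith)

theorem devPos_nonneg (δ : ℝ) : 0 ≤ devPos P δ ψ₀ ζ₀ :=
  (norm_nonneg _).trans (le_devPos (w := Slip.none) Slip.none_admissible
    (t := 0) ⟨le_rfl, by linarith [P.T_pos]⟩)

/-- The center of the circle traversed without slip. -/
def circleCenter (P : Params) (g ψ₀ : ℝ) (ζ₀ : ℂ) : ℂ :=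
  ζ₀ + (g * P.R : ℝ) * (Complex.I * Complex.exp (ψ₀ * Complex.I))

/-- The radius of the disc which accommodates all motions under the maximal steering angle. -/
def sweptRadius (P : Params) (g ψ₀ : ℝ) (ζ₀ : ℂ) : ℝ := P.R + devPos P (P.dmax * g) ψ₀ ζ₀

theorem sweptRadius_pos : 0 < sweptRadius P g ψ₀ ζ₀ :=
  add_pos_of_pos_of_nonneg P.R_pos (devPos_nonneg _)

theorem cthickening_initialDisc : Metric.cthickening (devPos P (P.dmax * g) ψ₀ ζ₀)
    (initialDisc P g ψ₀ ζ₀) = Metric.closedBall (circleCenter P g ψ₀ ζ₀) (sweptRadius P g ψ₀ ζ₀) := by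
  unfold initialDisc circleCenter sweptRadius
  rw [cthickening_closedBall (devPos_nonneg _) P.R_pos.le, add_comm (devPos _ _ _ _) P.R]

theorem position_mem_closedBall (hg : g = 1 ∨ g = -1) (hw : w.Admissible P) {t : ℝ}
    (ht : t ∈ Icc 0 (2 * P.T)) : position P w (P.dmax * g) ψ₀ ζ₀ t ∈
      Metric.closedBall (circleCenter P g ψ₀ ζ₀) (sweptRadius P g ψ₀ ζ₀) := by
  rw [← cthickening_initialDisc]
  refine Metric.mem_cthickening_of_dist_le _ _ _ _ (dist_position_none hg t) ?_
  rw [dist_comm, dist_eq_norm]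
  exact le_devPos hw ht

end

/-! ### Change of sign of the sliding variable within two revolutions. -/

/-- The values lie in `2 * π * ℤ`. Were the end values different, `f` would attain a value at a
distance from `f a` in `(0, π]`, where the cosine of the increment is less than 1. -/
theorem eq_of_exp_eq_one {f : ℝ → ℝ} {a b : ℝ} (hab : a ≤ b) (hf : ContinuousOn f (Icc a b))
    (h : ∀ t ∈ Icc a b, Complex.exp (f t * Complex.I) = 1) : f a = f b := by
  have hc : ∀ t ∈ Icc a b, ∀ t' ∈ Icc a b, Real.cos (f t - f t') = 1 := by
    intro t ht t' ht'
    have h1 : Complex.exp ((f t - f t' : ℝ) * Complex.I) = 1 := by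
      push_cast
      rw [sub_mul, Complex.exp_sub, h t ht, h t' ht', div_one]
    rw [Complex.exp_ofReal_mul_I] at h1
    have := congrArg Complex.re h1
    simpa [-Complex.ofReal_cos, -Complex.ofReal_sin] using this
  have hpi := Real.pi_pos
  have ha : a ∈ Icc a b := ⟨le_rfl, hab⟩
  by_contra hne
  rcases lt_or_gt_of_ne hne with hlt | hlt
  · obtain ⟨t, ht, hte⟩ := intermediate_value_Icc hab hf
      (show min (f b) (f a + Real.pi) ∈ _ from ⟨le_min hlt.le (by linarith), min_le_left _ _⟩)
    have h1 := (Real.cos_eq_one_iff_of_lt_of_lt (by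
      have : f a < f t := by rw [hte]; exact lt_min hlt (by linarith)
      linarith) (by linarith [min_le_right (f b) (f a + Real.pi)])).1 (hc t ht a ha)
    have : f a < f t := by rw [hte]; exact lt_min hlt (by linarith)
    linarith
  · obtain ⟨t, ht, hte⟩ := intermediate_value_Icc' hab hf
      (show max (f b) (f a - Real.pi) ∈ _ from ⟨le_max_left _ _, max_le hlt.le (by linarith)⟩)
    have : f t < f a := by rw [hte]; exact max_lt hlt (by linarith)
    have h1 := (Real.cos_eq_one_iff_of_lt_of_lt (by linarith [le_max_right (f b) (f a - Real.pi)])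
      (by linarith)).1 (hc t ht a ha)
    linarith

section
variable {P : Params} {C : RefPath} {χ : ℝ → ℝ} {w : Slip} {e : Estimates} {u : ℝ → State → ℝ}
  {b : ℝ} {s z θ : ℝ → ℝ}

theorem Motion.point_cont (m : Motion P C w u b s z θ) :
    ContinuousOn (fun t => C.point (s t) (z t)) (Icc 0 b) := by
  have hm : MapsTo s (Icc 0 b) C.dom := fun t ht => interior_subset (m.mem t ht)
  have h1 := C.r_cont.comp m.s_cont hm
  have h2 := C.dir_cont.comp m.s_cont hm
  have h3 := Complex.continuous_ofReal.comp_continuousOn m.z_cont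
  exact h1.add (h3.mul (continuousOn_const.mul h2))

/-- In two revolutions, the sliding variable changes its sign. -/
theorem no_two_revolutions (hC : C.ClosestWellDefined P.lam) (hχ : IsDesignFunction P C χ)
    (hw : w.Admissible P) (he : e.Admissible P w) {β : ℝ → ℝ} (hβ : ContinuousOn β (Ici 0))
    (hβb : ∀ t, 0 ≤ t → |β t| ≤ P.betaBar) {g : ℝ} (hg : g = 1 ∨ g = -1)
    (m : Motion P C w u (2 * P.T) s z θ)
    (hθ : |θ 0| ≤ Real.pi)
    (hgood : ∀ t ∈ Icc 0 (2 * P.T),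
      C.IsClosest (s t) (C.point (s t) (z t)) ∧ C.kBar * |z t| ≤ P.lam)
    (hD : ∀ t ∈ Ioo 0 (2 * P.T), TurnLim P w u t (s t, z t, θ t)
      (turnRate P (w.v P t) (w.φ t) (β t) (P.dmax * g)))
    (hdisc : Metric.closedBall (circleCenter P g (C.tang (s 0) - θ 0) (C.point (s 0) (z 0)))
      (sweptRadius P g (C.tang (s 0) - θ 0) (C.point (s 0) (z 0))) ⊆ C.domain P.lam)
    (hang : devAng P (P.dmax * g) (C.tang (s 0) - θ 0) < Real.pi)
    (hS : 0 < g * slidingVar χ e (2 * P.T) (s (2 * P.T), z (2 * P.T), θ (2 * P.T))) : False := by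
  have hT := P.T_pos
  have hw' := hw.withBias hβ hβb
  have hlast : (2 * P.T) ∈ Icc 0 (2 * P.T) := ⟨by linarith, le_rfl⟩
  have hfirst : (0 : ℝ) ∈ Icc 0 (2 * P.T) := ⟨le_rfl, by linarith⟩
  have hform := m.heading_position hw hβ hβb (abs_dmax_mul hg)
    (fun t ht => (hgood t ht).2.trans_lt P.lam_lt) hD
  set ψ₀ := C.tang (s 0) - θ 0
  set ζ₀ := C.point (s 0) (z 0) with hζ₀
  have hmemK : ∀ t ∈ Icc 0 (2 * P.T), C.point (s t) (z t) ∈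
      Metric.closedBall (circleCenter P g ψ₀ ζ₀) (sweptRadius P g ψ₀ ζ₀) := by
    intro t ht
    rw [← (hform t ht).2]
    exact position_mem_closedBall hg hw' ht
  obtain ⟨A, hAc, hAe, hAv⟩ := hC.exists_angle P.lam_lt (convex_closedBall _ _)
    ⟨_, hmemK 0 hfirst⟩ hdisc
  -- The tangent angle along the motion and the lifted angle `A` at the vehicle position differ by a
  -- constant, so `tang` changes by at most `π` in total.
  have hconst := eq_of_exp_eq_one (f := fun t => C.tang (s t) - A (C.point (s t) (z t))) (by linarith)
    ((C.tang_cont.comp m.s_cont fun t ht => interior_subset (m.mem t ht)).sub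
      (hAc.comp m.point_cont hmemK)) (fun t ht => by
      push_cast
      rw [sub_mul, Complex.exp_sub, hAe _ (hmemK t ht),
        hC.closestDir_eq (hdisc (hmemK t ht)).1 (hgood t ht).1]
      exact div_self (Complex.exp_ne_zero _))
  beta_reduce at hconst
  have hv1 := hAv _ (hmemK 0 hfirst) _ (hmemK _ hlast)
  have hv2 := hAv _ (hmemK _ hlast) _ (hmemK 0 hfirst)
  -- The heading turns by more than `4π - π` in the sense `g` and `tang` changes by at most `π`, so
  -- `g * θ` falls by more than `2π`, to below `-π`. But `g * S > 0` keeps it above `-chiMax -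
  -- phiBar > -π`.
  have hdev := (le_devAng (ψ₀ := ψ₀) hw' (abs_dmax_mul hg) hlast).trans_lt hang
  rw [heading_none hg, (hform _ hlast).1] at hdev
  have h4 : g * (P.vrw / P.R) * (2 * P.T) = g * (4 * Real.pi) := by
    have := P.vrw_pos.ne'
    have := P.R_pos.ne'
    unfold Params.T
    field_simp
    ring
  rw [h4] at hdev
  have hχb := abs_le.1 (hχ.abs_le_chiMax (hgood _ hlast).2)
  have hχm := hχ.chiMax_lt
  have hφh := abs_le.1 (he.φh_le (2 * P.T) hlast.1)
  have hφb := P.phiBar_lt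
  have hθ' := abs_le.1 hθ
  have hd := abs_lt.1 hdev
  have he0 := P.ePhi_nonneg
  simp only [slidingVar] at hS
  have hψ : ψ₀ = C.tang (s 0) - θ 0 := rfl
  rcases hg with rfl | rfl
  · linarith
  · linarith
end

/-! ### Touching the boundary of the domain under the maximal steering angle -/

section
variable {P : Params} {w w' : Slip} {ψ₀ δ : ℝ} {ζ₀ : ℂ}

/-- Continuation of the slip past `t₀`: all signals are frozen, apart from the slip angle, which
goes over to `φ₁` for the time `h`. -/
theorem Slip.Admissible.exists_continuation (hw : w.Admissible P) {t₀ h φ₁ : ℝ} (ht₀ : 0 ≤ t₀)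
    (hh : 0 < h) (hφ₁ : |φ₁| ≤ P.phiBar) : ∃ w' : Slip, w'.Admissible P ∧
      (∀ τ ≤ t₀, w'.φ τ = w.φ τ ∧ w'.β τ = w.β τ ∧ w'.vs τ = w.vs τ) ∧
      (∀ τ, t₀ ≤ τ → w'.β τ = w.β t₀ ∧ w'.vs τ = w.vs t₀) ∧
      (∀ τ, t₀ + h ≤ τ → w'.φ τ = φ₁) ∧ (φ₁ = w.φ t₀ → ∀ τ, t₀ ≤ τ → w'.φ τ = φ₁) := by
  -- A linear ramp from 0 to 1 over `[t₀, t₀ + h]` keeps the slip angle continuous; by convexity,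
  -- its bound persists.
  set l : ℝ → ℝ := fun τ => min 1 (max 0 ((τ - t₀) / h)) with hl
  have hl01 : ∀ τ, 0 ≤ l τ ∧ l τ ≤ 1 := fun τ =>
    ⟨le_min zero_le_one (le_max_left _ _), min_le_left _ _⟩
  have hlc : Continuous l := by fun_prop
  have hl0 : ∀ τ ≤ t₀, l τ = 0 := by
    intro τ hτ
    have : (τ - t₀) / h ≤ 0 := div_nonpos_of_nonpos_of_nonneg (by linarith) hh.le
    simp [hl, max_eq_left this]
  have hl1 : ∀ τ, t₀ + h ≤ τ → l τ = 1 := by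
    intro τ hτ
    have : 1 ≤ (τ - t₀) / h := by rw [le_div_iff₀ hh]; linarith
    simp [hl, max_eq_right (zero_le_one.trans this), min_eq_left this]
  have hmin : ContinuousOn (fun τ : ℝ => min τ t₀) (Ici 0) := by fun_prop
  have hmaps : MapsTo (fun τ : ℝ => min τ t₀) (Ici 0) (Ici 0) := fun τ hτ => le_min hτ ht₀
  refine ⟨⟨fun τ => w.φ (min τ t₀) + l τ * (φ₁ - w.φ t₀), fun τ => w.β (min τ t₀),
    fun τ => w.vs (min τ t₀)⟩, ⟨?_, hw.β_cont.comp hmin hmaps, hw.vs_cont.comp hmin hmaps, ?_,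
    fun t ht => hw.β_le _ (hmaps ht), fun t ht => hw.vs_le _ (hmaps ht)⟩, ?_, ?_, ?_, ?_⟩
  · exact (hw.φ_cont.comp hmin hmaps).add (hlc.continuousOn.mul continuousOn_const)
  · intro t ht
    rcases le_total t t₀ with h1 | h1
    · simp only [min_eq_left h1, hl0 t h1, zero_mul, add_zero]
      exact hw.φ_le t ht
    · simp only [min_eq_right h1]
      have h2 := abs_le.1 (hw.φ_le t₀ ht₀)
      have h3 := abs_le.1 hφ₁
      obtain ⟨h4, h5⟩ := hl01 t
      rw [abs_le]
      constructor <;> nlinarith [mul_nonneg h4 (sub_nonneg.2 h3.1), mul_nonneg h4 (sub_nonneg.2 h3.2),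
        mul_nonneg (sub_nonneg.2 h5) (sub_nonneg.2 h2.1), mul_nonneg (sub_nonneg.2 h5) (sub_nonneg.2 h2.2)]
  · intro τ hτ
    simp [min_eq_left hτ, hl0 τ hτ]
  · intro τ hτ
    simp [min_eq_right hτ]
  · intro τ hτ
    simp only [min_eq_right (by linarith : t₀ ≤ τ), hl1 τ hτ]
    ring
  · intro he τ hτ
    simp only [min_eq_right hτ, he]
    ring

theorem heading_congr {t : ℝ} (ht : 0 ≤ t)
    (h : ∀ τ ≤ t, w'.φ τ = w.φ τ ∧ w'.β τ = w.β τ ∧ w'.vs τ = w.vs τ) :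
    heading P w' δ ψ₀ t = heading P w δ ψ₀ t := by
  unfold heading
  congr 1
  apply intervalIntegral.integral_congr
  intro τ hτ
  rw [uIcc_of_le ht] at hτ
  obtain ⟨h1, h2, h3⟩ := h τ hτ.2
  simp only [h1, h2, h3]

theorem position_congr {t : ℝ} (ht : 0 ≤ t)
    (h : ∀ τ ≤ t, w'.φ τ = w.φ τ ∧ w'.β τ = w.β τ ∧ w'.vs τ = w.vs τ) :
    position P w' δ ψ₀ ζ₀ t = position P w δ ψ₀ ζ₀ t := by
  rw [position_eq, position_eq]
  congr 1
  apply intervalIntegral.integral_congr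
  intro τ hτ
  rw [uIcc_of_le ht] at hτ
  obtain ⟨h1, h2, h3⟩ := h τ hτ.2
  simp only [velocity, Slip.v, h1, h3, heading_congr hτ.1 fun σ hσ => h σ (hσ.trans hτ.2)]

theorem velocity_intervalIntegrable (hw : w.Admissible P) (hδ : |δ| ≤ P.dmax) {a b : ℝ}
    (ha : 0 ≤ a) (hab : a ≤ b) : IntervalIntegrable (velocity P w δ ψ₀) volume a b := by
  apply ContinuousOn.intervalIntegrable
  rw [uIcc_of_le hab]
  exact (velocity_cont hw hδ ψ₀).mono fun x hx => ha.trans hx.1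

theorem position_sub (hw : w.Admissible P) (hδ : |δ| ≤ P.dmax) {a b : ℝ}
    (ha : 0 ≤ a) (hab : a ≤ b) : position P w δ ψ₀ ζ₀ b - position P w δ ψ₀ ζ₀ a =
      ∫ τ in a..b, velocity P w δ ψ₀ τ := by
  rw [position_eq, position_eq, add_sub_add_left_eq_sub, intervalIntegral.integral_interval_sub_left
    (velocity_intervalIntegrable hw hδ le_rfl (ha.trans hab))
    (velocity_intervalIntegrable hw hδ le_rfl ha)]

/-- From any position, the vehicle may go on with any velocity compatible with the bounds on the
slip angle. -/
theorem exists_position_near (hw : w.Admissible P) (hδ : |δ| ≤ P.dmax) {t₀ φ₁ : ℝ}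
    (ht₀ : 0 ≤ t₀) (hφ₁ : |φ₁| ≤ P.phiBar) {η : ℝ} (hη : 0 < η) :
    ∃ x₀ > 0, ∀ x, 0 < x → x < x₀ → ∃ w' : Slip, w'.Admissible P ∧
      ‖position P w' δ ψ₀ ζ₀ (t₀ + x) - position P w δ ψ₀ ζ₀ t₀ - x * (speed P φ₁ (w.vs t₀) *
        Complex.exp ((heading P w δ ψ₀ t₀ + φ₁ : ℝ) * Complex.I))‖ ≤ η * x := by
  have hM := P.vMax_pos
  have hΩ := P.turnMax_nonneg
  -- The slip angle passes to `φ₁` during the fraction `c` of the time `x`, at the cost of at most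
  -- `2 * vMax * c * x ≤ η / 2 * x`. Afterwards, the rotation of the vehicle costs at most `vMax *
  -- turnMax * x ^ 2`, also at most `η / 2 * x` for small `x`.
  set c := min 1 (η / (4 * P.vMax)) with hc
  have hc0 : 0 < c := by positivity
  have hc1 : c ≤ 1 := min_le_left _ _
  have hc2 : 2 * P.vMax * c ≤ η / 2 := by
    have : c ≤ η / (4 * P.vMax) := min_le_right _ _
    rw [le_div_iff₀ (by positivity)] at this
    linarith
  refine ⟨η / (2 * P.vMax * P.turnMax + 1), by positivity, fun x hx hx0 => ?_⟩
  rw [lt_div_iff₀ (by positivity)] at hx0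
  obtain ⟨w', hw', h1, h2, h3, -⟩ := hw.exists_continuation ht₀ (h := c * x) (by positivity) hφ₁
  refine ⟨w', hw', ?_⟩
  rw [← position_congr ht₀ h1, position_sub hw' hδ ht₀ (by linarith)]
  set V : ℂ := speed P φ₁ (w.vs t₀) * Complex.exp ((heading P w δ ψ₀ t₀ + φ₁ : ℝ) * Complex.I)
    with hV
  have hcx : c * x ≤ x := by nlinarith
  have hii1 := velocity_intervalIntegrable (ψ₀ := ψ₀) hw' hδ ht₀ (b := t₀ + c * x) (by nlinarith)
  have hii2 := velocity_intervalIntegrable (ψ₀ := ψ₀) hw' hδ (a := t₀ + c * x) (b := t₀ + x)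
    (by positivity) (by linarith)
  have hspeed := speed_bounds hφ₁ (hw.vs_le t₀ ht₀)
  have hspeed0 := speed_pos hφ₁ (hw.vs_le t₀ ht₀)
  have hVn : ‖V‖ ≤ P.vMax := by
    rw [hV, norm_mul, Complex.norm_exp_ofReal_mul_I, mul_one, Complex.norm_real,
      Real.norm_of_nonneg hspeed0.le]
    exact hspeed.2
  have e1 : (∫ τ in t₀..(t₀ + x), velocity P w' δ ψ₀ τ) - x * V =
      (∫ τ in t₀..(t₀ + c * x), (velocity P w' δ ψ₀ τ - V)) +
        ∫ τ in (t₀ + c * x)..(t₀ + x), (velocity P w' δ ψ₀ τ - V) := by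
    rw [intervalIntegral.integral_sub hii1 intervalIntegrable_const,
      intervalIntegral.integral_sub hii2 intervalIntegrable_const,
      ← intervalIntegral.integral_add_adjacent_intervals hii1 hii2,
      intervalIntegral.integral_const, intervalIntegral.integral_const]
    simp only [Complex.real_smul]
    push_cast
    ring
  have b1 := intervalIntegral.norm_integral_le_of_norm_le_const (a := t₀) (b := t₀ + c * x)
    (f := fun τ => velocity P w' δ ψ₀ τ - V) (C := 2 * P.vMax) (fun τ hτ => by
      rw [uIoc_of_le (by nlinarith)] at hτ
      have := norm_velocity_le (ψ₀ := ψ₀) (δ := δ) hw' (ht₀.trans hτ.1.le)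
      exact (norm_sub_le _ _).trans (by linarith))
  have b2 := intervalIntegral.norm_integral_le_of_norm_le_const (a := t₀ + c * x) (b := t₀ + x)
    (f := fun τ => velocity P w' δ ψ₀ τ - V) (C := P.vMax * (P.turnMax * x)) (fun τ hτ => by
      rw [uIoc_of_le (by linarith)] at hτ
      have hcx0 : 0 < c * x := by positivity
      have ht : t₀ ≤ τ := by linarith [hτ.1]
      have hh := abs_heading_sub_le (ψ₀ := ψ₀) hw' hδ ht₀ ht
      rw [heading_congr ht₀ h1] at hh
      have hvel : velocity P w' δ ψ₀ τ = speed P φ₁ (w.vs t₀) *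
          Complex.exp ((heading P w' δ ψ₀ τ + φ₁ : ℝ) * Complex.I) := by
        simp only [velocity, Slip.v, h3 τ hτ.1.le, (h2 τ ht).2]
      rw [hvel, hV, ← mul_sub, norm_mul, Complex.norm_real, Real.norm_of_nonneg hspeed0.le]
      refine mul_le_mul hspeed.2 ?_ (norm_nonneg _) hM.le
      refine (norm_exp_mul_I_sub_le _ _).trans ?_
      rw [add_sub_add_right_eq_sub]
      refine hh.trans ?_
      gcongr
      linarith [hτ.2])
  rw [e1]
  refine (norm_add_le _ _).trans ((add_le_add b1 b2).trans ?_)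
  rw [abs_of_nonneg (by linarith [mul_pos hc0 hx]), abs_of_nonneg (by linarith)]
  have k1 : 2 * P.vMax * (t₀ + c * x - t₀) ≤ η / 2 * x := by
    have := mul_le_mul_of_nonneg_right hc2 hx.le
    linarith
  have k2 : P.vMax * (P.turnMax * x) * (t₀ + x - (t₀ + c * x)) ≤ P.vMax * (P.turnMax * x) * x := by
    gcongr
    linarith [mul_pos hc0 hx]
  have k3 : P.vMax * (P.turnMax * x) * x ≤ η / 2 * x := by
    have : P.vMax * (P.turnMax * x) ≤ η / 2 := by nlinarith
    exact mul_le_mul_of_nonneg_right this hx.le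
  linarith

/-- With all slips frozen past `t₀`, the vehicle traces an arc. -/
theorem exists_position_arc (hw : w.Admissible P) (hδ : |δ| ≤ P.dmax) {t₀ ω : ℝ}
    (ht₀ : 0 ≤ t₀) (hω : ω = turnRate P (w.v P t₀) (w.φ t₀) (w.β t₀) δ) (hω0 : ω ≠ 0) :
    ∃ w' : Slip, w'.Admissible P ∧ ∀ x, 0 ≤ x →
      position P w' δ ψ₀ ζ₀ (t₀ + x) = position P w δ ψ₀ ζ₀ t₀ + w.v P t₀ *
        Complex.exp ((heading P w δ ψ₀ t₀ + w.φ t₀ : ℝ) * Complex.I) *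
        ((Real.sin (ω * x) / ω : ℝ) + ((1 - Real.cos (ω * x)) / ω : ℝ) * Complex.I) := by
  obtain ⟨w', hw', h1, h2, -, h4⟩ := hw.exists_continuation ht₀ (h := 1) one_pos (hw.φ_le t₀ ht₀)
  refine ⟨w', hw', fun x hx => ?_⟩
  have h4 := h4 rfl
  rw [← position_congr ht₀ h1, ← sub_eq_iff_eq_add', position_sub hw' hδ ht₀ (by linarith)]
  have hhead : ∀ τ, t₀ ≤ τ → heading P w' δ ψ₀ τ = heading P w δ ψ₀ t₀ + ω * (τ - t₀) := by
    intro τ hτ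
    rw [← heading_congr ht₀ h1]
    have hii : ∀ a b, 0 ≤ a → a ≤ b → IntervalIntegrable (fun τ => turnRate P
        (speed P (w'.φ τ) (w'.vs τ)) (w'.φ τ) (w'.β τ) δ) volume a b := by
      intro a b ha hab
      apply ContinuousOn.intervalIntegrable
      rw [uIcc_of_le hab]
      exact (hw'.turnRate_cont hδ).mono fun y hy => ha.trans hy.1
    unfold heading
    rw [← intervalIntegral.integral_add_adjacent_intervals (hii 0 t₀ le_rfl ht₀) (hii t₀ τ ht₀ hτ)]
    have : ∫ τ in t₀..τ, turnRate P (speed P (w'.φ τ) (w'.vs τ)) (w'.φ τ) (w'.β τ) δ =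
        ∫ _ in t₀..τ, ω := by
      apply intervalIntegral.integral_congr
      intro y hy
      rw [uIcc_of_le hτ] at hy
      simp only [h4 y hy.1, (h2 y hy.1).1, (h2 y hy.1).2, hω, Slip.v]
    rw [this, intervalIntegral.integral_const, smul_eq_mul]
    ring
  set E : ℂ := Complex.exp ((heading P w δ ψ₀ t₀ + w.φ t₀ : ℝ) * Complex.I) with hE
  set F : ℝ → ℂ := fun τ => -Complex.I * (w.v P t₀ / ω * E) *
    Complex.exp ((ω * (τ - t₀) : ℝ) * Complex.I) with hF
  have hωc : (ω : ℂ) ≠ 0 := by exact_mod_cast hω0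
  have hder : ∀ τ ∈ uIcc t₀ (t₀ + x), HasDerivAt F (velocity P w' δ ψ₀ τ) τ := by
    intro τ hτ
    rw [uIcc_of_le (by linarith)] at hτ
    have d1 : HasDerivAt (fun τ : ℝ => ω * (τ - t₀)) ω τ := by
      simpa using ((hasDerivAt_id τ).sub_const t₀).const_mul ω
    have d2 := ((d1.ofReal_comp).mul_const Complex.I).cexp.const_mul
      (-Complex.I * (w.v P t₀ / ω * E))
    refine d2.congr_deriv ?_
    have : velocity P w' δ ψ₀ τ = w.v P t₀ * (E * Complex.exp ((ω * (τ - t₀) : ℝ) * Complex.I)) := by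
      rw [velocity, hhead τ hτ.1, hE, ← Complex.exp_add]
      simp only [Slip.v, h4 τ hτ.1, (h2 τ hτ.1).2]
      congr 2
      push_cast
      ring
    rw [this]
    field_simp
    linear_combination (-(w.v P t₀ : ℂ) * E) * Complex.I_sq
  rw [intervalIntegral.integral_eq_sub_of_hasDerivAt hder
    (velocity_intervalIntegrable hw' hδ ht₀ (by linarith))]
  simp only [hF, sub_self, mul_zero, add_sub_cancel_left]
  rw [Complex.exp_ofReal_mul_I, Complex.exp_ofReal_mul_I]
  simp only [Real.cos_zero, Real.sin_zero]
  push_cast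
  field_simp
  linear_combination (-(w.v P t₀ : ℂ) * E * Complex.sin (ω * x)) * Complex.I_sq
end

theorem sq_eq_one_of_sign {g : ℝ} (hg : g = 1 ∨ g = -1) : g * g = 1 := by
  rcases hg with rfl | rfl <;> norm_num

set_option maxHeartbeats 1000000 in
/-- The position and velocity at which the boundary of the domain may be touched. -/
theorem touching {P : Params} {C : RefPath} (hC : C.ClosestWellDefined P.lam)
    (hK : C.kBar < P.kV - Real.tan P.phiBar / P.L) {w : Slip} (hw : w.Admissible P)
    {g ψ₀ : ℝ} {ζ₀ : ℂ} (hg : g = 1 ∨ g = -1)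
    (hdisc : Metric.closedBall (circleCenter P g ψ₀ ζ₀) (sweptRadius P g ψ₀ ζ₀) ⊆ C.domain P.lam)
    {t₀ s z : ℝ} (ht₀ : 0 ≤ t₀) (ht₀T : t₀ < 2 * P.T)
    (hs : C.IsClosest s (C.point s z)) (hz : C.kBar * |z| = P.lam) {ς : ℝ} (hς : ς = 1 ∨ ς = -1)
    (hςz : ς * z = |z|) (hpos : position P w (P.dmax * g) ψ₀ ζ₀ t₀ = C.point s z) :
    0 < ς * Real.sin (C.tang s - heading P w (P.dmax * g) ψ₀ t₀ - w.φ t₀) ∨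
    (Real.sin (C.tang s - heading P w (P.dmax * g) ψ₀ t₀ - w.φ t₀) = 0 ∧
      Real.cos (C.tang s - heading P w (P.dmax * g) ψ₀ t₀ - w.φ t₀) = -(g * ς) ∧
      w.φ t₀ = -(g * P.phiBar)) := by
  have hδ := abs_dmax_mul (P := P) hg
  set δ := P.dmax * g with hδdef
  set ψ := heading P w δ ψ₀ t₀ with hψ
  set ϑ := C.tang s - ψ with hϑ
  set ρ := sweptRadius P g ψ₀ ζ₀ with hρ
  set c₀ := circleCenter P g ψ₀ ζ₀ with hc₀
  set p := C.point s z with hp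
  set d := C.dir s with hd
  have hdn : ‖d‖ = 1 := C.norm_dir s
  have hςς := sq_eq_one_of_sign hς
  have hgg := sq_eq_one_of_sign hg
  have hz0 : 0 < |z| := by
    rcases (abs_nonneg z).eq_or_lt with h | h
    · rw [← h, mul_zero] at hz; linarith [P.lam_pos]
    · exact h
  have hzς : z = ς * |z| := by rw [← hςz]; linear_combination (-z) * hςς
  have hdI : inner ℝ d (Complex.I * d) = (0 : ℝ) := by rw [real_inner_comm]; exact C.inner_dir_I s
  have hII : inner ℝ (Complex.I * d) (Complex.I * d) = (1 : ℝ) := by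
    rw [real_inner_self_eq_norm_sq]; simp [hdn]
  have hdd : inner ℝ d d = (1 : ℝ) := by rw [real_inner_self_eq_norm_sq]; simp [hdn]
  have hinner : ∀ a b : ℝ, inner ℝ ((a : ℂ) * d + (b : ℂ) * (Complex.I * d)) (z * (Complex.I * d))
      = b * z := by
    intro a b
    simp only [← Complex.real_smul, inner_add_left, inner_smul_left, inner_smul_right, hdI, hII]
    simp [mul_comm]
  have hexp : ∀ y : ℝ, Complex.exp ((ψ + y : ℝ) * Complex.I) =
      (Real.cos (ϑ - y) : ℂ) * d + ((-Real.sin (ϑ - y) : ℝ) : ℂ) * (Complex.I * d) := by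
    intro y
    have : ((ψ + y : ℝ) : ℂ) * Complex.I = C.tang s * Complex.I + ((-(ϑ - y) : ℝ) : ℂ) * Complex.I := by
      rw [hϑ]; push_cast; ring
    rw [this, Complex.exp_add, Complex.exp_ofReal_mul_I (-(ϑ - y)), Real.cos_neg, Real.sin_neg]
    change d * _ = _
    push_cast
    ring
  -- Any admissible slip angle may come right after `t₀`, and the motion still stays in the disc. An
  -- outward velocity would take it out of the domain by `exit`.
  have first : ∀ φ₁, |φ₁| ≤ P.phiBar → 0 ≤ ς * Real.sin (ϑ - φ₁) := by
    intro φ₁ hφ₁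
    by_contra! hneg
    have hv := speed_pos hφ₁ (hw.vs_le t₀ ht₀)
    obtain ⟨η, hη, h₀, hh₀, hexit⟩ := hC.exit hz P.lam_pos hs
      (V := speed P φ₁ (w.vs t₀) * Complex.exp ((ψ + φ₁ : ℝ) * Complex.I)) (by
        rw [hexp, mul_add, ← mul_assoc, ← mul_assoc, ← Complex.ofReal_mul, ← Complex.ofReal_mul,
          hinner, hzς]
        have := mul_pos hv (mul_pos (neg_pos.2 hneg) hz0)
        linarith)
    obtain ⟨x₀, hx₀, hnear⟩ := exists_position_near (ψ₀ := ψ₀) (ζ₀ := ζ₀) hw hδ ht₀ hφ₁ hη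
    set x := min (h₀ / 2) (min (x₀ / 2) (2 * P.T - t₀)) with hx
    have hxpos : 0 < x := lt_min (by linarith) (lt_min (by linarith) (by linarith))
    have hx1 : x ≤ h₀ / 2 := min_le_left _ _
    have hx2 : x ≤ x₀ / 2 := (min_le_right _ _).trans (min_le_left _ _)
    have hx3 : x ≤ 2 * P.T - t₀ := (min_le_right _ _).trans (min_le_right _ _)
    obtain ⟨w', hw', hle⟩ := hnear x hxpos (by linarith)
    rw [hpos] at hle
    have h1 := hexit x hxpos (by linarith) _ hle
    have h2 := (hdisc (position_mem_closedBall hg hw' (t := t₀ + x) ⟨by linarith, by linarith⟩)).1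
    exact absurd h2 (not_le.2 h1)
  have hφt := hw.φ_le t₀ ht₀
  rcases (first _ hφt).lt_or_eq with h | h
  · exact Or.inl h
  right
  have hsin : Real.sin (ϑ - w.φ t₀) = 0 := by
    rcases mul_eq_zero.1 h.symm with h | h
    · rcases hς with h' | h' <;> rw [h'] at h <;> norm_num at h
    · exact h
  set c := Real.cos (ϑ - w.φ t₀) with hc
  have hc1 : c = 1 ∨ c = -1 := by
    have := Real.sin_sq_add_cos_sq (ϑ - w.φ t₀)
    rw [hsin] at this
    exact mul_self_eq_one_iff.1 (by rw [hc]; linarith)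
  have hcc := sq_eq_one_of_sign hc1
  -- At a zero of the sine, `first` fixes the sign of `sin (w.φ t₀ - φ₁)` for all admissible `φ₁`,
  -- so `w.φ t₀` is an end of its range.
  have hextreme : w.φ t₀ = ς * c * P.phiBar := by
    have hall : ∀ φ₁, |φ₁| ≤ P.phiBar → 0 ≤ ς * c * Real.sin (w.φ t₀ - φ₁) := by
      intro φ₁ hφ₁
      have := first φ₁ hφ₁
      rw [show ϑ - φ₁ = (ϑ - w.φ t₀) + (w.φ t₀ - φ₁) by ring, Real.sin_add, hsin, zero_mul,
        zero_add] at this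
      rw [mul_assoc]; exact this
    have hφb := abs_le.1 hφt
    have hpb := P.phiBar_lt
    have hp0 := P.phiBar_nonneg
    have hςc : ς * c = 1 ∨ ς * c = -1 := by
      rcases hς with h1 | h1 <;> rcases hc1 with h2 | h2 <;> rw [h1, h2] <;> norm_num
    rcases hςc with h1 | h1
    · have := hall P.phiBar (by rw [abs_of_nonneg hp0])
      rw [h1, one_mul] at this ⊢
      by_contra hne
      have : Real.sin (w.φ t₀ - P.phiBar) < 0 :=
        Real.sin_neg_of_neg_of_neg_pi_lt (by
          have := lt_of_le_of_ne hφb.2 (by simpa using hne)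
          linarith) (by linarith)
      linarith
    · have := hall (-P.phiBar) (by rw [abs_neg, abs_of_nonneg hp0])
      rw [h1] at this ⊢
      by_contra hne
      have : 0 < Real.sin (w.φ t₀ - -P.phiBar) :=
        Real.sin_pos_of_pos_of_lt_pi (by
          have := lt_of_le_of_ne hφb.1 (fun h => hne (by linarith))
          linarith) (by linarith)
      linarith
  -- position relative to the center of the disc
  have hpK : p ∈ Metric.closedBall c₀ ρ := by
    rw [← hpos]; exact position_mem_closedBall hg hw ⟨ht₀, ht₀T.le⟩
  set q := p - c₀ with hq
  have hqρ : ‖q‖ ≤ ρ := by rwa [Metric.mem_closedBall, dist_eq_norm] at hpK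
  -- Rays with a positive component along `ς * (I * d)`, whatever the tangential component `M`,
  -- leave the domain and so the disc. Hence `p` lies on the bounding circle, and the outward normal
  -- there is `ς * (I * d)`.
  have hout : ∀ M : ℝ, ∃ h₀ > 0, ∀ x : ℝ, 0 < x → x < h₀ →
      ρ < ‖q + x * ((M : ℂ) * d + (ς : ℂ) * (Complex.I * d))‖ := by
    intro M
    obtain ⟨η, hη, h₀, hh₀, hexit⟩ := hC.exit hz P.lam_pos hs
      (V := (M : ℂ) * d + (ς : ℂ) * (Complex.I * d)) (by rw [hinner, hςz]; exact hz0)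
    refine ⟨h₀, hh₀, fun x hx hxh => ?_⟩
    by_contra! hle
    have h1 := hexit x hx hxh (p + x * ((M : ℂ) * d + (ς : ℂ) * (Complex.I * d))) (by
      rw [show p + x * ((M : ℂ) * d + (ς : ℂ) * (Complex.I * d)) - p -
        x * ((M : ℂ) * d + (ς : ℂ) * (Complex.I * d)) = 0 by ring, norm_zero]
      positivity)
    have h2 : p + x * ((M : ℂ) * d + (ς : ℂ) * (Complex.I * d)) ∈ Metric.closedBall c₀ ρ := by
      rw [Metric.mem_closedBall, dist_eq_norm]
      rwa [show p + x * ((M : ℂ) * d + (ς : ℂ) * (Complex.I * d)) - c₀ =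
        q + x * ((M : ℂ) * d + (ς : ℂ) * (Complex.I * d)) by rw [hq]; ring]
    exact absurd (hdisc h2).1 (not_le.2 h1)
  set a₁ := inner ℝ d q with ha₁
  set a₂ := inner ℝ (Complex.I * d) q with ha₂
  have hqdec : q = (a₁ : ℂ) * d + (a₂ : ℂ) * (Complex.I * d) := eq_inner_add_inner hdn q
  have hnorm : ∀ x y : ℝ, ‖(x : ℂ) * d + (y : ℂ) * (Complex.I * d)‖ ^ 2 = x ^ 2 + y ^ 2 := by
    intro x y
    rw [show (x : ℂ) * d + (y : ℂ) * (Complex.I * d) = ((x : ℂ) + y * Complex.I) * d by ring,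
      norm_mul, hdn, mul_one, ← Complex.normSq_eq_norm_sq, Complex.normSq_add_mul_I]
  have hρ0 : 0 < ρ := sweptRadius_pos
  have hq2 : a₁ ^ 2 + a₂ ^ 2 ≤ ρ ^ 2 := by
    rw [← hnorm, ← hqdec]; gcongr
  have hout2 : ∀ M : ℝ, ∃ h₀ > 0, ∀ x : ℝ, 0 < x → x < h₀ →
      ρ ^ 2 < (a₁ + x * M) ^ 2 + (a₂ + x * ς) ^ 2 := by
    intro M
    obtain ⟨h₀, hh₀, h⟩ := hout M
    refine ⟨h₀, hh₀, fun x hx hxh => ?_⟩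
    have h1 := h x hx hxh
    rw [← hnorm, show ((a₁ + x * M : ℝ) : ℂ) * d + ((a₂ + x * ς : ℝ) : ℂ) * (Complex.I * d) =
      q + x * ((M : ℂ) * d + (ς : ℂ) * (Complex.I * d)) by rw [hqdec]; push_cast; ring]
    gcongr
  have hhalf : ∀ M : ℝ, 0 ≤ a₁ * M + a₂ * ς := by
    intro M
    by_contra! hneg
    obtain ⟨h₀, hh₀, h⟩ := hout2 M
    set x := min (h₀ / 2) (-(a₁ * M + a₂ * ς) / (M ^ 2 + 1)) with hx
    have hx0 : 0 < x := lt_min (by linarith) (div_pos (by linarith) (by positivity))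
    have h1 := h x hx0 (by linarith [min_le_left (h₀ / 2) (-(a₁ * M + a₂ * ς) / (M ^ 2 + 1))])
    have h2 : x * (M ^ 2 + 1) ≤ -(a₁ * M + a₂ * ς) := by
      rw [← le_div_iff₀ (by positivity)]; exact min_le_right _ _
    have h3 : (a₁ + x * M) ^ 2 + (a₂ + x * ς) ^ 2 =
        a₁ ^ 2 + a₂ ^ 2 + 2 * (x * (a₁ * M + a₂ * ς)) + x * (x * (M ^ 2 + 1)) := by
      linear_combination x ^ 2 * hςς
    have h4 := mul_le_mul_of_nonneg_left h2 hx0.le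
    have h5 := mul_pos hx0 (neg_pos.2 hneg)
    linarith
  have ha10 : a₁ = 0 := by
    by_contra hne
    -- This `M` makes the expression equal to `-1`.
    have := hhalf (-(a₂ * ς + 1) / a₁)
    rw [mul_div_cancel₀ _ hne] at this
    linarith
  have ha2 : 0 ≤ a₂ * ς := by simpa [ha10] using hhalf 0
  have ha2ρ : ρ ≤ a₂ * ς := by
    by_contra! hlt
    obtain ⟨h₀, hh₀, h⟩ := hout2 0
    set x := min (h₀ / 2) (ρ - a₂ * ς) with hx
    have hx0 : 0 < x := lt_min (by linarith) (by linarith)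
    have h1 := h x hx0 (by linarith [min_le_left (h₀ / 2) (ρ - a₂ * ς)])
    have h2 : x ≤ ρ - a₂ * ς := min_le_right _ _
    rw [ha10] at h1
    have h3 : (a₂ + x * ς) ^ 2 = (a₂ * ς + x) ^ 2 := by
      linear_combination (-(a₂ ^ 2) + x ^ 2) * hςς
    nlinarith
  -- the sense of rotation
  have hgcς : g * (ς * c) ≠ 1 := by
    intro hcon
    have hςc : ς * c = g := by
      calc ς * c = (g * g) * (ς * c) := by rw [hgg, one_mul]
        _ = g * (g * (ς * c)) := by ring
        _ = g := by rw [hcon, mul_one]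
    have hv := hw.v_pos ht₀
    set ω := turnRate P (w.v P t₀) (w.φ t₀) (w.β t₀) δ with hω
    have hgω : 0 < g * ω := by
      rw [hω, turnRate, hextreme, hςc]
      have h1 : g * (Real.tan (δ + w.β t₀) - Real.tan (g * P.phiBar)) =
          Real.tan (P.dmax + g * w.β t₀) - Real.tan P.phiBar := by
        rcases hg with rfl | rfl
        · simp [hδdef]
        · rw [hδdef, show P.dmax * -1 + w.β t₀ = -(P.dmax + -1 * w.β t₀) by ring, Real.tan_neg,
            show -1 * P.phiBar = -P.phiBar by ring, Real.tan_neg]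
          ring
      have hβ : |g * w.β t₀| ≤ P.betaBar := by
        rw [abs_mul]
        rcases hg with rfl | rfl <;> simpa using hw.β_le t₀ ht₀
      have hβ' := abs_le.1 hβ
      have h2 : Real.tan (P.dmax - P.betaBar) ≤ Real.tan (P.dmax + g * w.β t₀) :=
        Real.strictMonoOn_tan.monotoneOn
          ⟨by linarith [P.betaBar_lt, Real.pi_pos], by linarith [P.dmax_add_lt, P.betaBar_nonneg]⟩
          ⟨by linarith [P.betaBar_lt, Real.pi_pos], by linarith [P.dmax_add_lt]⟩ (by linarith)
      have h3 : Real.tan P.phiBar < Real.tan (P.dmax - P.betaBar) := by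
        have := C.kBar_nonneg
        have h4 : Real.tan P.phiBar / P.L < Real.tan (P.dmax - P.betaBar) / P.L := by
          change C.kBar < Real.tan (P.dmax - P.betaBar) / P.L - _ at hK
          linarith
        exact (div_lt_div_iff_of_pos_right P.L_pos).1 h4
      calc 0 < w.v P t₀ / P.L * (Real.tan (P.dmax + g * w.β t₀) - Real.tan P.phiBar) :=
            mul_pos (div_pos hv P.L_pos) (by linarith)
        _ = _ := by rw [← h1]; ring
    have hω0 : ω ≠ 0 := fun h => by rw [h, mul_zero] at hgω; exact lt_irrefl _ hgω
    -- With the slips frozen, the vehicle starts along the tangent to the circle and bends outwards,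
    -- gaining `v * (1 - cos (ω * x)) / (g * ω) > 0` along the outward normal. It would thus leave
    -- the disc that contains all admissible motions. The duration `x ≤ π / |ω|` ensures `cos (ω *
    -- x) < 1`.
    obtain ⟨w', hw', harc⟩ := exists_position_arc (ψ₀ := ψ₀) (ζ₀ := ζ₀) hw hδ ht₀ hω hω0
    set x := min (2 * P.T - t₀) (Real.pi / |ω|) with hx
    have hω' := abs_pos.2 hω0
    have hx0 : 0 < x := lt_min (by linarith) (div_pos Real.pi_pos hω')
    have hx1 : x ≤ 2 * P.T - t₀ := min_le_left _ _
    have hx2 : |ω * x| ≤ Real.pi := by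
      rw [abs_mul, abs_of_pos hx0, mul_comm, ← le_div_iff₀ hω']
      exact min_le_right _ _
    have hcos : Real.cos (ω * x) < 1 := by
      refine lt_of_le_of_ne (Real.cos_le_one _) fun h1 => ?_
      have h2 := abs_le.1 hx2
      have := (Real.cos_eq_one_iff_of_lt_of_lt (by linarith [Real.pi_pos])
        (by linarith [Real.pi_pos])).1 h1
      exact (mul_ne_zero hω0 hx0.ne') this
    have hmem := position_mem_closedBall (ψ₀ := ψ₀) (ζ₀ := ζ₀) hg hw' (t := t₀ + x)
      ⟨by linarith, by linarith⟩
    rw [harc x hx0.le, hpos, hexp, hsin, Metric.mem_closedBall, dist_eq_norm] at hmem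
    have heq : p + (w.v P t₀ : ℂ) * ((c : ℂ) * d + ((-0 : ℝ) : ℂ) * (Complex.I * d)) *
        ((Real.sin (ω * x) / ω : ℝ) + ((1 - Real.cos (ω * x)) / ω : ℝ) * Complex.I) - c₀ =
        ((w.v P t₀ * c * (Real.sin (ω * x) / ω) : ℝ) : ℂ) * d +
        ((a₂ + w.v P t₀ * c * ((1 - Real.cos (ω * x)) / ω) : ℝ) : ℂ) * (Complex.I * d) := by
      have : p - c₀ = (a₂ : ℂ) * (Complex.I * d) := by
        rw [← hq, hqdec, ha10]; simp
      push_cast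
      linear_combination this
    have hsq : ‖p + (w.v P t₀ : ℂ) * ((c : ℂ) * d + ((-0 : ℝ) : ℂ) * (Complex.I * d)) *
        ((Real.sin (ω * x) / ω : ℝ) + ((1 - Real.cos (ω * x)) / ω : ℝ) * Complex.I) - c₀‖ ^ 2
        ≤ ρ ^ 2 := by gcongr
    rw [heq, hnorm] at hsq
    have hA : 0 < w.v P t₀ * (1 - Real.cos (ω * x)) / (g * ω) :=
      div_pos (mul_pos hv (by linarith)) hgω
    have hB : ς * (a₂ + w.v P t₀ * c * ((1 - Real.cos (ω * x)) / ω)) =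
        a₂ * ς + w.v P t₀ * (1 - Real.cos (ω * x)) / (g * ω) := by
      have hg0 : g ≠ 0 := fun h => by rw [h] at hgg; norm_num at hgg
      have : w.v P t₀ * (1 - Real.cos (ω * x)) / (g * ω) =
          (ς * c) * (w.v P t₀ * ((1 - Real.cos (ω * x)) / ω)) := by
        rw [hςc]
        field_simp
        linear_combination (-(1 - Real.cos (ω * x))) * hgg
      rw [this]; ring
    have hC2 : (a₂ + w.v P t₀ * c * ((1 - Real.cos (ω * x)) / ω)) ^ 2 =
        (a₂ * ς + w.v P t₀ * (1 - Real.cos (ω * x)) / (g * ω)) ^ 2 := by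
      rw [← hB]
      linear_combination (-(a₂ + w.v P t₀ * c * ((1 - Real.cos (ω * x)) / ω)) ^ 2) * hςς
    rw [hC2] at hsq
    nlinarith [sq_nonneg (w.v P t₀ * c * (Real.sin (ω * x) / ω))]
  have hςcg : ς * c = -g := by
    rcases hς with h1 | h1 <;> rcases hc1 with h2 | h2 <;> rcases hg with h3 | h3 <;>
      rw [h1, h2, h3] at hgcς ⊢ <;> first | (norm_num; done) | (norm_num at hgcς)
  refine ⟨hsin, ?_, by rw [hextreme, hςcg]; ring⟩
  linear_combination ς * hςcg - c * hςς

/-! ### The first stage of the motion -/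

/-- Continuous induction in which a step may use the property on the whole past; the analysis of a
contact with the boundary relies on the entire preceding motion. -/
theorem forall_Icc_of_step {p : ℝ → Prop} {a b : ℝ} (h0 : p a)
    (hc : IsClosed {t ∈ Icc a b | p t})
    (h : ∀ t ∈ Ico a b, (∀ τ ∈ Icc a t, p τ) → ∃ t₁, t < t₁ ∧ ∀ τ ∈ Icc t t₁, τ ≤ b → p τ) :
    ∀ t ∈ Icc a b, p t := by
  by_contra! hne
  set X := {t ∈ Icc a b | ¬ p t} with hX
  have hXne : X.Nonempty := hne
  have hbdd : BddBelow X := ⟨a, fun t ht => ht.1.1⟩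
  set t := sInf X with ht
  have hat : a ≤ t := le_csInf hXne fun x hx => hx.1.1
  obtain ⟨x₀, hx₀⟩ := hXne
  have htb : t ≤ b := (csInf_le hbdd hx₀).trans hx₀.1.2
  have hlt : ∀ τ ∈ Ico a t, p τ := by
    intro τ hτ
    by_contra hp
    exact absurd (csInf_le hbdd (show τ ∈ X from ⟨⟨hτ.1, hτ.2.le.trans htb⟩, hp⟩)) (not_le.2 hτ.2)
  have hpt : p t := by
    rcases hat.eq_or_lt with h1 | h1
    · rw [← h1]; exact h0
    · have : t ∈ closure {t ∈ Icc a b | p t} := by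
        have hsub : Ico a t ⊆ {t ∈ Icc a b | p t} := fun τ hτ => ⟨⟨hτ.1, hτ.2.le.trans htb⟩, hlt τ hτ⟩
        refine closure_mono hsub ?_
        rw [closure_Ico h1.ne]
        exact ⟨hat, le_rfl⟩
      rw [hc.closure_eq] at this
      exact this.2
  have hle : ∀ τ ∈ Icc a t, p τ := fun τ hτ => hτ.2.eq_or_lt.elim (fun h => h ▸ hpt)
    fun h => hlt τ ⟨hτ.1, h⟩
  have htb' : t < b := by
    refine lt_of_le_of_ne htb fun h1 => ?_
    exact hx₀.2 (hle x₀ ⟨hx₀.1.1, h1 ▸ hx₀.1.2⟩)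
  obtain ⟨t₁, ht₁, hp⟩ := h t ⟨hat, htb'⟩ hle
  obtain ⟨x, hx, hxt⟩ := exists_lt_of_csInf_lt ⟨x₀, hx₀⟩ (show sInf X < t₁ from ht₁)
  exact hx.2 (hp x ⟨csInf_le hbdd hx, hxt.le⟩ hx.1.2)

theorem exists_Icc_of_eventually {p : ℝ → Prop} {a b : ℝ} (hab : a < b)
    (h : ∀ᶠ t in 𝓝[Icc a b] a, p t) : ∃ t₁, a < t₁ ∧ t₁ ≤ b ∧ ∀ t ∈ Icc a t₁, p t := by
  rw [nhdsWithin_Icc_eq_nhdsGE hab] at h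
  obtain ⟨u, hu, hs⟩ := (mem_nhdsGE_iff_exists_Icc_subset).1 h
  exact ⟨min u b, lt_min hu hab, min_le_right _ _, fun t ht =>
    hs ⟨ht.1, ht.2.trans (min_le_left _ _)⟩⟩

section
variable {P : Params} {C : RefPath} {w : Slip} {u : ℝ → State → ℝ} {b : ℝ} {s z θ : ℝ → ℝ}

/-- The first coordinate is the abscissa of the closest point, which is not too far. -/
def Good (P : Params) (C : RefPath) (s z : ℝ) : Prop :=
  C.IsClosest s (C.point s z) ∧ C.kBar * |z| ≤ P.lam

theorem Good.lt_one {s z : ℝ} (h : Good P C s z) : C.kBar * |z| < 1 := h.2.trans_lt P.lam_lt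

theorem Motion.isClosed_good (m : Motion P C w u b s z θ) :
    IsClosed {t ∈ Icc 0 b | Good P C (s t) (z t)} := by
  have hz := m.z_cont.abs
  have h1 : IsClosed {t ∈ Icc 0 b | C.kBar * |z t| ≤ P.lam} :=
    isClosed_Icc.isClosed_le (continuousOn_const.mul hz) continuousOn_const
  have h2 : ∀ s' ∈ C.dom, IsClosed {t ∈ Icc 0 b | |z t| ≤ dist (C.point (s t) (z t)) (C.r s')} :=
    fun s' _ => isClosed_Icc.isClosed_le hz (continuous_dist.comp_continuousOn (m.point_cont.prodMk continuousOn_const))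
  convert h1.inter (isClosed_biInter h2) using 1
  ext t
  obtain ⟨s₁, hs₁⟩ := C.exists_regular
  simp only [mem_ofPred_eq, mem_inter_iff, mem_iInter, Good, RefPath.IsClosest, C.dist_point_r]
  exact ⟨fun h => ⟨⟨h.1, h.2.2⟩, fun s' hs' => ⟨h.1, h.2.1.2 s' hs'⟩⟩,
    fun h => ⟨h.1.1, ⟨interior_subset (m.mem t h.1.1), fun s' hs' => (h.2 s' hs').2⟩, h.1.2⟩⟩

theorem Motion.tendsto_within (m : Motion P C w u b s z θ) {t₀ : ℝ} (ht₀ : t₀ ∈ Ico 0 b) :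
    Tendsto (fun t => (s t, z t, θ t)) (𝓝[Icc t₀ b] t₀) (𝓝 (s t₀, z t₀, θ t₀)) := by
  have hsub : Icc t₀ b ⊆ Icc 0 b := Icc_subset_Icc_left ht₀.1
  have hmem : t₀ ∈ Icc 0 b := ⟨ht₀.1, ht₀.2.le⟩
  exact ((m.s_cont t₀ hmem).mono hsub).prodMk_nhds
    (((m.z_cont t₀ hmem).mono hsub).prodMk_nhds ((m.θ_cont t₀ hmem).mono hsub))

theorem Motion.eventually_isClosest (m : Motion P C w u b s z θ) (hC : C.ClosestWellDefined P.lam)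
    {t₀ : ℝ} (ht₀ : t₀ ∈ Ico 0 b) (hg : Good P C (s t₀) (z t₀)) :
    ∀ᶠ t in 𝓝[Icc t₀ b] t₀, C.IsClosest (s t) (C.point (s t) (z t)) := by
  have h := hC.eventually_isClosest P.lam_lt (m.mem t₀ ⟨ht₀.1, ht₀.2.le⟩) hg.2 hg.1
  have h2 := m.tendsto_within ht₀
  exact ((continuous_fst.tendsto _).comp h2 |>.prodMk_nhds
    ((continuous_fst.comp continuous_snd).tendsto _ |>.comp h2)).eventually h

theorem tendsto_within_of_continuousOn {f : ℝ → ℝ} (hf : ContinuousOn f (Ici 0)) {t₀ : ℝ}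
    (ht₀ : 0 ≤ t₀) : Tendsto f (𝓝[Icc t₀ b] t₀) (𝓝 (f t₀)) :=
  (hf t₀ ht₀).mono fun _ hx => ht₀.trans hx.1

/-- The motion stays good as long as the distance to the path does not increase. -/
theorem Motion.exists_good_of_inward (m : Motion P C w u b s z θ) (hC : C.ClosestWellDefined P.lam)
    {t₀ : ℝ} (ht₀ : t₀ ∈ Ico 0 b) (hg : Good P C (s t₀) (z t₀))
    (h : C.kBar * |z t₀| = P.lam → ∀ ς : ℝ, (ς = 1 ∨ ς = -1) → ς * z t₀ = |z t₀| →
      ∃ t₁, t₀ < t₁ ∧ t₁ ≤ b ∧ ∀ t ∈ Ioo t₀ t₁, 0 ≤ ς * Real.sin (θ t - w.φ t))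
    (hw : w.Admissible P) :
    ∃ t₁, t₀ < t₁ ∧ t₁ ≤ b ∧ ∀ t ∈ Icc t₀ t₁, Good P C (s t) (z t) := by
  have hzt : Tendsto z (𝓝[Icc t₀ b] t₀) (𝓝 (z t₀)) :=
    ((continuous_fst.comp continuous_snd).tendsto _).comp (m.tendsto_within ht₀)
  have hcl := m.eventually_isClosest hC ht₀ hg
  rcases hg.2.lt_or_eq with hlt | heq
  · have h1 : ∀ᶠ t in 𝓝[Icc t₀ b] t₀, C.kBar * |z t| < P.lam :=
      (hzt.abs.const_mul C.kBar).eventually (gt_mem_nhds hlt)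
    exact exists_Icc_of_eventually ht₀.2 (hcl.mp (h1.mono fun t h1 h2 => ⟨h2, h1.le⟩))
  · have hz0 : 0 < |z t₀| := by
      rcases (abs_nonneg (z t₀)).eq_or_lt with h | h
      · rw [← h, mul_zero] at heq; linarith [P.lam_pos]
      · exact h
    obtain ⟨ς, hς, hςz⟩ : ∃ ς : ℝ, (ς = 1 ∨ ς = -1) ∧ ς * z t₀ = |z t₀| := by
      rcases le_total 0 (z t₀) with h | h
      · exact ⟨1, Or.inl rfl, by rw [abs_of_nonneg h, one_mul]⟩
      · exact ⟨-1, Or.inr rfl, by rw [abs_of_nonpos h]; ring⟩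
    obtain ⟨t₁, ht₁, ht₁b, hin⟩ := h heq ς hς hςz
    have h1 : ∀ᶠ t in 𝓝[Icc t₀ b] t₀, C.kBar * |z t| < 1 :=
      (hzt.abs.const_mul C.kBar).eventually (gt_mem_nhds hg.lt_one)
    have h2 : ∀ᶠ t in 𝓝[Icc t₀ b] t₀, 0 < ς * z t :=
      (hzt.const_mul ς).eventually (lt_mem_nhds (by rw [hςz]; exact hz0))
    obtain ⟨t₂, ht₂, ht₂b, hall⟩ := exists_Icc_of_eventually ht₀.2 (hcl.and (h1.and h2))
    refine ⟨min t₁ t₂, lt_min ht₁ ht₂, (min_le_left _ _).trans ht₁b, fun t ht => ?_⟩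
    have htt₁ : t ≤ t₁ := ht.2.trans (min_le_left _ _)
    have htt₂ : t ≤ t₂ := ht.2.trans (min_le_right _ _)
    have hς1 : |ς| = 1 := by rcases hς with rfl | rfl <;> simp
    have habs : ∀ t ∈ Icc t₀ t₂, |z t| = ς * z t := by
      intro t ht
      rw [← abs_of_pos (hall t ht).2.2, abs_mul, hς1, one_mul]
    have hac : AbsolutelyContinuousOnInterval (fun t => ς * z t) t₀ t :=
      (ac_mono m.z_ac ht₀.1 ht.1 (htt₁.trans ht₁b)).const_mul ς
    have hmono := ac_sub_le (m := 0) ht.1 hac (by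
      filter_upwards [m.incl] with τ hτ hτ'
      obtain ⟨y, hy, -, hyz, -⟩ := hτ ⟨ht₀.1.trans_lt hτ'.1, hτ'.2.trans_le (htt₁.trans ht₁b)⟩
      refine ⟨_, hyz.const_mul ς, ?_⟩
      have hτ0 : 0 ≤ τ := ht₀.1.trans hτ'.1.le
      rw [filippov_zDot (x := (s τ, z τ, θ τ)) hτ0
        (m.mem τ ⟨hτ0, hτ'.2.le.trans (htt₁.trans ht₁b)⟩)
        (hall τ ⟨hτ'.1.le, hτ'.2.le.trans htt₂⟩).2.1 hy]
      have h3 := mul_nonneg (hw.v_pos hτ0).le (hin τ ⟨hτ'.1, hτ'.2.trans_le htt₁⟩)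
      simp only [zDot]
      linarith)
    refine ⟨(hall t ⟨ht.1, htt₂⟩).1, ?_⟩
    rw [← heq]
    refine mul_le_mul_of_nonneg_left ?_ C.kBar_nonneg
    rw [habs t ⟨ht.1, htt₂⟩, ← hςz]
    linarith

/-! ### Neighborhoods up to null sets, and motions far from the sliding surface. -/

/-- Neighborhoods of a state up to null sets. -/
def nearAE (x : State) : Filter State := 𝓝 x ⊓ ae volume

theorem eventually_nearAE {x : State} {p : State → Prop} : (∀ᶠ x' in nearAE x, p x') ↔
    ∃ ρ > 0, ∃ N : Set State, volume N = 0 ∧ ∀ x' ∈ Metric.ball x ρ \ N, p x' := by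
  constructor
  · intro h
    obtain ⟨A, hA, B, hB, hAB⟩ := mem_inf_iff.1 h
    obtain ⟨ρ, hρ, hball⟩ := Metric.mem_nhds_iff.1 hA
    refine ⟨ρ, hρ, Bᶜ, mem_ae_iff.1 hB, fun x' hx' => ?_⟩
    have : x' ∈ A ∩ B := ⟨hball hx'.1, not_not.1 hx'.2⟩
    rw [← hAB] at this
    exact this
  · rintro ⟨ρ, hρ, N, hN, h⟩
    have h1 : Metric.ball x ρ ∈ 𝓝 x ⊓ ae volume := mem_inf_of_left (Metric.ball_mem_nhds x hρ)
    have h2 : Nᶜ ∈ 𝓝 x ⊓ ae volume := mem_inf_of_right (by rw [mem_ae_iff, compl_compl]; exact hN)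
    exact mem_of_superset (inter_mem h1 h2) fun x' hx' => h x' hx'

/-- Neighborhoods of a time and of a state, the latter up to null sets. -/
def near (t : ℝ) (x : State) : Filter (ℝ × State) := 𝓝[Ici 0] t ×ˢ nearAE x

theorem eventually_near {t : ℝ} {x : State} {p : ℝ × State → Prop} : (∀ᶠ q in near t x, p q) ↔
    ∃ ρ > 0, ∃ N : Set State, volume N = 0 ∧ ∀ τ, 0 ≤ τ → |τ - t| < ρ →
      ∀ x' ∈ Metric.ball x ρ \ N, p (τ, x') := by
  rw [near, eventually_prod_iff]
  constructor
  · rintro ⟨pa, ha, pb, hb, h⟩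
    obtain ⟨ρ, hρ, N, hN, hball⟩ := eventually_nearAE.1 hb
    obtain ⟨δ, hδ, hA⟩ := Metric.mem_nhdsWithin_iff.1 ha
    refine ⟨min ρ δ, lt_min hρ hδ, N, hN, fun τ hτ hτt x' hx' => h ?_ (hball x'
      ⟨Metric.ball_subset_ball (min_le_left _ _) hx'.1, hx'.2⟩)⟩
    exact hA ⟨by rw [Metric.mem_ball, Real.dist_eq]; exact hτt.trans_le (min_le_right _ _), hτ⟩
  · rintro ⟨ρ, hρ, N, hN, h⟩
    refine ⟨fun τ => 0 ≤ τ ∧ |τ - t| < ρ, ?_, fun x' => x' ∈ Metric.ball x ρ \ N,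
      eventually_nearAE.2 ⟨ρ, hρ, N, hN, fun _ h => h⟩, fun hτ _ hx' => h _ hτ.1 hτ.2 _ hx'⟩
    exact Metric.mem_nhdsWithin_iff.2 ⟨ρ, hρ, fun τ hτ =>
      ⟨hτ.2, by rw [← Real.dist_eq]; exact hτ.1⟩⟩

theorem turnLim_iff {t : ℝ} {x : State} {D : ℝ} : TurnLim P w u t x D ↔
    Tendsto (fun q : ℝ × State => turnRate P (w.v P q.1) (w.φ q.1) (w.β q.1) (u q.1 q.2))
      (near t x) (𝓝 D) := by
  simp only [Metric.tendsto_nhds, eventually_near, Real.dist_eq]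
  rfl

/-- One ball and one null set serve all nearby centers. So an estimate of the field established near
the state at `t₀` is available along the motion for some time afterwards and yields a differential
inequality. -/
theorem eventually_eventually_near {t : ℝ} {x : State} {p : ℝ × State → Prop}
    (h : ∀ᶠ q in near t x, p q) :
    ∀ᶠ q in 𝓝[Ici 0] t ×ˢ 𝓝 x, ∀ᶠ x' in nearAE q.2, p (q.1, x') := by
  rw [near, eventually_prod_iff] at h
  obtain ⟨pa, ha, pb, hb, h⟩ := h
  obtain ⟨ρ, hρ, N, hN, hball⟩ := eventually_nearAE.1 hb
  filter_upwards [ha.prod_mk (Metric.ball_mem_nhds x hρ)] with q hq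
  have h1 : Metric.ball x ρ ∈ nearAE q.2 := mem_inf_of_left (Metric.isOpen_ball.mem_nhds hq.2)
  have h2 : Nᶜ ∈ nearAE q.2 := mem_inf_of_right (by rw [mem_ae_iff, compl_compl]; exact hN)
  filter_upwards [h1, h2] with x' h1 h2
  exact h hq.1 (hball x' ⟨h1, h2⟩)

theorem nearAE_le (x : State) : nearAE x ≤ 𝓝 x := inf_le_left

theorem near_le (t : ℝ) (x : State) : near t x ≤ 𝓝[Ici 0] t ×ˢ 𝓝 x :=
  prod_mono le_rfl inf_le_left

theorem tendsto_near_of_continuousOn {f : ℝ → ℝ} (hf : ContinuousOn f (Ici 0)) {t : ℝ}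
    (ht : 0 ≤ t) (x : State) : Tendsto (fun q : ℝ × State => f q.1) (near t x) (𝓝 (f t)) :=
  Tendsto.comp (hf t ht) tendsto_fst

theorem tendsto_near_snd (t : ℝ) (x : State) :
    Tendsto (fun q : ℝ × State => q.2) (near t x) (𝓝 x) :=
  tendsto_snd.mono_right inf_le_left

theorem RefPath.eventually_regular {x : State} (hx : x.1 ∈ interior C.dom) :
    ∀ᶠ x' in nearAE x, x'.1 ∈ C.dom \ C.brk :=
  eventually_nearAE.2 (C.κ_mem_near hx)

theorem eventually_near_of_snd {t : ℝ} {x : State} {p : State → Prop} (h : ∀ᶠ x' in nearAE x, p x') :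
    ∀ᶠ q in near t x, p q.2 := tendsto_snd.eventually h

theorem filippov_le_of_eventually {f : ℝ → State → State} {t : ℝ} {x y : State}
    (hy : y ∈ filippov f t x) (a b c B : ℝ)
    (h : ∀ ε > 0, ∀ᶠ x' in nearAE x, a * (f t x').1 + b * (f t x').2.1 + c * (f t x').2.2 ≤ B + ε) :
    a * y.1 + b * y.2.1 + c * y.2.2 ≤ B :=
  filippov_le hy a b c B fun ε hε => eventually_nearAE.1 (h ε hε)

theorem Motion.tendsto_near (m : Motion P C w u b s z θ) {t₀ : ℝ} (ht₀ : t₀ ∈ Ico 0 b) :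
    Tendsto (fun t => (t, (s t, z t, θ t))) (𝓝[Icc t₀ b] t₀)
      (𝓝[Ici 0] t₀ ×ˢ 𝓝 (s t₀, z t₀, θ t₀)) :=
  Tendsto.prodMk (tendsto_id.mono_left (nhdsWithin_mono _ fun _ h => ht₀.1.trans h.1))
    (m.tendsto_within ht₀)

theorem tan_sub_sign {g δ β φ : ℝ} (hg : g = 1 ∨ g = -1) :
    g * (Real.tan (δ * g + β) - Real.tan φ) = Real.tan (δ + g * β) - Real.tan (g * φ) := by
  rcases hg with rfl | rfl
  · simp
  · rw [show δ * -1 + β = -(δ + -1 * β) by ring, Real.tan_neg, show -1 * φ = -φ by ring,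
      Real.tan_neg]
    ring

theorem abs_mul_sign {g x y : ℝ} (hg : g = 1 ∨ g = -1) (h : |x| ≤ y) : |g * x| ≤ y := by
  rcases hg with rfl | rfl <;> simpa using h

theorem kV_le_tan {β : ℝ} (hβ : |β| ≤ P.betaBar) : P.kV ≤ Real.tan (P.dmax + β) / P.L := by
  have hβ' := abs_le.1 hβ
  refine div_le_div_of_nonneg_right ?_ P.L_pos.le
  exact Real.strictMonoOn_tan.monotoneOn
    ⟨by linarith [P.betaBar_lt, Real.pi_pos], by linarith [P.dmax_add_lt, P.betaBar_nonneg]⟩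
    ⟨by linarith [P.betaBar_lt, Real.pi_pos], by linarith [P.dmax_add_lt]⟩ (by linarith)

/-- The left-hand side is positive only for `a < 0`, when the denominator is at least 1. Hence the
factor `1 / (1 - k * z)` is not lost, and `kBar < kV - tan phiBar / L` will suffice at a contact
with the boundary. -/
theorem neg_div_one_sub_le {k a z : ℝ} (ha : |a| ≤ k) (hz : 0 ≤ z) (hkz : k * z < 1) :
    -a / (1 - a * z) ≤ k := by
  have ha' := abs_le.1 ha
  have h1 : 0 < 1 - a * z := one_sub_mul_pos ha (by rwa [abs_of_nonneg hz])
  rw [div_le_iff₀ h1]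
  nlinarith [mul_nonneg (mul_nonneg ((abs_nonneg a).trans ha) hz) (sub_nonneg.2 ha'.2),
    mul_nonneg (sub_nonneg.2 (show a * z ≤ 1 by linarith)) (by linarith : 0 ≤ k + a)]

/-- In the tangential case, the path contributes to `g * dθ/dt` at most about `kBar * v`, less than
the angular velocity of the vehicle, so `g * θ` does not increase. Besides, `g * φ` is least
possible at `t₀`. Hence `g * (θ - φ)` stays below its value at `t₀`, which keeps the velocity from
pointing outwards. -/
theorem Motion.inward_of_touching (m : Motion P C w u b s z θ) (hw : w.Admissible P)
    (hK : C.kBar < P.kV - Real.tan P.phiBar / P.L) {g : ℝ} (hg : g = 1 ∨ g = -1) {β : ℝ}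
    (hβ : |β| ≤ P.betaBar) {t₀ : ℝ} (ht₀ : t₀ ∈ Ico 0 b)
    (hlim : TurnLim P w u t₀ (s t₀, z t₀, θ t₀)
      (turnRate P (w.v P t₀) (w.φ t₀) β (P.dmax * g)))
    (hz : C.kBar * |z t₀| < 1) {ς : ℝ} (hς : ς = 1 ∨ ς = -1) (hςz : ς * z t₀ = |z t₀|)
    (h : 0 < ς * Real.sin (θ t₀ - w.φ t₀) ∨ (Real.sin (θ t₀ - w.φ t₀) = 0 ∧
      Real.cos (θ t₀ - w.φ t₀) = -(g * ς) ∧ w.φ t₀ = -(g * P.phiBar))) :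
    ∃ t₁, t₀ < t₁ ∧ t₁ ≤ b ∧ ∀ t ∈ Ioo t₀ t₁, 0 ≤ ς * Real.sin (θ t - w.φ t) := by
  have hφt : Tendsto w.φ (𝓝[Icc t₀ b] t₀) (𝓝 (w.φ t₀)) :=
    tendsto_within_of_continuousOn hw.φ_cont ht₀.1
  have hθt : Tendsto θ (𝓝[Icc t₀ b] t₀) (𝓝 (θ t₀)) :=
    ((continuous_snd.comp continuous_snd).tendsto _).comp (m.tendsto_within ht₀)
  rcases h with h | ⟨hsin, hcos, hφ⟩
  · have h1 : ∀ᶠ t in 𝓝[Icc t₀ b] t₀, 0 < ς * Real.sin (θ t - w.φ t) :=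
      (((Real.continuous_sin.tendsto _).comp (hθt.sub hφt)).const_mul ς).eventually
        (lt_mem_nhds h)
    obtain ⟨t₁, h2, h3, h4⟩ := exists_Icc_of_eventually ht₀.2 h1
    exact ⟨t₁, h2, h3, fun t ht => (h4 t ⟨ht.1.le, ht.2.le⟩).le⟩
  have hgg := sq_eq_one_of_sign hg
  have hςς := sq_eq_one_of_sign hς
  have hv₀ := hw.v_pos ht₀.1
  set ε := P.kV - Real.tan P.phiBar / P.L - C.kBar with hε
  have hε0 : 0 < ε := by linarith
  have htan : 0 ≤ Real.tan P.phiBar / P.L := div_nonneg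
    (Real.tan_nonneg_of_nonneg_of_le_pi_div_two P.phiBar_nonneg P.phiBar_lt.le) P.L_pos.le
  -- the rate of rotation of the vehicle dominates
  have hturn : w.v P t₀ * (C.kBar + ε) ≤
      g * turnRate P (w.v P t₀) (w.φ t₀) β (P.dmax * g) := by
    have e1 : g * turnRate P (w.v P t₀) (w.φ t₀) β (P.dmax * g) =
        w.v P t₀ * ((Real.tan (P.dmax + g * β) - Real.tan (g * w.φ t₀)) / P.L) := by
      rw [← tan_sub_sign hg, turnRate]; ring
    rw [e1]
    refine mul_le_mul_of_nonneg_left ?_ hv₀.le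
    have h1 := kV_le_tan (abs_mul_sign hg hβ)
    rw [hφ, show g * -(g * P.phiBar) = -P.phiBar by linear_combination (-P.phiBar) * hgg,
      Real.tan_neg, sub_neg_eq_add, add_div]
    linarith
  set Φ : ℝ × ℝ × ℝ → ℝ → ℝ := fun q k => g * (k * (Real.cos (q.2.1 - q.2.2) / (1 - k * q.1)))
    with hΦ
  have hbase : ∀ k ∈ Icc (-C.kBar) C.kBar, Φ (z t₀, θ t₀, w.φ t₀) k ≤ C.kBar := by
    intro k hk
    have := neg_div_one_sub_le (a := ς * k) (abs_mul_sign hς (abs_le.2 ⟨hk.1, hk.2⟩))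
      (abs_nonneg (z t₀)) hz
    refine le_trans (le_of_eq ?_) this
    simp only [hΦ, hcos]
    rw [← hςz, show ς * k * (ς * z t₀) = k * z t₀ by linear_combination (k * z t₀) * hςς]
    linear_combination (-(k * ς / (1 - k * z t₀))) * hgg
  have htube := eventually_forall_abs_sub_lt (F := Φ) (x₀ := (z t₀, θ t₀, w.φ t₀))
    (K := Icc (-C.kBar) C.kBar) isCompact_Icc (fun k hk => by
      have : 1 - k * z t₀ ≠ 0 := (one_sub_mul_pos (abs_le.2 ⟨hk.1, hk.2⟩) hz).ne'
      simp only [hΦ]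
      fun_prop (disch := exact this)) (show 0 < ε / 3 by linarith)
  have hv1 : ∀ᶠ q in near t₀ (s t₀, z t₀, θ t₀),
      w.v P q.1 * (C.kBar + ε / 3) < w.v P t₀ * (C.kBar + 2 * ε / 3) := by
    refine ((tendsto_near_of_continuousOn hw.v_cont ht₀.1 _).mul_const _).eventually
      (gt_mem_nhds ?_)
    exact mul_lt_mul_of_pos_left (by linarith) hv₀
  have hΦ1 : ∀ᶠ q : ℝ × State in near t₀ (s t₀, z t₀, θ t₀), ∀ k ∈ Icc (-C.kBar) C.kBar,
      |Φ (q.2.2.1, q.2.2.2, w.φ q.1) k - Φ (z t₀, θ t₀, w.φ t₀) k| < ε / 3 := by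
    have hx := tendsto_near_snd t₀ (s t₀, z t₀, θ t₀)
    exact (Tendsto.prodMk_nhds (((continuous_fst.comp continuous_snd).tendsto _).comp hx)
      (Tendsto.prodMk_nhds (((continuous_snd.comp continuous_snd).tendsto _).comp hx)
        (tendsto_near_of_continuousOn hw.φ_cont ht₀.1 _))).eventually htube
  have hT1 := (turnLim_iff.1 hlim).const_mul g |>.eventually (lt_mem_nhds
    (show w.v P t₀ * (C.kBar + 2 * ε / 3) < g * turnRate P (w.v P t₀) (w.φ t₀) β (P.dmax * g) from
      lt_of_lt_of_le (mul_lt_mul_of_pos_left (by linarith) hv₀) hturn))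
  have hκ1 := eventually_near_of_snd (t := t₀) (C.eventually_regular (x := (s t₀, z t₀, θ t₀))
    (m.mem t₀ ⟨ht₀.1, ht₀.2.le⟩))
  have hτ0 : ∀ᶠ q in near t₀ (s t₀, z t₀, θ t₀), 0 ≤ q.1 :=
    tendsto_fst.eventually eventually_mem_nhdsWithin
  have hfield : ∀ᶠ q in near t₀ (s t₀, z t₀, θ t₀), g * (field P C w u q.1 q.2).2.2 ≤ 0 := by
    filter_upwards [hv1, hΦ1, hT1, hκ1, hτ0] with q hv hΦq hT hκ hτ
    have hk : C.κ q.2.1 ∈ Icc (-C.kBar) C.kBar := abs_le.1 (C.abs_κ_le hκ)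
    have h1 := (abs_lt.1 (hΦq _ hk)).2
    have h2 := hbase _ hk
    have h3 : w.v P q.1 * Φ (q.2.2.1, q.2.2.2, w.φ q.1) (C.κ q.2.1) ≤
        w.v P q.1 * (C.kBar + ε / 3) :=
      mul_le_mul_of_nonneg_left (by linarith) (hw.v_pos hτ).le
    have h4 : g * (field P C w u q.1 q.2).2.2 =
        w.v P q.1 * Φ (q.2.2.1, q.2.2.2, w.φ q.1) (C.κ q.2.1) -
        g * turnRate P (w.v P q.1) (w.φ q.1) (w.β q.1) (u q.1 q.2) := by
      simp only [field, thetaDot, sDot, hΦ, Slip.v]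
      ring
    rw [h4]; linarith
  have hev := (m.tendsto_near ht₀).eventually (eventually_eventually_near hfield)
  have hsmall : ∀ᶠ t in 𝓝[Icc t₀ b] t₀,
      |g * (θ t - θ t₀) - g * (w.φ t - w.φ t₀)| < Real.pi := by
    have h1 := (((hθt.sub_const (θ t₀)).const_mul g).sub
      ((hφt.sub_const (w.φ t₀)).const_mul g)).abs
    simp only [sub_self, mul_zero, abs_zero] at h1
    exact h1.eventually (gt_mem_nhds Real.pi_pos)
  obtain ⟨t₁, ht₁, ht₁b, hall⟩ := exists_Icc_of_eventually ht₀.2 (hev.and hsmall)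
  refine ⟨t₁, ht₁, ht₁b, fun t ht => ?_⟩
  have hac : AbsolutelyContinuousOnInterval (fun t => g * θ t) t₀ t :=
    (ac_mono m.θ_ac ht₀.1 ht.1.le (ht.2.le.trans ht₁b)).const_mul g
  have hmono := ac_sub_le (m := 0) ht.1.le hac (by
    filter_upwards [m.incl] with τ hτ hτ'
    have hτ1 : τ < t₁ := hτ'.2.trans ht.2
    obtain ⟨y, hy, -, -, hyθ⟩ := hτ ⟨ht₀.1.trans_lt hτ'.1, hτ1.trans_le ht₁b⟩
    refine ⟨_, hyθ.const_mul g, ?_⟩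
    have := filippov_le_of_eventually hy 0 0 g 0 fun ε hε => by
      filter_upwards [(hall τ ⟨hτ'.1.le, hτ1.le⟩).1] with x' hx'
      linarith
    linarith)
  rw [zero_mul] at hmono
  have hs := (hall t ⟨ht.1.le, ht.2.le⟩).2
  have hφb := hw.φ_le t (ht₀.1.trans ht.1.le)
  have hgφ := (abs_le.1 (abs_mul_sign hg hφb)).1
  have harg : g * (θ t - θ t₀) - g * (w.φ t - w.φ t₀) ≤ 0 := by
    have : g * w.φ t₀ = -P.phiBar := by rw [hφ]; linear_combination (-P.phiBar) * hgg
    linarith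
  have hfin := Real.sin_nonpos_of_nonpos_of_neg_pi_le harg (abs_lt.1 hs).1.le
  have e1 : Real.sin (θ t - w.φ t) =
      Real.cos (θ t₀ - w.φ t₀) * Real.sin ((θ t - θ t₀) - (w.φ t - w.φ t₀)) := by
    rw [show θ t - w.φ t = (θ t₀ - w.φ t₀) + ((θ t - θ t₀) - (w.φ t - w.φ t₀)) by ring,
      Real.sin_add, hsin]
    ring
  have e2 : Real.sin (g * (θ t - θ t₀) - g * (w.φ t - w.φ t₀)) =
      g * Real.sin ((θ t - θ t₀) - (w.φ t - w.φ t₀)) := by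
    rw [← mul_sub]
    rcases hg with rfl | rfl
    · simp
    · rw [neg_one_mul, Real.sin_neg, neg_one_mul]
  rw [e1, hcos]
  rw [e2] at hfin
  have : ς * (-(g * ς) * Real.sin ((θ t - θ t₀) - (w.φ t - w.φ t₀))) =
      -(g * Real.sin ((θ t - θ t₀) - (w.φ t - w.φ t₀))) := by
    linear_combination (-(g * Real.sin ((θ t - θ t₀) - (w.φ t - w.φ t₀)))) * hςς
  linarith

/-- Far from the sliding surface, the law acts as the maximal actuation law does, up to an
admissible bias of the steering angle. -/
def OuterLaw (P : Params) (C : RefPath) (χ : ℝ → ℝ) (w : Slip) (e : Estimates)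
    (u : ℝ → State → ℝ) (σ : ℝ) : Prop :=
  ∀ g : ℝ, (g = 1 ∨ g = -1) → ∃ β : ℝ → ℝ, ContinuousOn β (Ici 0) ∧
    (∀ t, 0 ≤ t → |β t| ≤ P.betaBar) ∧
    ∀ t, 0 ≤ t → ∀ x : State, x.1 ∈ interior C.dom → C.kBar * |x.2.1| ≤ P.lam →
      σ < g * slidingVar χ e t x →
      TurnLim P w u t x (turnRate P (w.v P t) (w.φ t) (β t) (P.dmax * g))

variable {χ : ℝ → ℝ} {e : Estimates} {σ : ℝ}

/-- Up to each `t₀`, the motion is a plane motion under `±δ_max` with the admissible slip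
`w.withBias β`, so `touching` applies whenever the boundary is met. -/
theorem Motion.good_of_outer (m : Motion P C w u b s z θ) (hC : C.ClosestWellDefined P.lam)
    (hw : w.Admissible P) (hK : C.kBar < P.kV - Real.tan P.phiBar / P.L)
    (hout : OuterLaw P C χ w e u σ) {g : ℝ} (hg : g = 1 ∨ g = -1) (hb : b ≤ 2 * P.T)
    (hdisc : Metric.closedBall (circleCenter P g (C.tang (s 0) - θ 0) (C.point (s 0) (z 0)))
      (sweptRadius P g (C.tang (s 0) - θ 0) (C.point (s 0) (z 0))) ⊆ C.domain P.lam)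
    (h0 : Good P C (s 0) (z 0))
    (hS : ∀ t ∈ Ico 0 b, σ < g * slidingVar χ e t (s t, z t, θ t)) :
    ∀ t ∈ Icc 0 b, Good P C (s t) (z t) := by
  obtain ⟨β, hβ, hβb, hlim⟩ := hout g hg
  refine forall_Icc_of_step h0 m.isClosed_good fun t₀ ht₀ hgood => ?_
  have hm := m.restrict ht₀.1 ht₀.2.le
  have hgt := hgood t₀ ⟨ht₀.1, le_rfl⟩
  have hlim₀ : ∀ t ∈ Icc 0 t₀, TurnLim P w u t (s t, z t, θ t)
      (turnRate P (w.v P t) (w.φ t) (β t) (P.dmax * g)) := fun t ht =>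
    hlim t ht.1 _ (m.mem t ⟨ht.1, ht.2.trans ht₀.2.le⟩) (hgood t ht).2
      (hS t ⟨ht.1, ht.2.trans_lt ht₀.2⟩)
  obtain ⟨hhead, hpos⟩ := hm.heading_position hw hβ hβb (abs_dmax_mul hg)
    (fun t ht => (hgood t ht).lt_one) (fun t ht => hlim₀ t ⟨ht.1.le, ht.2.le⟩) t₀ ⟨ht₀.1, le_rfl⟩
  obtain ⟨t₁, h1, h2, h3⟩ := m.exists_good_of_inward hC ht₀ hgt (fun hz ς hς hςz => by
    have htouch := touching hC hK (hw.withBias hβ hβb) hg hdisc ht₀.1 (ht₀.2.trans_le hb)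
      hgt.1 hz hς hςz hpos
    rw [hhead, sub_sub_cancel] at htouch
    exact m.inward_of_touching hw hK hg (hβb t₀ ht₀.1) ht₀ (hlim₀ t₀ ⟨ht₀.1, le_rfl⟩)
      hgt.lt_one hς hςz htouch) hw
  exact ⟨t₁, h1, fun τ hτ _ => h3 τ hτ⟩

end

/-! ### Derivatives of the design function -/

namespace IsDesignFunction

variable {P : Params} {C : RefPath} {χ : ℝ → ℝ}

/-- Being `C²` up to the end of the piece, `χ` has a Lipschitz derivative there. The linear error
term is what makes the exact rate in `exists_rate` possible. -/
theorem right_piece (h : IsDesignFunction P C χ) (z₀ : ℝ) :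
    HasDerivWithinAt χ (rightDeriv χ z₀) (Ioi z₀) z₀ ∧ ∃ b, z₀ < b ∧ ∃ K, 0 ≤ K ∧
      ∀ z ∈ Ioo z₀ b, DifferentiableAt ℝ χ z ∧
        |deriv χ z - rightDeriv χ z₀| ≤ K * (z - z₀) := by
  obtain ⟨B, hB, hsm⟩ := h.pieces
  obtain ⟨b, hb, hempty⟩ : ∃ b, z₀ < b ∧ Ioo z₀ b ∩ B = ∅ := by
    have hF : ((B ∩ Icc z₀ (z₀ + 1)) \ {z₀}).Finite := (hB z₀ (z₀ + 1)).subset fun x hx => hx.1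
    have h1 : ((B ∩ Icc z₀ (z₀ + 1)) \ {z₀})ᶜ ∈ 𝓝[>] z₀ :=
      mem_nhdsWithin_of_mem_nhds (hF.isClosed.isOpen_compl.mem_nhds fun hx => hx.2 rfl)
    obtain ⟨u, hu, hsub⟩ := mem_nhdsGT_iff_exists_Ioo_subset.1 h1
    refine ⟨min u (z₀ + 1), lt_min hu (by linarith), ?_⟩
    ext x
    simp only [mem_inter_iff, mem_empty_iff_false, iff_false, not_and]
    intro hx hxB
    exact hsub ⟨hx.1, hx.2.trans_le (min_le_left _ _)⟩
      ⟨⟨hxB, hx.1.le, hx.2.le.trans (min_le_right _ _)⟩, hx.1.ne'⟩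
  have hcd := hsm z₀ b hb hempty
  have hu : UniqueDiffOn ℝ (Icc z₀ b) := uniqueDiffOn_Icc hb
  have h1 : ContDiffOn ℝ 1 (derivWithin χ (Icc z₀ b)) (Icc z₀ b) :=
    hcd.derivWithin hu (by norm_num)
  obtain ⟨K, hK⟩ := h1.exists_lipschitzOnWith one_ne_zero (convex_Icc z₀ b) isCompact_Icc
  have hz₀ : z₀ ∈ Icc z₀ b := ⟨le_rfl, hb.le⟩
  have hd : HasDerivWithinAt χ (derivWithin χ (Icc z₀ b) z₀) (Ioi z₀) z₀ :=
    ((hcd.differentiableOn (by norm_num)) z₀ hz₀).hasDerivWithinAt.mono_of_mem_nhdsWithin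
      (Icc_mem_nhdsGT_of_mem ⟨le_rfl, hb⟩)
  have heq : rightDeriv χ z₀ = derivWithin χ (Icc z₀ b) z₀ :=
    hd.derivWithin (uniqueDiffWithinAt_Ioi z₀)
  rw [heq]
  refine ⟨hd, b, hb, K, K.2, fun z hz => ?_⟩
  have hnh : Icc z₀ b ∈ 𝓝 z := Icc_mem_nhds hz.1 hz.2
  refine ⟨((hcd.differentiableOn (by norm_num)) z ⟨hz.1.le, hz.2.le⟩).differentiableAt hnh, ?_⟩
  rw [← derivWithin_of_mem_nhds hnh]
  have := hK.dist_le_mul z ⟨hz.1.le, hz.2.le⟩ z₀ hz₀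
  rwa [Real.dist_eq, Real.dist_eq, abs_of_pos (sub_pos.2 hz.1)] at this

theorem hasDerivWithinAt_Iio (h : IsDesignFunction P C χ) (z₀ : ℝ) :
    HasDerivWithinAt χ (rightDeriv χ (-z₀)) (Iio z₀) z₀ := by
  have h1 := (h.right_piece (-z₀)).1
  have h2 : HasDerivWithinAt (fun z : ℝ => -z) (-1) (Iio z₀) z₀ := (hasDerivAt_neg z₀).hasDerivWithinAt
  have h3 := (HasDerivWithinAt.comp z₀ h1 h2 (fun z hz => neg_lt_neg (mem_Iio.1 hz))).neg
  refine (h3.congr_deriv (by ring)).congr (fun z _ => ?_) ?_ <;> simp [h.odd]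

theorem leftDeriv_eq (h : IsDesignFunction P C χ) (z₀ : ℝ) :
    leftDeriv χ z₀ = rightDeriv χ (-z₀) :=
  (h.hasDerivWithinAt_Iio z₀).derivWithin (uniqueDiffWithinAt_Iio z₀)

theorem hasDerivAt_neg (h : IsDesignFunction P C χ) {z d : ℝ} (hd : HasDerivAt χ d (-z)) :
    HasDerivAt χ d z := by
  have h3 := (HasDerivAt.comp z hd (_root_.hasDerivAt_neg z)).neg
  refine (h3.congr_deriv (by ring)).congr_of_eventuallyEq (Eventually.of_forall fun z => ?_)
  simp [h.odd]

theorem rightDeriv_nonneg (h : IsDesignFunction P C χ) (z : ℝ) : 0 ≤ rightDeriv χ z :=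
  (h.mono.monotoneOn _).derivWithin_nonneg

theorem leftDeriv_nonneg (h : IsDesignFunction P C χ) (z : ℝ) : 0 ≤ leftDeriv χ z :=
  (h.mono.monotoneOn _).derivWithin_nonneg

/-- By oddness, the left side at `z₀` is the right side at `-z₀`. -/
theorem eventually_deriv (h : IsDesignFunction P C χ) (z₀ : ℝ) {η : ℝ} (hη : 0 < η) :
    ∀ᶠ z in 𝓝[≠] z₀, DifferentiableAt ℝ χ z ∧
      ∃ d, (d = rightDeriv χ z₀ ∨ d = leftDeriv χ z₀) ∧ |deriv χ z - d| < η := by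
  have key : ∀ z₀, ∃ b > 0, ∀ z, z₀ < z → z < z₀ + b →
      DifferentiableAt ℝ χ z ∧ |deriv χ z - rightDeriv χ z₀| < η := by
    intro z₀
    obtain ⟨-, b, hb, K, hK, hz⟩ := h.right_piece z₀
    refine ⟨min (b - z₀) (η / (K + 1)), lt_min (by linarith) (by positivity), fun z h1 h2 => ?_⟩
    have h3 : z < b := by linarith [min_le_left (b - z₀) (η / (K + 1))]
    have h4 : z - z₀ < η / (K + 1) := by linarith [min_le_right (b - z₀) (η / (K + 1))]
    rw [lt_div_iff₀ (by positivity)] at h4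
    refine ⟨(hz z ⟨h1, h3⟩).1, (hz z ⟨h1, h3⟩).2.trans_lt ?_⟩
    nlinarith
  obtain ⟨b₁, hb₁, h₁⟩ := key z₀
  obtain ⟨b₂, hb₂, h₂⟩ := key (-z₀)
  rw [eventually_nhdsWithin_iff]
  filter_upwards [Metric.ball_mem_nhds z₀ (lt_min hb₁ hb₂)] with z hz hne
  rw [Metric.mem_ball, Real.dist_eq] at hz
  have hz1 := abs_lt.1 (hz.trans_le (min_le_left _ _))
  have hz2 := abs_lt.1 (hz.trans_le (min_le_right _ _))
  rcases lt_or_gt_of_ne (show z ≠ z₀ from hne) with hlt | hgt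
  · obtain ⟨h3, h4⟩ := h₂ (-z) (by linarith) (by linarith)
    have h5 := h.hasDerivAt_neg h3.hasDerivAt
    refine ⟨h5.differentiableAt, _, Or.inr rfl, ?_⟩
    rw [h5.deriv, h.leftDeriv_eq]
    exact h4
  · obtain ⟨h3, h4⟩ := h₁ z hgt (by linarith)
    exact ⟨h3, _, Or.inl rfl, h4⟩

theorem rightDeriv_eq_deriv {z : ℝ} (hd : DifferentiableAt ℝ χ z) : rightDeriv χ z = deriv χ z :=
  hd.hasDerivAt.hasDerivWithinAt.derivWithin (uniqueDiffWithinAt_Ioi z)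

theorem leftDeriv_eq_deriv {z : ℝ} (hd : DifferentiableAt ℝ χ z) : leftDeriv χ z = deriv χ z :=
  hd.hasDerivAt.hasDerivWithinAt.derivWithin (uniqueDiffWithinAt_Iio z)

/-- By `eventually_deriv`, every point has a neighborhood free of kinks apart from the point itself;
compactness does the rest. -/
theorem finite_kinks (h : IsDesignFunction P C χ) (a b : ℝ) :
    ({z | ¬ DifferentiableAt ℝ χ z} ∩ Icc a b).Finite := by
  rw [inter_comm]
  refine isCompact_Icc.induction_on (p := fun s => (s ∩ {z | ¬ DifferentiableAt ℝ χ z}).Finite)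
    (by simp) (fun s t hst ht => ht.subset (inter_subset_inter_left _ hst))
    (fun s t hs ht => by rw [union_inter_distrib_right]; exact hs.union ht) fun x _ => ?_
  have h1 := h.eventually_deriv x one_pos
  rw [eventually_nhdsWithin_iff] at h1
  refine ⟨_, mem_nhdsWithin_of_mem_nhds h1, (finite_singleton x).subset fun z hz => ?_⟩
  by_contra hne
  exact hz.2 (hz.1 hne).1

theorem eventually_abs_deriv_le (h : IsDesignFunction P C χ) (z₀ : ℝ) :
    ∃ K, ∀ᶠ z in 𝓝 z₀, |deriv χ z| ≤ K := by
  have h1 := h.eventually_deriv z₀ one_pos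
  rw [eventually_nhdsWithin_iff] at h1
  refine ⟨max |deriv χ z₀| (max |rightDeriv χ z₀| |leftDeriv χ z₀| + 1), ?_⟩
  filter_upwards [h1] with z hz
  by_cases hne : z = z₀
  · rw [hne]; exact le_max_left _ _
  obtain ⟨-, d, hd, hlt⟩ := hz hne
  refine le_max_of_le_right ?_
  have h2 : |deriv χ z| ≤ |deriv χ z - d| + |d| := by
    simpa using abs_add_le (deriv χ z - d) d
  have h3 : |d| ≤ max |rightDeriv χ z₀| |leftDeriv χ z₀| := by
    rcases hd with rfl | rfl
    · exact le_max_left _ _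
    · exact le_max_right _ _
  linarith

theorem exists_lipschitz (h : IsDesignFunction P C χ) (a b : ℝ) :
    ∃ K, 0 ≤ K ∧ ∀ x ∈ Icc a b, ∀ y ∈ Icc a b, dist (χ x) (χ y) ≤ K * dist x y := by
  obtain ⟨K, hK⟩ : ∃ K, ∀ z ∈ Icc a b, |deriv χ z| ≤ K := by
    refine isCompact_Icc.induction_on (p := fun s => ∃ K, ∀ z ∈ s, |deriv χ z| ≤ K)
      ⟨0, by simp⟩ (fun s t hst ⟨K, hK⟩ => ⟨K, fun z hz => hK z (hst hz)⟩) ?_ ?_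
    · rintro s t ⟨K, hK⟩ ⟨K', hK'⟩
      exact ⟨max K K', fun z hz => hz.elim (fun h => (hK z h).trans (le_max_left _ _))
        fun h => (hK' z h).trans (le_max_right _ _)⟩
    · intro x _
      obtain ⟨K, hK⟩ := h.eventually_abs_deriv_le x
      exact ⟨_, mem_nhdsWithin_of_mem_nhds hK, K, fun z hz => hz⟩
  refine ⟨max K 0, le_max_right _ _, ?_⟩
  have key : ∀ x ∈ Icc a b, ∀ y ∈ Icc a b, x ≤ y → χ y - χ x ≤ max K 0 * (y - x) := by
    intro x hx y hy hxy
    have := le_of_hasDerivAt_off_finite (f := fun z => max K 0 * z - χ z) (h.finite_kinks a b) hxy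
      ((continuous_const.mul continuous_id).sub h.cont).continuousOn (fun u hu => by
        have hd : DifferentiableAt ℝ χ u := by
          by_contra hcon
          exact hu.2 ⟨hcon, hx.1.trans hu.1.1.le, hu.1.2.le.trans hy.2⟩
        refine ⟨max K 0 - deriv χ u, ?_, ?_⟩
        · exact (((hasDerivAt_id u).const_mul (max K 0)).congr_deriv (mul_one _)).sub hd.hasDerivAt
        · have := hK u ⟨hx.1.trans hu.1.1.le, hu.1.2.le.trans hy.2⟩
          linarith [le_abs_self (deriv χ u), le_max_left K 0])
    linarith
  intro x hx y hy
  rw [Real.dist_eq, Real.dist_eq]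
  rcases le_total x y with hxy | hxy
  · rw [abs_of_nonpos (by linarith [h.mono hxy]), abs_of_nonpos (by linarith)]
    linarith [key x hx y hy hxy]
  · rw [abs_of_nonneg (by linarith [h.mono hxy]), abs_of_nonneg (by linarith)]
    linarith [key y hy x hx hxy]

/-- The root of `χ z = ePhi`. -/
theorem exists_root (h : IsDesignFunction P C χ) :
    ∃ ez, 0 ≤ ez ∧ C.kBar * ez ≤ P.lam ∧ (∀ z, χ z = P.ePhi ↔ z = ez) ∧ 0 < rightDeriv χ ez := by
  have hne : (χ '' {z | C.kBar * |z| ≤ P.lam}).Nonempty := ⟨χ 0, 0, by simp [P.lam_pos.le], rfl⟩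
  obtain ⟨_, ⟨z, hz, rfl⟩, hlt⟩ := exists_lt_of_lt_csSup hne h.ePhi_lt
  have hlt' : P.ePhi < χ |z| := hlt.trans_le (h.mono (le_abs_self z))
  obtain ⟨ez, hez, hroot⟩ := intermediate_value_Icc (abs_nonneg z) h.cont.continuousOn
    (show P.ePhi ∈ Icc (χ 0) (χ |z|) from ⟨by rw [h.zero]; exact P.ePhi_nonneg, hlt'.le⟩)
  have hpos : ∀ y, χ y = P.ePhi → 0 < rightDeriv χ y := fun y hy =>
    (h.deriv_pos y (by rw [hy]; linarith [P.ePhi_nonneg, h.chiMax_pos]) (by rw [hy]; exact h.ePhi_lt)).1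
  -- Between two roots, the monotone `χ` would be constant, against the positive right derivative at
  -- the left one.
  have hinj : ∀ x y, χ x = P.ePhi → χ y = P.ePhi → x < y → False := by
    intro x y hx hy hxy
    have h1 := (h.right_piece x).1
    have h2 : HasDerivWithinAt χ 0 (Ioi x) x := by
      refine (hasDerivWithinAt_const x (Ioi x) P.ePhi).congr_of_eventuallyEq ?_ hx
      filter_upwards [Ioc_mem_nhdsGT hxy] with w hw
      exact le_antisymm (hy ▸ h.mono hw.2) (hx ▸ h.mono hw.1.le)
    have := (uniqueDiffWithinAt_Ioi x).eq_deriv _ h1 h2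
    linarith [hpos x hx]
  refine ⟨ez, hez.1, ?_, fun y => ⟨fun hy => ?_, fun hy => hy ▸ hroot⟩, hpos ez hroot⟩
  · exact (mul_le_mul_of_nonneg_left hez.2 C.kBar_nonneg).trans hz
  · rcases lt_trichotomy y ez with h1 | h1 | h1
    · exact (hinj y ez hy hroot h1).elim
    · exact h1
    · exact (hinj ez y hroot hy h1).elim

/-- The rate of approach outside of the final zone. -/
theorem exists_rate (h : IsDesignFunction P C χ) {ez : ℝ} (hez : 0 ≤ ez) (hroot : χ ez = P.ePhi)
    (hpos : 0 < rightDeriv χ ez) : ∃ m, 0 < m ∧ ∀ D, 0 ≤ D → C.kBar * (ez + D) ≤ P.lam →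
      rightDeriv χ ez * D ≤ Real.sin (χ (ez + D) - χ ez) * (1 + m * D) := by
  set γ := rightDeriv χ ez with hγ
  obtain ⟨-, b, hb, K, hK, hder⟩ := h.right_piece ez
  -- a quadratic lower bound
  have hquad : ∀ D, 0 ≤ D → ez + D ≤ b → γ * D - K * D ^ 2 ≤ χ (ez + D) - χ ez := by
    intro D hD hDb
    have := le_of_hasDerivAt_off_finite (f := fun z => χ z - γ * (z - ez) + K * (z - ez) ^ 2)
      (F := ∅) finite_empty (a := ez) (b := ez + D) (by linarith)
      ((h.cont.sub (by fun_prop)).add (by fun_prop)).continuousOn (fun u hu => by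
        have hu1 : u ∈ Ioo ez b := ⟨hu.1.1, hu.1.2.trans_le hDb⟩
        obtain ⟨hd, hb⟩ := hder u hu1
        have e1 : HasDerivAt (fun z : ℝ => z - ez) 1 u := (hasDerivAt_id u).sub_const ez
        refine ⟨_, (hd.hasDerivAt.sub (e1.const_mul γ)).add ((e1.pow 2).const_mul K), ?_⟩
        have h1 := (abs_le.1 hb).1
        have h2 := mul_nonneg hK (sub_pos.2 hu1.1).le
        simp only [Nat.cast_ofNat, Nat.add_one_sub_one, pow_one, mul_one]
        linarith)
    simp only [sub_self, mul_zero, sub_zero, add_sub_cancel_left] at this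
    nlinarith
  have hsinle : ∀ D, 0 ≤ D → C.kBar * (ez + D) ≤ P.lam → 0 ≤ χ (ez + D) - χ ez ∧
      χ (ez + D) - χ ez < Real.pi / 2 := by
    intro D hD hDz
    refine ⟨by linarith [h.mono (show ez ≤ ez + D by linarith)], ?_⟩
    have := h.le_chiMax (z := ez + D) (by rw [abs_of_nonneg (by linarith)]; exact hDz)
    linarith [h.chiMax_lt, P.ePhi_nonneg]
  -- the constants
  set M := K + γ ^ 3 + 1 with hM
  have hM0 : 0 < M := by positivity
  set h₀ := min (b - ez) (min (1 / (γ + 1)) (γ / (2 * M))) with hh₀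
  have hh₀pos : 0 < h₀ := lt_min (by linarith) (lt_min (by positivity) (by positivity))
  have hsmall : ∀ D, 0 ≤ D → D ≤ h₀ → C.kBar * (ez + D) ≤ P.lam →
      M * D ≤ γ / 2 ∧ γ * D - M * D ^ 2 ≤ Real.sin (χ (ez + D) - χ ez) := by
    intro D hD hDh hDz
    have h1 : D ≤ b - ez := hDh.trans (min_le_left _ _)
    have h2 : D ≤ 1 / (γ + 1) := hDh.trans ((min_le_right _ _).trans (min_le_left _ _))
    have h3 : D ≤ γ / (2 * M) := hDh.trans ((min_le_right _ _).trans (min_le_right _ _))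
    rw [le_div_iff₀ (by positivity)] at h2 h3
    have hMD : M * D ≤ γ / 2 := by linarith
    refine ⟨hMD, ?_⟩
    rcases hD.eq_or_lt with h0 | h0
    · simp [← h0]
    have hD1 : D ≤ 1 := by nlinarith
    have hγD : γ * D ≤ 1 := by linarith
    have hKD : K * D ≤ M * D := by gcongr; rw [hM]; nlinarith [pow_pos hpos 3]
    set y := γ * D - K * D ^ 2 with hy
    have hy0 : 0 < y := by
      have : y = D * (γ - K * D) := by rw [hy]; ring
      rw [this]
      exact mul_pos h0 (by linarith)
    have hyγ : y ≤ γ * D := by rw [hy]; nlinarith [mul_nonneg hK (sq_nonneg D)]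
    have hyx := hquad D hD (by linarith)
    have hx := hsinle D hD hDz
    have hs1 : Real.sin y ≤ Real.sin (χ (ez + D) - χ ez) :=
      Real.sin_le_sin_of_le_of_le_pi_div_two (by linarith [Real.pi_pos]) hx.2.le hyx
    have hs2 := Real.sin_gt_sub_cube hy0
    have hy3 : y ^ 3 ≤ γ ^ 3 * D ^ 2 := by
      calc y ^ 3 ≤ (γ * D) ^ 3 := by gcongr
        _ = γ ^ 3 * D ^ 2 * D := by ring
        _ ≤ γ ^ 3 * D ^ 2 * 1 := by gcongr
        _ = γ ^ 3 * D ^ 2 := mul_one _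
    have : γ * D - M * D ^ 2 = y - γ ^ 3 * D ^ 2 - D ^ 2 := by rw [hy, hM]; ring
    have hy30 := pow_pos hy0 3
    nlinarith [sq_nonneg D]
  -- For `D ≤ h₀`, `(γ * D - M * D ^ 2) * (1 + m * D) ≥ γ * D` because `M * D ≤ γ / 2` and `γ * m ≥
  -- 2 * M`. For `D ≥ h₀`, the sine is at least `γ * h₀ / 2`, and `h₀ * m ≥ 2` suffices. The factor
  -- `1 + m * D` is the one produced by differentiating `D * exp (m * D)`.
  refine ⟨2 * M / γ + 2 / h₀, by positivity, fun D hD hDz => ?_⟩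
  set m := 2 * M / γ + 2 / h₀ with hm
  have hm1 : 2 * M ≤ γ * m := by
    rw [hm, mul_add γ, mul_div_cancel₀ _ hpos.ne']
    linarith [mul_pos hpos (div_pos two_pos hh₀pos)]
  have hm2 : 2 ≤ h₀ * m := by
    rw [hm, mul_add h₀, mul_div_cancel₀ _ hh₀pos.ne']
    linarith [mul_pos hh₀pos (div_pos (mul_pos two_pos hM0) hpos)]
  have hm0 : 0 < m := by rw [hm]; positivity
  rcases le_total D h₀ with hle | hge
  · obtain ⟨h1, h2⟩ := hsmall D hD hle hDz
    refine le_trans ?_ (mul_le_mul_of_nonneg_right h2 (by positivity))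
    have h3 : (γ * D - M * D ^ 2) * (1 + m * D) - γ * D = D ^ 2 * (γ * m - M - m * (M * D)) := by
      ring
    have h4 : 0 ≤ γ * m - M - m * (M * D) := by nlinarith
    nlinarith [mul_nonneg (sq_nonneg D) h4]
  · have hz₀ : C.kBar * (ez + h₀) ≤ P.lam :=
      (mul_le_mul_of_nonneg_left (by linarith) C.kBar_nonneg).trans hDz
    obtain ⟨h1, h2⟩ := hsmall h₀ hh₀pos.le le_rfl hz₀
    have h3 : Real.sin (χ (ez + h₀) - χ ez) ≤ Real.sin (χ (ez + D) - χ ez) :=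
      Real.sin_le_sin_of_le_of_le_pi_div_two
        (by linarith [(hsinle h₀ hh₀pos.le hz₀).1, Real.pi_pos]) (hsinle D hD hDz).2.le
        (by linarith [h.mono (show ez + h₀ ≤ ez + D by linarith)])
    have h4 : γ * h₀ / 2 ≤ Real.sin (χ (ez + D) - χ ez) := by
      have : M * h₀ ^ 2 = h₀ * (M * h₀) := by ring
      nlinarith
    calc γ * D ≤ γ * h₀ / 2 * (m * D) := by
          have := mul_le_mul_of_nonneg_left hm2 (mul_nonneg hpos.le hD)
          linarith
      _ ≤ γ * h₀ / 2 * (1 + m * D) := by gcongr; linarith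
      _ ≤ _ := mul_le_mul_of_nonneg_right h4 (by positivity)

end IsDesignFunction

/-! ### Motion near the sliding surface -/

section
variable {P : Params} {C : RefPath} {w : Slip} {u : ℝ → State → ℝ} {b : ℝ} {s z θ : ℝ → ℝ}
  {χ : ℝ → ℝ} {e : Estimates} {σ : ℝ}

/-- The time derivative of the sliding variable at a regular state. -/
def slidingDot (P : Params) (C : RefPath) (χ : ℝ → ℝ) (w : Slip) (e : Estimates)
    (u : ℝ → State → ℝ) (t : ℝ) (x : State) : ℝ :=
  (field P C w u t x).2.2 - deriv χ x.2.1 * zDot x.2.2 (w.φ t) (w.v P t) - e.dφh t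

theorem Estimates.Admissible.φh_cont (he : e.Admissible P w) : ContinuousOn e.φh (Ici 0) :=
  fun t ht => (he.φh_deriv t ht).continuousWithinAt

theorem tendsto_slidingVar (hχ : IsDesignFunction P C χ) (he : e.Admissible P w) {t : ℝ}
    (ht : 0 ≤ t) (x : State) : Tendsto (fun q : ℝ × State => slidingVar χ e q.1 q.2)
      (𝓝[Ici 0] t ×ˢ 𝓝 x) (𝓝 (slidingVar χ e t x)) := by
  have h1 : Tendsto (fun q : ℝ × State => e.φh q.1) (𝓝[Ici 0] t ×ˢ 𝓝 x) (𝓝 (e.φh t)) :=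
    Tendsto.comp (he.φh_cont t ht) tendsto_fst
  have h2 : Continuous fun x : State => x.2.2 - χ x.2.1 := by
    have := hχ.cont
    fun_prop
  exact ((h2.tendsto x).comp tendsto_snd).sub h1

theorem continuous_slidingVar (hχ : IsDesignFunction P C χ) (t : ℝ) :
    Continuous (slidingVar χ e t) := by
  have := hχ.cont
  unfold slidingVar
  fun_prop

theorem Motion.sliding_ac (m : Motion P C w u b s z θ) (hχ : IsDesignFunction P C χ)
    (he : e.Admissible P w) :
    AbsolutelyContinuousOnInterval (fun t => slidingVar χ e t (s t, z t, θ t)) 0 b := by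
  have h1 : AbsolutelyContinuousOnInterval (fun t => χ (z t)) 0 b := by
    obtain ⟨M, hM⟩ := isCompact_Icc.exists_bound_of_continuousOn m.z_cont
    obtain ⟨K, hK, hlip⟩ := hχ.exists_lipschitz (-M) M
    refine ac_comp_lipschitz hK m.z_ac (s := Icc (-M) M) (fun t ht => ?_) hlip
    rw [uIcc_of_le m.b_nonneg] at ht
    exact abs_le.1 (hM t ht)
  have h2 : AbsolutelyContinuousOnInterval e.φh 0 b := by
    have : LipschitzOnWith (Real.toNNReal P.dphiBar) e.φh (uIcc 0 b) := by
      rw [uIcc_of_le m.b_nonneg]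
      refine Convex.lipschitzOnWith_of_nnnorm_hasDerivWithin_le (convex_Icc 0 b)
        (f' := e.dφh) (fun t ht => (he.φh_deriv t ht.1).mono fun _ h => h.1) fun t ht => ?_
      rw [← NNReal.coe_le_coe, coe_nnnorm, Real.coe_toNNReal _ P.dphiBar_nonneg]
      exact he.dφh_le t ht.1
    exact this.absolutelyContinuousOnInterval
  exact (m.θ_ac.sub h1).sub h2

theorem Motion.sliding_cont (m : Motion P C w u b s z θ) (hχ : IsDesignFunction P C χ)
    (he : e.Admissible P w) :
    ContinuousOn (fun t => slidingVar χ e t (s t, z t, θ t)) (Icc 0 b) := by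
  have := (m.sliding_ac hχ he).continuousOn
  rwa [uIcc_of_le m.b_nonneg] at this

theorem tendsto_nearAE_normal (x : State) :
    Tendsto (fun x' : State => x'.2.1) (nearAE x) (𝓝[≠] x.2.1) := by
  refine tendsto_nhdsWithin_iff.2 ⟨?_, ?_⟩
  · exact ((continuous_fst.comp continuous_snd).tendsto x).mono_left (nearAE_le x)
  · have h : ∀ᵐ x' : State, x'.2.1 ∉ ({x.2.1} : Set ℝ) := by
      rw [ae_iff]
      simpa using volume_snd_mem (countable_singleton x.2.1)
    exact h.filter_mono inf_le_right

/-- At almost every time spent at a kink of `χ`, `dz/dt = 0`, so the chain rule holds with slope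
zero and the term of `slidingDot` with `deriv χ` tends to zero nearby. Thus a one-sided bound on
`slidingDot` at almost all nearby states passes to `dS/dt`. -/
theorem Motion.ae_sliding_deriv (m : Motion P C w u b s z θ) (hχ : IsDesignFunction P C χ)
    (he : e.Admissible P w) :
    ∀ᵐ t, t ∈ Ioo 0 b → C.kBar * |z t| < 1 →
      ∃ S', HasDerivAt (fun t => slidingVar χ e t (s t, z t, θ t)) S' t ∧
        ∀ g B, (∀ᶠ x' in nearAE (s t, z t, θ t), g * slidingDot P C χ w e u t x' ≤ B) →
          g * S' ≤ B := by
  have hcount : {y | ¬ DifferentiableAt ℝ χ y}.Countable :=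
    countable_of_finite_Icc hχ.finite_kinks
  filter_upwards [m.incl, ae_hasDerivAt_eq_zero z hcount] with t h1 h2 ht hzt
  obtain ⟨y, hy, -, hyz, hyθ⟩ := h1 ht
  have hy2 : y.2.1 = zDot (θ t) (w.φ t) (w.v P t) :=
    filippov_zDot (x := (s t, z t, θ t)) ht.1.le (m.mem t ⟨ht.1.le, ht.2.le⟩) hzt hy
  have hφ : HasDerivAt e.φh (e.dφh t) t := (he.φh_deriv t ht.1.le).hasDerivAt (Ici_mem_nhds ht.1)
  have hzc : Tendsto (fun x' : State => zDot x'.2.2 (w.φ t) (w.v P t)) (nearAE (s t, z t, θ t))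
      (𝓝 (zDot (θ t) (w.φ t) (w.v P t))) := by
    have : Continuous fun x' : State => zDot x'.2.2 (w.φ t) (w.v P t) := by
      unfold zDot; fun_prop
    have h := this.tendsto (s t, z t, θ t)
    exact h.mono_left (nearAE_le (s t, z t, θ t))
  obtain ⟨D, hD, hlim⟩ : ∃ D, HasDerivAt (fun τ => χ (z τ)) (D * y.2.1) t ∧
      Tendsto (fun x' : State => (deriv χ x'.2.1 - D) * zDot x'.2.2 (w.φ t) (w.v P t))
        (nearAE (s t, z t, θ t)) (𝓝 0) := by
    by_cases hd : DifferentiableAt ℝ χ (z t)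
    · refine ⟨deriv χ (z t), hd.hasDerivAt.comp t hyz, ?_⟩
      have h3 : Tendsto (deriv χ) (𝓝[≠] (z t)) (𝓝 (deriv χ (z t))) := by
        rw [Metric.tendsto_nhds]
        intro η hη
        filter_upwards [hχ.eventually_deriv (z t) hη] with y hy
        obtain ⟨-, d, hd', hlt⟩ := hy
        rw [IsDesignFunction.rightDeriv_eq_deriv hd,
          IsDesignFunction.leftDeriv_eq_deriv hd, or_self] at hd'
        rwa [Real.dist_eq, ← hd']
      have h4 := ((h3.comp (tendsto_nearAE_normal (s t, z t, θ t))).sub_const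
        (deriv χ (z t))).mul hzc
      simpa using h4
    · have hy0 : y.2.1 = 0 := h2 hd _ hyz
      refine ⟨0, ?_, ?_⟩
      · obtain ⟨K, hK, hlip⟩ := hχ.exists_lipschitz (z t - 1) (z t + 1)
        rw [zero_mul]
        rw [hy0] at hyz
        refine hasDerivAt_zero_of_lipschitz (K := K) hyz ?_
        filter_upwards [hyz.continuousAt (Icc_mem_nhds (sub_one_lt _) (lt_add_one _))] with τ hτ
        exact hlip _ hτ _ ⟨by linarith, by linarith⟩
      · obtain ⟨K, hK⟩ := hχ.eventually_abs_deriv_le (z t)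
        rw [← hy2, hy0] at hzc
        have h5 := hzc.norm.const_mul K
        rw [norm_zero, mul_zero] at h5
        refine squeeze_zero_norm' ?_ h5
        have h6 : Tendsto (fun x' : State => x'.2.1) (nearAE (s t, z t, θ t)) (𝓝 (z t)) :=
          (tendsto_nearAE_normal (s t, z t, θ t)).mono_right nhdsWithin_le_nhds
        filter_upwards [h6.eventually hK] with x' hx'
        rw [sub_zero, norm_mul]
        exact mul_le_mul_of_nonneg_right hx' (norm_nonneg _)
  refine ⟨y.2.2 - D * y.2.1 - e.dφh t, (hyθ.sub hD).sub hφ, fun g B hB => ?_⟩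
  have := filippov_le_of_eventually hy 0 (-(g * D)) g (B + g * e.dφh t) fun ε hε => by
    have hlim' := hlim.const_mul g
    rw [mul_zero] at hlim'
    filter_upwards [hB, hlim'.eventually (gt_mem_nhds hε)] with x' h3 h4
    have h5 : (field P C w u t x').2.1 = zDot x'.2.2 (w.φ t) (w.v P t) := rfl
    rw [slidingDot] at h3
    rw [h5]
    linarith
  linarith

/-- Requirements to the law near the sliding surface. -/
structure InnerLaw (P : Params) (C : RefPath) (χ : ℝ → ℝ) (w : Slip) (e : Estimates)
    (u : ℝ → State → ℝ) (σ ε : ℝ) : Prop where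
  σ_nonneg : 0 ≤ σ
  σ_lt : P.ePhi + σ < chiMax P C χ
  ε_pos : 0 < ε
  barrier : ∀ t, 0 ≤ t → ∀ x : State, x.1 ∈ interior C.dom → C.kBar * |x.2.1| ≤ P.lam →
    |slidingVar χ e t x| ≤ σ → ∀ g : ℝ, (g = 1 ∨ g = -1) →
    ∀ᶠ q in near t x, σ < g * slidingVar χ e q.1 q.2 → g * slidingDot P C χ w e u q.1 q.2 ≤ 0
  decay : ∀ t, 0 ≤ t → ∀ x : State, x.1 ∈ interior C.dom → C.kBar * |x.2.1| ≤ P.lam →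
    ∀ g : ℝ, (g = 1 ∨ g = -1) → 0 < g * slidingVar χ e t x → g * slidingVar χ e t x ≤ σ →
    ∀ᶠ x' in nearAE x, g * slidingDot P C χ w e u t x' ≤ -ε

/-- On the boundary of the domain `|χ| = chiMax`, which outweighs the estimation error and `σ`
together; the argument of the sine falls in `(0, π)`. -/
theorem sin_heading_pos (hχ : IsDesignFunction P C χ) (he : e.Admissible P w)
    (hσ : P.ePhi + σ < chiMax P C χ) {t : ℝ} (ht : 0 ≤ t) {x : State}
    (hz : C.kBar * |x.2.1| = P.lam) (hS : |slidingVar χ e t x| ≤ σ)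
    {ς : ℝ} (hς : ς = 1 ∨ ς = -1) (hςz : ς * x.2.1 = |x.2.1|) :
    0 < ς * Real.sin (x.2.2 - w.φ t) := by
  have hςς := sq_eq_one_of_sign hς
  have h1 : ς * χ x.2.1 = chiMax P C χ := by
    rw [← hχ.apply_eq_chiMax (abs_nonneg _) hz, ← hςz]
    rcases hς with rfl | rfl
    · simp
    · rw [neg_one_mul, neg_one_mul, hχ.odd]
  have h2 : ς * Real.sin (x.2.2 - w.φ t) = Real.sin (ς * (x.2.2 - w.φ t)) := by
    rcases hς with rfl | rfl
    · simp
    · rw [neg_one_mul, neg_one_mul, Real.sin_neg]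
  have h3 := abs_le.1 (abs_mul_sign hς hS)
  have h4 := abs_le.1 (abs_mul_sign hς (he.φ_err t ht))
  have h5 := hχ.chiMax_lt
  have h6 := P.ePhi_nonneg
  rw [h2]
  have h7 : ς * (x.2.2 - w.φ t) = chiMax P C χ + ς * slidingVar χ e t x - ς * (w.φ t - e.φh t) := by
    rw [← h1, slidingVar]; ring
  rw [h7]
  exact Real.sin_pos_of_pos_of_lt_pi (by linarith) (by linarith)

/-- The two constraints support each other, hence a joint induction: the bound on `S` turns the
vehicle inwards at the boundary of the domain, and within the domain the law keeps `|S|` from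
growing past `σ`. -/
theorem Motion.inner_invariant (m : Motion P C w u b s z θ) (hC : C.ClosestWellDefined P.lam)
    (hχ : IsDesignFunction P C χ) (hw : w.Admissible P) (he : e.Admissible P w) {ε : ℝ}
    (hin : InnerLaw P C χ w e u σ ε) {t₁ : ℝ} (ht₁ : t₁ ∈ Icc 0 b)
    (hgood : Good P C (s t₁) (z t₁)) (hS : |slidingVar χ e t₁ (s t₁, z t₁, θ t₁)| ≤ σ) :
    ∀ t ∈ Icc t₁ b, Good P C (s t) (z t) ∧ |slidingVar χ e t (s t, z t, θ t)| ≤ σ := by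
  have hcont := m.sliding_cont hχ he
  refine forall_Icc_of_step (p := fun t => Good P C (s t) (z t) ∧
    |slidingVar χ e t (s t, z t, θ t)| ≤ σ) ⟨hgood, hS⟩ ?_ fun t₀ ht₀ hall => ?_
  · have h1 := isClosed_Icc.isClosed_le hcont.abs (continuousOn_const (c := σ))
    convert (isClosed_Icc (a := t₁) (b := b)).inter (m.isClosed_good.inter h1) using 1
    ext t
    simp only [mem_ofPred_eq, mem_inter_iff]
    exact ⟨fun h => ⟨h.1, ⟨⟨ht₁.1.trans h.1.1, h.1.2⟩, h.2.1⟩, ⟨ht₁.1.trans h.1.1, h.1.2⟩, h.2.2⟩,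
      fun h => ⟨h.1, h.2.1.2, h.2.2.2⟩⟩
  obtain ⟨hg₀, hS₀⟩ := hall t₀ ⟨ht₀.1, le_rfl⟩
  have ht₀' : t₀ ∈ Ico 0 b := ⟨ht₁.1.trans ht₀.1, ht₀.2⟩
  have hmem₀ := m.mem t₀ ⟨ht₀'.1, ht₀.2.le⟩
  obtain ⟨t₂, ht₂, ht₂b, hgood₂⟩ := m.exists_good_of_inward hC ht₀' hg₀ (fun hz ς hς hςz => by
    have hpos := sin_heading_pos (x := (s t₀, z t₀, θ t₀)) hχ he hin.σ_lt ht₀'.1 hz hS₀ hς hςz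
    have hφt : Tendsto w.φ (𝓝[Icc t₀ b] t₀) (𝓝 (w.φ t₀)) :=
      tendsto_within_of_continuousOn hw.φ_cont ht₀'.1
    have hθt : Tendsto θ (𝓝[Icc t₀ b] t₀) (𝓝 (θ t₀)) :=
      ((continuous_snd.comp continuous_snd).tendsto _).comp (m.tendsto_within ht₀')
    have h1 : ∀ᶠ t in 𝓝[Icc t₀ b] t₀, 0 < ς * Real.sin (θ t - w.φ t) :=
      (((Real.continuous_sin.tendsto _).comp (hθt.sub hφt)).const_mul ς).eventually
        (lt_mem_nhds hpos)
    obtain ⟨t₁, h2, h3, h4⟩ := exists_Icc_of_eventually ht₀.2 h1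
    exact ⟨t₁, h2, h3, fun t ht => (h4 t ⟨ht.1.le, ht.2.le⟩).le⟩) hw
  have hbar : ∀ g : ℝ, (g = 1 ∨ g = -1) → ∃ t₃, t₀ < t₃ ∧ ∀ t ∈ Icc t₀ t₃, t ≤ b →
      g * slidingVar χ e t (s t, z t, θ t) ≤ σ := by
    intro g hg
    have hev := (m.tendsto_near ht₀').eventually (eventually_eventually_near
      (hin.barrier t₀ ht₀'.1 _ hmem₀ hg₀.2 hS₀ g hg))
    obtain ⟨t₃, ht₃, ht₃b, hev⟩ := exists_Icc_of_eventually ht₀.2 hev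
    refine ⟨min t₂ t₃, lt_min ht₂ ht₃, fun t ht _ => ?_⟩
    have htt₂ : t ≤ t₂ := ht.2.trans (min_le_left _ _)
    have htt₃ : t ≤ t₃ := ht.2.trans (min_le_right _ _)
    refine ac_barrier (f := fun t => g * slidingVar χ e t (s t, z t, θ t)) ht.1 ((ac_mono (m.sliding_ac hχ he) ht₀'.1 ht.1
      (htt₃.trans ht₃b)).const_mul g) ?_ ?_
    · refine (le_abs_self _).trans ?_
      exact abs_mul_sign hg hS₀
    · filter_upwards [m.ae_sliding_deriv hχ he] with τ hτ hτt hτS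
      have hτ0 : 0 < τ := ht₀'.1.trans_lt hτt.1
      obtain ⟨S', hS', hle⟩ := hτ ⟨hτ0, hτt.2.trans_le (htt₃.trans ht₃b)⟩
        (hgood₂ τ ⟨hτt.1.le, hτt.2.le.trans htt₂⟩).lt_one
      refine ⟨_, hS'.const_mul g, hle g 0 ?_⟩
      have h1 : ∀ᶠ x' in nearAE (s τ, z τ, θ τ), σ < g * slidingVar χ e τ x' :=
        (((continuous_slidingVar hχ τ).const_mul g).tendsto _ |>.mono_left
          (nearAE_le _)).eventually (lt_mem_nhds hτS)
      filter_upwards [h1, hev τ ⟨hτt.1.le, hτt.2.le.trans htt₃⟩] with x' h2 h3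
      exact h3 h2
  obtain ⟨t₃, ht₃, h₃⟩ := hbar 1 (Or.inl rfl)
  obtain ⟨t₄, ht₄, h₄⟩ := hbar (-1) (Or.inr rfl)
  refine ⟨min t₂ (min t₃ t₄), lt_min ht₂ (lt_min ht₃ ht₄), fun τ hτ hτb => ⟨?_, ?_⟩⟩
  · exact hgood₂ τ ⟨hτ.1, hτ.2.trans (min_le_left _ _)⟩
  · have h1 := h₃ τ ⟨hτ.1, hτ.2.trans ((min_le_right _ _).trans (min_le_left _ _))⟩ hτb
    have h2 := h₄ τ ⟨hτ.1, hτ.2.trans ((min_le_right _ _).trans (min_le_right _ _))⟩ hτb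
    exact abs_le.2 ⟨by linarith, by linarith⟩

/-- The sliding surface is reached in a finite time and is not left afterwards. -/
theorem Motion.sliding_eq_zero (m : Motion P C w u b s z θ)
    (hχ : IsDesignFunction P C χ) (he : e.Admissible P w) {ε : ℝ}
    (hin : InnerLaw P C χ w e u σ ε) {t₁ : ℝ} (ht₁ : 0 ≤ t₁)
    (hgood : ∀ t ∈ Icc t₁ b, Good P C (s t) (z t) ∧
      |slidingVar χ e t (s t, z t, θ t)| ≤ σ) {t : ℝ} (ht : t₁ + σ / ε ≤ t) (htb : t ≤ b) :
    slidingVar χ e t (s t, z t, θ t) = 0 := by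
  have hε := hin.ε_pos
  have ht₁t : t₁ ≤ t := by linarith [div_nonneg hin.σ_nonneg hε.le]
  have hac : ∀ g τ, t₁ ≤ τ → τ ≤ t →
      AbsolutelyContinuousOnInterval (fun t => g * slidingVar χ e t (s t, z t, θ t)) τ t :=
    fun g τ h1 h2 => (ac_mono (m.sliding_ac hχ he) (ht₁.trans h1) h2 htb).const_mul g
  have hder : ∀ g : ℝ, (g = 1 ∨ g = -1) → ∀ᵐ τ, τ ∈ Ioo t₁ t →
      0 < g * slidingVar χ e τ (s τ, z τ, θ τ) →
      ∃ S', HasDerivAt (fun t => g * slidingVar χ e t (s t, z t, θ t)) S' τ ∧ S' ≤ -ε := by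
    intro g hg
    filter_upwards [m.ae_sliding_deriv hχ he] with τ hτ hτt hpos
    have hmem : τ ∈ Icc t₁ b := ⟨hτt.1.le, hτt.2.le.trans htb⟩
    obtain ⟨S', hS', hle⟩ := hτ ⟨ht₁.trans_lt hτt.1, hτt.2.trans_le htb⟩ (hgood τ hmem).1.lt_one
    refine ⟨_, hS'.const_mul g, hle g _ (hin.decay τ (ht₁.trans hmem.1) _
      (m.mem τ ⟨ht₁.trans hmem.1, hmem.2⟩) (hgood τ hmem).1.2 g hg hpos ?_)⟩
    exact (le_abs_self _).trans (abs_mul_sign hg (hgood τ hmem).2)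
  have hle : ∀ g : ℝ, (g = 1 ∨ g = -1) → g * slidingVar χ e t (s t, z t, θ t) ≤ 0 := by
    intro g hg
    -- Otherwise `g * S`, at most `σ` initially, would decrease at the rate `ε` for the time at
    -- least `σ / ε` and still be positive.
    obtain ⟨τ, hτ, hτ0⟩ : ∃ τ ∈ Icc t₁ t, g * slidingVar χ e τ (s τ, z τ, θ τ) ≤ 0 := by
      by_contra! hpos
      have h1 := ac_sub_le (m := -ε) ht₁t (hac g t₁ le_rfl ht₁t) (by
        filter_upwards [hder g hg] with τ h1 h2
        exact h1 h2 (hpos τ ⟨h2.1.le, h2.2.le⟩))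
      have h2 := hpos t ⟨ht₁t, le_rfl⟩
      have h3 : g * slidingVar χ e t₁ (s t₁, z t₁, θ t₁) ≤ σ :=
        (le_abs_self _).trans (abs_mul_sign hg (hgood t₁ ⟨le_rfl, ht₁t.trans htb⟩).2)
      have h4 : σ / ε ≤ t - t₁ := by linarith
      rw [div_le_iff₀ hε] at h4
      linarith
    refine ac_barrier (f := fun t => g * slidingVar χ e t (s t, z t, θ t)) hτ.2 (hac g τ hτ.1 hτ.2) hτ0 ?_
    filter_upwards [hder g hg] with τ' h1 h2 h3
    obtain ⟨S', h4, h5⟩ := h1 ⟨hτ.1.trans_lt h2.1, h2.2⟩ h3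
    exact ⟨S', h4, by linarith⟩
  have h1 := hle 1 (Or.inl rfl)
  have h2 := hle (-1) (Or.inr rfl)
  linarith

end

/-! ### Convergence to the path -/

section
variable {P : Params} {C : RefPath} {w : Slip} {u : ℝ → State → ℝ} {b : ℝ} {s z θ : ℝ → ℝ}
  {χ : ℝ → ℝ} {e : Estimates} {σ : ℝ}

theorem sign_eq_of_ne_zero {x : ℝ} (hx : x ≠ 0) : Real.sign x = 1 ∨ Real.sign x = -1 :=
  (Real.sign_apply_eq_of_ne_zero x hx).symm

theorem sign_mul_self {x : ℝ} (hx : x ≠ 0) : Real.sign x * x = |x| := by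
  rcases lt_or_gt_of_ne hx with h | h
  · rw [Real.sign_of_neg h, abs_of_neg h]; ring
  · rw [Real.sign_of_pos h, abs_of_pos h]; ring

/-- `t₁` is the first time at which `|S| ≤ σ`, or `b` if the interval ends, before `2T`, without it.
That `S` stays large up to `2T` is excluded by `no_two_revolutions`. -/
theorem Motion.exists_inner (m : Motion P C w u b s z θ) (hC : C.ClosestWellDefined P.lam)
    (hχ : IsDesignFunction P C χ) (hw : w.Admissible P) (he : e.Admissible P w)
    (hK : C.kBar < P.kV - Real.tan P.phiBar / P.L) (hσ : 0 ≤ σ)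
    (hout : OuterLaw P C χ w e u σ)
    (hinit : InitialOK P C (s 0, z 0, θ 0) (slidingVar χ e 0 (s 0, z 0, θ 0))) :
    ∃ t₁ ∈ Icc 0 b, t₁ ≤ 2 * P.T ∧ (∀ t ∈ Icc 0 t₁, Good P C (s t) (z t)) ∧
      (|slidingVar χ e t₁ (s t₁, z t₁, θ t₁)| ≤ σ ∨ t₁ = b) := by
  have hb := m.b_nonneg
  have hT := P.T_pos
  have h0 : Good P C (s 0) (z 0) := by
    refine ⟨hinit.closest, ?_⟩
    have := hinit.pos_mem.1
    rwa [hinit.closest.distTo_point] at this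
  set S := fun t => slidingVar χ e t (s t, z t, θ t) with hS
  by_cases hS0 : |S 0| ≤ σ
  · refine ⟨0, ⟨le_rfl, hb⟩, by linarith, fun t ht => ?_, Or.inl hS0⟩
    rw [le_antisymm ht.2 ht.1]; exact h0
  push Not at hS0
  have hne : S 0 ≠ 0 := fun h => by rw [h, abs_zero] at hS0; linarith
  set g := Real.sign (S 0) with hgdef
  have hg : g = 1 ∨ g = -1 := sign_eq_of_ne_zero hne
  have hgS0 : σ < g * S 0 := by
    rwa [hgdef, sign_mul_self hne]
  have hdisc : Metric.closedBall (circleCenter P g (C.tang (s 0) - θ 0) (C.point (s 0) (z 0)))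
      (sweptRadius P g (C.tang (s 0) - θ 0) (C.point (s 0) (z 0))) ⊆ C.domain P.lam := by
    rw [← cthickening_initialDisc]
    exact hinit.disc_subset hne
  have hang : devAng P (P.dmax * g) (C.tang (s 0) - θ 0) < Real.pi := hinit.angle_dev hne
  have hcont : ContinuousOn (fun t => g * S t) (Icc 0 b) :=
    continuousOn_const.mul (m.sliding_cont hχ he)
  by_cases hex : ∃ t ∈ Icc 0 (min b (2 * P.T)), g * S t ≤ σ
  · set X := {t ∈ Icc 0 (min b (2 * P.T)) | g * S t ≤ σ} with hX
    have hXc : IsClosed X := isClosed_Icc.isClosed_le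
      (hcont.mono (Icc_subset_Icc_right (min_le_left _ _))) continuousOn_const
    have hXne : X.Nonempty := hex
    have hXb : BddBelow X := ⟨0, fun t ht => ht.1.1⟩
    have hmem := hXc.csInf_mem hXne hXb
    set t₁ := sInf X with ht₁
    have hpos : ∀ t ∈ Ico 0 t₁, σ < g * S t := by
      intro t ht
      by_contra! hle
      exact absurd (csInf_le hXb (show t ∈ X from ⟨⟨ht.1, ht.2.le.trans hmem.1.2⟩, hle⟩))
        (not_le.2 ht.2)
    have ht₁b : t₁ ≤ b := hmem.1.2.trans (min_le_left _ _)
    have ht₁T : t₁ ≤ 2 * P.T := hmem.1.2.trans (min_le_right _ _)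
    have ht₁0 : 0 < t₁ := by
      refine lt_of_le_of_ne hmem.1.1 fun h => ?_
      have := hmem.2
      rw [← h] at this
      linarith
    have heq : σ ≤ g * S t₁ := by
      have h1 : t₁ ∈ closure (Ico 0 t₁) := by
        rw [closure_Ico ht₁0.ne]; exact ⟨ht₁0.le, le_rfl⟩
      refine ContinuousWithinAt.closure_le h1 continuousWithinAt_const
        ((hcont t₁ ⟨ht₁0.le, ht₁b⟩).mono fun t ht => ⟨ht.1, ht.2.le.trans ht₁b⟩)
        fun t ht => (hpos t ht).le
    refine ⟨t₁, ⟨ht₁0.le, ht₁b⟩, ht₁T, ?_, Or.inl ?_⟩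
    · exact (m.restrict ht₁0.le ht₁b).good_of_outer hC hw hK hout hg ht₁T hdisc h0 hpos
    · have h1 : g * S t₁ = σ := le_antisymm hmem.2 heq
      have h2 : |g * S t₁| = |S t₁| := by
        rw [abs_mul]; rcases hg with h | h <;> rw [h] <;> simp
      change |S t₁| ≤ σ
      rw [← h2, h1, abs_of_nonneg hσ]
  · push Not at hex
    rcases lt_or_ge b (2 * P.T) with hlt | hge
    · rw [min_eq_left hlt.le] at hex
      exact ⟨b, ⟨hb, le_rfl⟩, hlt.le, m.good_of_outer hC hw hK hout hg hlt.le hdisc h0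
        fun t ht => hex t ⟨ht.1, ht.2.le⟩, Or.inr rfl⟩
    · rw [min_eq_right hge] at hex
      have hm := m.restrict (by linarith) hge
      have hgood := hm.good_of_outer hC hw hK hout hg le_rfl hdisc h0
        fun t ht => hex t ⟨ht.1, ht.2.le⟩
      obtain ⟨β, hβ, hβb, hlim⟩ := hout g hg
      refine (no_two_revolutions hC hχ hw he hβ hβb hg hm hinit.angle hgood (fun t ht => ?_)
        hdisc hang (hσ.trans_lt (hex _ ⟨by linarith, le_rfl⟩))).elim
      exact hlim t ht.1.le _ (hm.mem t ⟨ht.1.le, ht.2.le⟩) (hgood t ⟨ht.1.le, ht.2.le⟩).2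
        (hex t ⟨ht.1.le, ht.2.le⟩)

/-- Bounds `z` before the sliding stage by a quantity common to all motions, so that one constant
`c` serves them all. -/
theorem Motion.abs_z_le (m : Motion P C w u b s z θ) (hw : w.Admissible P)
    (hgood : ∀ t ∈ Icc 0 b, Good P C (s t) (z t)) : ∀ t ∈ Icc 0 b, |z t| ≤ |z 0| + P.vMax * t := by
  have key : ∀ ς : ℝ, (ς = 1 ∨ ς = -1) → ∀ t ∈ Icc 0 b, ς * z t ≤ |z 0| + P.vMax * t := by
    intro ς hς t ht
    have h1 := ac_sub_le (m := P.vMax) ht.1 ((ac_mono m.z_ac le_rfl ht.1 ht.2).const_mul ς) (by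
      filter_upwards [m.incl] with τ hτ hτt
      have hmem : τ ∈ Icc 0 b := ⟨hτt.1.le, hτt.2.le.trans ht.2⟩
      obtain ⟨y, hy, -, hyz, -⟩ := hτ ⟨hτt.1, hτt.2.trans_le ht.2⟩
      refine ⟨_, hyz.const_mul ς, ?_⟩
      rw [filippov_zDot (x := (s τ, z τ, θ τ)) hmem.1 (m.mem τ hmem) (hgood τ hmem).lt_one hy,
        zDot]
      have h2 : |ς * Real.sin (θ τ - w.φ τ)| ≤ 1 := abs_mul_sign hς (Real.abs_sin_le_one _)
      have h3 := (abs_le.1 h2).1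
      have h4 := hw.v_pos hmem.1
      have h5 := (speed_bounds (hw.φ_le τ hmem.1) (hw.vs_le τ hmem.1)).2
      change w.v P τ ≤ _ at h5
      nlinarith)
    have h2 : ς * z 0 ≤ |z 0| := (le_abs_self _).trans (abs_mul_sign hς le_rfl)
    linarith
  intro t ht
  have h1 := key 1 (Or.inl rfl) t ht
  have h2 := key (-1) (Or.inr rfl) t ht
  exact abs_le.2 ⟨by linarith, by linarith⟩

/-- On the sliding surface, the distance to the path decays outside of the final zone. -/
theorem zDot_le (hχ : IsDesignFunction P C χ) (hw : w.Admissible P) (he : e.Admissible P w)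
    {ez : ℝ} (hroot : χ ez = P.ePhi) {t : ℝ} (ht : 0 ≤ t) {x : State}
    (hz : C.kBar * |x.2.1| ≤ P.lam) (hS : slidingVar χ e t x = 0) (hlt : ez ≤ |x.2.1|)
    {ς : ℝ} (hς : ς = 1 ∨ ς = -1) (hςz : ς * x.2.1 = |x.2.1|) :
    ς * zDot x.2.2 (w.φ t) (w.v P t) ≤
      -(P.vMin * Real.sin (χ (ez + (|x.2.1| - ez)) - χ ez)) := by
  have h1 : ς * χ x.2.1 = χ |x.2.1| := by
    rw [← hςz]
    rcases hς with rfl | rfl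
    · simp
    · rw [neg_one_mul, neg_one_mul, hχ.odd]
  have h2 : ς * Real.sin (x.2.2 - w.φ t) = Real.sin (ς * (x.2.2 - w.φ t)) := by
    rcases hς with rfl | rfl
    · simp
    · rw [neg_one_mul, neg_one_mul, Real.sin_neg]
  have h3 : ς * (x.2.2 - w.φ t) = χ |x.2.1| - ς * (w.φ t - e.φh t) := by
    rw [slidingVar] at hS
    rw [← h1]
    linear_combination ς * hS
  have h4 := abs_le.1 (abs_mul_sign hς (he.φ_err t ht))
  have h5 := hχ.le_chiMax (z := |x.2.1|) (by rwa [abs_abs])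
  have h6 := hχ.chiMax_lt
  have h7 := hχ.mono hlt
  have h8 : Real.sin (χ |x.2.1| - P.ePhi) ≤ ς * Real.sin (x.2.2 - w.φ t) := by
    rw [h2, h3]
    exact Real.sin_le_sin_of_le_of_le_pi_div_two (by linarith [Real.pi_pos]) (by linarith)
      (by linarith)
  have h9 : 0 ≤ Real.sin (χ |x.2.1| - P.ePhi) :=
    Real.sin_nonneg_of_nonneg_of_le_pi (by linarith)
      (by linarith [Real.pi_pos, P.ePhi_nonneg])
  have h10 := (speed_bounds (hw.φ_le t ht) (hw.vs_le t ht)).1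
  change _ ≤ w.v P t at h10
  rw [add_sub_cancel, hroot, zDot]
  have h11 := mul_le_mul h10 h8 h9 (hw.v_pos ht).le
  linarith

/-- `W = D * exp (M * D) * exp (k * t)` with `D = |z| - ez` plays the role of a Lyapunov function:
`dW/dt` is a positive multiple of `(1 + M * D) * dD/dt + k * D`, which `hrate` makes nonpositive.
The weight `exp (M * D)` absorbs the nonlinearity without loss in the exponent. -/
theorem Motion.tail (m : Motion P C w u b s z θ) (hχ : IsDesignFunction P C χ)
    (hw : w.Admissible P) (he : e.Admissible P w) {ez γ M c : ℝ} (hez : 0 ≤ ez)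
    (hroot : χ ez = P.ePhi) (hM : 0 < M)
    (hrate : ∀ D, 0 ≤ D → C.kBar * (ez + D) ≤ P.lam →
      γ * D ≤ Real.sin (χ (ez + D) - χ ez) * (1 + M * D))
    {t₁ t : ℝ} (ht₁ : 0 ≤ t₁) (ht : t₁ ≤ t) (htb : t ≤ b)
    (hgood : ∀ t ∈ Icc t₁ b, Good P C (s t) (z t))
    (hS : ∀ t ∈ Icc t₁ b, slidingVar χ e t (s t, z t, θ t) = 0) (hc : 0 ≤ c)
    (hc₁ : (|z t₁| - ez) * Real.exp (M * (|z t₁| - ez)) * Real.exp (γ * P.vMin * t₁) ≤ c) :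
    |z t| ≤ ez + c * Real.exp (-(γ * P.vMin) * t) := by
  set k := γ * P.vMin with hk
  set W := fun t => (|z t| - ez) * Real.exp (M * (|z t| - ez)) * Real.exp (k * t) with hW
  have hzac := ac_mono m.z_ac ht₁ ht htb
  have hD : AbsolutelyContinuousOnInterval
      (fun t => (|z t| - ez) * Real.exp (M * (|z t| - ez))) t₁ t := by
    obtain ⟨B, hB⟩ := isCompact_Icc.exists_bound_of_continuousOn
      (m.z_cont.mono (show Icc t₁ t ⊆ Icc 0 b from Icc_subset_Icc ht₁ htb))
    have hcd : ContDiff ℝ 1 fun x : ℝ => (x - ez) * Real.exp (M * (x - ez)) := by fun_prop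
    obtain ⟨K, hK⟩ := hcd.contDiffOn.exists_lipschitzOnWith (s := Icc 0 B) one_ne_zero
      (convex_Icc _ _) isCompact_Icc
    have habs : AbsolutelyContinuousOnInterval (fun t => |z t|) t₁ t := by
      refine ac_comp_lipschitz zero_le_one hzac (s := univ) (h := fun x : ℝ => |x|)
        (fun _ _ => mem_univ _) fun x _ y _ => ?_
      rw [one_mul, Real.dist_eq, Real.dist_eq]
      exact abs_abs_sub_abs_le x y
    refine ac_comp_lipschitz (h := fun x : ℝ => (x - ez) * Real.exp (M * (x - ez))) K.2 habs
      (s := Icc 0 B) (fun τ hτ => ?_) fun x hx y hy => hK.dist_le_mul x hx y hy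
    rw [uIcc_of_le ht] at hτ
    exact ⟨abs_nonneg _, hB τ hτ⟩
  have hE : AbsolutelyContinuousOnInterval (fun t => Real.exp (k * t)) t₁ t :=
    ContDiffOn.absolutelyContinuousOnInterval (by fun_prop)
  have hWt : W t ≤ c := by
    -- Above the level `c ≥ 0`, `W` is positive, so `D > 0` and `|z|` is differentiable wherever `z`
    -- is.
    refine ac_barrier (f := W) ht (hD.mul hE) hc₁ ?_
    filter_upwards [m.incl] with τ hτ hτt hcW
    have hmem : τ ∈ Icc t₁ b := ⟨hτt.1.le, hτt.2.le.trans htb⟩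
    have hτ0 : 0 ≤ τ := ht₁.trans hmem.1
    obtain ⟨y, hy, -, hyz, -⟩ := hτ ⟨ht₁.trans_lt hτt.1, hτt.2.trans_le htb⟩
    have hDpos : 0 < |z τ| - ez := by
      by_contra! hle
      have : W τ ≤ 0 := mul_nonpos_of_nonpos_of_nonneg
        (mul_nonpos_of_nonpos_of_nonneg hle (Real.exp_pos _).le) (Real.exp_pos _).le
      linarith
    have hz0 : z τ ≠ 0 := abs_pos.1 (by linarith)
    obtain ⟨ς, hς, hςz, hder⟩ : ∃ ς : ℝ, (ς = 1 ∨ ς = -1) ∧ ς * z τ = |z τ| ∧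
        HasDerivAt (fun t => |z t|) (ς * y.2.1) τ := by
      rcases lt_or_gt_of_ne hz0 with h | h
      · exact ⟨-1, Or.inr rfl, by rw [abs_of_neg h]; ring, (hasDerivAt_abs_neg h).comp τ hyz⟩
      · exact ⟨1, Or.inl rfl, by rw [abs_of_pos h]; ring, (hasDerivAt_abs_pos h).comp τ hyz⟩
    set D := |z τ| - ez with hDdef
    have hzD := zDot_le (x := (s τ, z τ, θ τ)) hχ hw he hroot hτ0 (hgood τ hmem).2
      (hS τ hmem) (by linarith : ez ≤ |z τ|) hς hςz
    rw [← filippov_zDot (x := (s τ, z τ, θ τ)) hτ0 (m.mem τ ⟨hτ0, hmem.2⟩)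
      (hgood τ hmem).lt_one hy] at hzD
    change ς * y.2.1 ≤ -(P.vMin * Real.sin (χ (ez + D) - χ ez)) at hzD
    have hr := hrate D hDpos.le (by
      rw [hDdef, add_sub_cancel]; exact (hgood τ hmem).2)
    have d1 : HasDerivAt (fun t => |z t| - ez) (ς * y.2.1) τ := hder.sub_const ez
    have d2 := (d1.mul (d1.const_mul M).exp).mul (((hasDerivAt_id τ).const_mul k).exp)
    refine ⟨_, d2, ?_⟩
    simp only [Pi.mul_apply, id, mul_one]
    rw [← hDdef]
    have e1 : (ς * y.2.1 * Real.exp (M * D) + D * (Real.exp (M * D) * (M * (ς * y.2.1)))) *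
        Real.exp (k * τ) + D * Real.exp (M * D) * (Real.exp (k * τ) * k) =
        Real.exp (M * D) * Real.exp (k * τ) * ((ς * y.2.1) * (1 + M * D) + k * D) := by ring
    rw [e1]
    refine mul_nonpos_of_nonneg_of_nonpos (by positivity) ?_
    have h1 := mul_le_mul_of_nonneg_right hzD (show 0 ≤ 1 + M * D by positivity)
    have h2 := mul_le_mul_of_nonneg_left hr P.vMin_pos.le
    rw [hk]
    linarith
  have hexp : Real.exp (k * t) * Real.exp (-k * t) = 1 := by
    rw [← Real.exp_add]; simp
  rcases le_total (|z t|) ez with hle | hge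
  · have : 0 ≤ c * Real.exp (-k * t) := by positivity
    linarith
  · have h1 : (|z t| - ez) * Real.exp (k * t) ≤ c := by
      refine le_trans ?_ hWt
      simp only [hW]
      refine mul_le_mul_of_nonneg_right ?_ (Real.exp_pos _).le
      exact le_mul_of_one_le_right (by linarith)
        (Real.one_le_exp (mul_nonneg hM.le (by linarith)))
    have h2 := mul_le_mul_of_nonneg_right h1 (Real.exp_pos (-k * t)).le
    rw [mul_assoc, hexp, mul_one] at h2
    linarith

theorem tracks_of_laws (hC : C.ClosestWellDefined P.lam)
    (hχ : IsDesignFunction P C χ) (hw : w.Admissible P) (he : e.Admissible P w)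
    (hK : C.kBar < P.kV - Real.tan P.phiBar / P.L) {ε : ℝ} (hin : InnerLaw P C χ w e u σ ε)
    (hout : OuterLaw P C χ w e u σ) {x₀ : State} (hinit : InitialOK P C x₀ (slidingVar χ e 0 x₀)) :
    TracksExponentially P C χ w u x₀ := by
  obtain ⟨ez, hez, -, hroot, hpos⟩ := hχ.exists_root
  have hroot' : χ ez = P.ePhi := (hroot ez).2 rfl
  obtain ⟨M, hM, hrate⟩ := hχ.exists_rate hez hroot' hpos
  refine ⟨ez, hroot, hpos, ?_⟩
  set γ := rightDeriv χ ez with hγ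
  change ∃ c, ∀ J x, _ → _ → _ → _ → _ → _ → ∀ t ∈ J, _ ∧ _ ∧
    _ ≤ ez + c * Real.exp (-(γ * P.vMin) * t)
  set T₃ := 2 * P.T + σ / ε with hT₃
  have hT₃0 : 0 < T₃ := by
    have := P.T_pos
    have := div_nonneg hin.σ_nonneg hin.ε_pos.le
    linarith
  set Z := |x₀.2.1| + P.vMax * T₃ with hZ
  have hZ0 : 0 ≤ Z := add_nonneg (abs_nonneg _) (mul_nonneg P.vMax_pos.le hT₃0.le)
  set k := γ * P.vMin with hk
  have hk0 : 0 < k := mul_pos hpos P.vMin_pos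
  -- Up to `T₃` the crude bound `|z| ≤ Z` is used, `exp (k * T₃)` making up for the decay;
  -- afterwards, `c` majorizes `W` at `T₃`. It does not depend on the motion.
  set c := Z * Real.exp (M * Z) * Real.exp (k * T₃) with hc
  have hc0 : 0 ≤ c := by positivity
  refine ⟨c, fun J x hJ h0 hJ0 hx hx0 hdom t ht => ?_⟩
  have ht0 : 0 ≤ t := hJ0 ht
  obtain ⟨s, z, θ, m, hxs⟩ := hx.exists_motion hJ h0 hdom ht ht0
  have hx₀ : x₀ = (s 0, z 0, θ 0) := by rw [← hx0]; exact hxs 0 ⟨le_rfl, ht0⟩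
  rw [hx₀] at hinit
  obtain ⟨t₁, ht₁, ht₁T, hgood₁, hor⟩ := m.exists_inner hC hχ hw he hK hin.σ_nonneg hout hinit
  have hinner : ∀ τ ∈ Icc t₁ t, t₁ < t → Good P C (s τ) (z τ) ∧
      |slidingVar χ e τ (s τ, z τ, θ τ)| ≤ σ := by
    intro τ hτ hlt
    rcases hor with h | h
    · exact m.inner_invariant hC hχ hw he hin ht₁ (hgood₁ t₁ ⟨ht₁.1, le_rfl⟩) h τ hτ
    · exact absurd h hlt.ne
  have hgood : ∀ τ ∈ Icc 0 t, Good P C (s τ) (z τ) := by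
    intro τ hτ
    rcases le_or_gt τ t₁ with h | h
    · exact hgood₁ τ ⟨hτ.1, h⟩
    · exact (hinner τ ⟨h.le, hτ.2⟩ (h.trans_le hτ.2)).1
  rw [hxs t ⟨ht0, le_rfl⟩]
  obtain ⟨hg1, hg2⟩ := hgood t ⟨ht0, le_rfl⟩
  refine ⟨hg1, hg2, ?_⟩
  have hzZ : ∀ τ ∈ Icc 0 t, τ ≤ T₃ → |z τ| ≤ Z := by
    intro τ hτ hτT
    refine (m.abs_z_le hw hgood τ hτ).trans ?_
    rw [hZ, hx₀]
    gcongr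
    exact P.vMax_pos.le
  have hexp1 : 1 ≤ Real.exp (M * Z) := Real.one_le_exp (mul_nonneg hM.le hZ0)
  rcases le_or_gt t T₃ with hle | hge
  · have h1 := hzZ t ⟨ht0, le_rfl⟩ hle
    have h2 : Z ≤ c * Real.exp (-k * t) := by
      rw [hc, mul_assoc, ← Real.exp_add, mul_assoc]
      refine le_mul_of_one_le_right hZ0 ?_
      refine one_le_mul_of_one_le_of_one_le hexp1 (Real.one_le_exp ?_)
      nlinarith
    change |z t| ≤ _
    linarith
  · have hT₃t : T₃ ∈ Icc 0 t := ⟨hT₃0.le, hge.le⟩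
    have hlt : t₁ < t := by linarith [div_nonneg hin.σ_nonneg hin.ε_pos.le]
    have hS : ∀ τ ∈ Icc T₃ t, slidingVar χ e τ (s τ, z τ, θ τ) = 0 := fun τ hτ =>
      m.sliding_eq_zero hχ he hin ht₁.1 (fun τ' hτ' => hinner τ' hτ' hlt)
        (by linarith [hτ.1]) hτ.2
    refine m.tail hχ hw he hez hroot' hM hrate hT₃0.le hge.le le_rfl
      (fun τ hτ => hgood τ ⟨hT₃0.le.trans hτ.1, hτ.2⟩) hS hc0 ?_
    have h1 : |z T₃| - ez ≤ Z := by linarith [hzZ T₃ hT₃t le_rfl]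
    rw [hc]
    refine mul_le_mul_of_nonneg_right ?_ (Real.exp_pos _).le
    gcongr

end

/-! ### The maximal actuation law -/

section
variable {P : Params} {C : RefPath} {w : Slip} {u : ℝ → State → ℝ} {χ : ℝ → ℝ} {e : Estimates}

theorem one_le_cos_add {x : ℝ} (h0 : 0 ≤ x) (h1 : x ≤ 4) : 1 ≤ Real.cos x + 2 * x := by
  have := Real.one_sub_sq_div_two_le_cos (x := x)
  nlinarith

/-- The maintainability inequality at `z = 0`: the reserve `2 * kBar / (1 - lam) * ePhi` covers the
defect `1 - cos ePhi`. So the vehicle can turn more sharply than the path under the worst slip. -/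
theorem StrictlyMaintainable.kBar_lt (h : StrictlyMaintainable P C χ)
    (hχ : IsDesignFunction P C χ) : C.kBar < P.kV - Real.tan P.phiBar / P.L := by
  have h1 := h 0 le_rfl (by simpa using P.lam_pos.le) _ (Or.inl rfl)
  have hpi := Real.pi_lt_d2
  have hb : P.ePhi < Real.pi / 2 := P.ePhi_le.trans_lt P.phiBar_lt
  simp only [hχ.zero, zero_add, mul_zero, sub_zero, div_one, kVehLow] at h1
  have h2 := mul_nonneg (hχ.rightDeriv_nonneg 0)
    (Real.sin_nonneg_of_nonneg_of_le_pi P.ePhi_nonneg (by linarith [Real.pi_pos]))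
  have h3 := mul_le_mul_of_nonneg_left (one_le_cos_add P.ePhi_nonneg (by linarith)) C.kBar_nonneg
  have h4 : 0 ≤ P.dphiBar / (P.vrw - P.vBar) := div_nonneg P.dphiBar_nonneg P.vMin_pos.le
  have h5 : C.kBar * (2 * P.ePhi) ≤ 2 * C.kBar / (1 - P.lam) * P.ePhi := by
    have h6 : 0 < 1 - P.lam := by linarith [P.lam_lt]
    have h7 : 2 * C.kBar ≤ 2 * C.kBar / (1 - P.lam) := by
      rw [le_div_iff₀ h6]
      nlinarith [mul_nonneg C.kBar_nonneg P.lam_pos.le]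
    nlinarith [mul_le_mul_of_nonneg_right h7 P.ePhi_nonneg]
  simp only [Params.kV]
  linarith

theorem abs_div_one_sub_le {k₀ k z y : ℝ} (hk : |k| ≤ k₀) (hz : k₀ * |z| < 1) :
    |k * (y / (1 - k * z))| ≤ k₀ * |y| / (1 - k₀ * |z|) := by
  have h1 := one_sub_mul_pos hk hz
  have h2 : 1 - k₀ * |z| ≤ 1 - k * z := by
    have : k * z ≤ k₀ * |z| := (le_abs_self _).trans (by rw [abs_mul]; gcongr)
    linarith
  rw [abs_mul, abs_div, abs_of_pos h1, mul_div_assoc]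
  gcongr
  linarith [abs_nonneg k]

/-- The value of the sum of the terms of `Ṡ` controlled by the maintainability inequality. -/
theorem StrictlyMaintainable.exists_slack (h : StrictlyMaintainable P C χ)
    (hχ : IsDesignFunction P C χ) {z : ℝ} (hz : C.kBar * |z| ≤ P.lam) :
    ∃ m > 0, ∀ d, (d = rightDeriv χ z ∨ d = leftDeriv χ z) → ∀ k a, |k| ≤ C.kBar → |a| ≤ P.ePhi →
      |k * (Real.cos (χ z + a) / (1 - k * z)) + d * Real.sin (χ z + a)| ≤
        P.kV - Real.tan P.phiBar / P.L - P.dphiBar / P.vMin - m := by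
  set y := |z| with hy
  have hy0 : 0 ≤ y := abs_nonneg z
  set B := χ y + P.ePhi with hB
  have key : ∀ d, (d = rightDeriv χ z ∨ d = leftDeriv χ z) → ∃ m > 0, ∀ k a, |k| ≤ C.kBar →
      |a| ≤ P.ePhi → |k * (Real.cos (χ z + a) / (1 - k * z)) + d * Real.sin (χ z + a)| ≤
        P.kV - Real.tan P.phiBar / P.L - P.dphiBar / P.vMin - m := by
    intro d hd
    have hd0 : 0 ≤ d := by
      rcases hd with rfl | rfl
      · exact hχ.rightDeriv_nonneg z
      · exact hχ.leftDeriv_nonneg z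
    have hd' : d = rightDeriv χ y ∨ d = leftDeriv χ y := by
      rcases abs_cases z with ⟨h1, -⟩ | ⟨h1, -⟩
      · rwa [hy, h1]
      · rw [hy, h1, hχ.leftDeriv_eq, neg_neg, ← hχ.leftDeriv_eq]; exact hd.symm
    have hm := h y hy0 hz d hd'
    refine ⟨_, sub_pos.2 hm, fun k a hk ha => ?_⟩
    have hχz : |χ z| = χ y := (hχ.abs z).symm
    have hχy0 : 0 ≤ χ y := hχ.nonneg hy0
    have hχy := hχ.le_chiMax (z := y) (by rwa [abs_of_nonneg hy0])
    have hmax := hχ.chiMax_lt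
    have he0 := P.ePhi_nonneg
    -- Maintainability concerns the angle `B`, while the actual one may be less by up to `2 * ePhi`.
    -- This only reduces the sine and raises the cosine by at most `2 * ePhi`, which the reserve `2
    -- * kBar / (1 - lam) * ePhi` pays for.
    set A := |χ z + a| with hA
    have hAB : A ≤ B := (abs_add_le _ _).trans (by rw [hχz, hB]; linarith)
    have hBA : B - 2 * P.ePhi ≤ A := by
      have h1 := abs_sub_abs_le_abs_sub (χ z) (-a)
      rw [abs_neg, hχz, sub_neg_eq_add] at h1
      rw [hB]; linarith
    have hB2 : B < Real.pi / 2 := by rw [hB]; linarith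
    have hA0 : 0 ≤ A := abs_nonneg _
    have hcosA : |Real.cos (χ z + a)| = Real.cos A := by
      rw [hA, Real.cos_abs]
      rw [abs_of_nonneg]
      exact Real.cos_nonneg_of_neg_pi_div_two_le_of_le (by linarith [neg_abs_le (χ z + a)])
        (by linarith [le_abs_self (χ z + a)])
    have hsinA : |Real.sin (χ z + a)| = Real.sin A := by
      rw [hA]
      refine Real.abs_sin_eq_sin_abs_of_abs_le_pi ?_
      linarith [Real.pi_pos]
    have hz1 : C.kBar * y < 1 := hz.trans_lt P.lam_lt
    have t1 := abs_div_one_sub_le (y := Real.cos (χ z + a)) hk (show C.kBar * |z| < 1 from hz1)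
    rw [hcosA] at t1
    have t2 : |d * Real.sin (χ z + a)| ≤ d * Real.sin B := by
      rw [abs_mul, abs_of_nonneg hd0, hsinA]
      exact mul_le_mul_of_nonneg_left (Real.sin_le_sin_of_le_of_le_pi_div_two
        (by linarith [Real.pi_pos]) hB2.le hAB) hd0
    have hcos : Real.cos A ≤ Real.cos B + 2 * P.ePhi := by
      have h1 := (abs_le.1 (Real.abs_cos_sub_cos_le A B)).2
      have h2 : |A - B| ≤ 2 * P.ePhi := abs_le.2 ⟨by linarith, by linarith⟩
      linarith
    have hden : 0 < 1 - P.lam := by linarith [P.lam_lt]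
    have t3 : C.kBar * Real.cos A / (1 - C.kBar * y) ≤
        C.kBar * Real.cos B / (1 - C.kBar * y) + 2 * C.kBar / (1 - P.lam) * P.ePhi := by
      have hden' : 0 < 1 - C.kBar * y := by linarith
      have h1 : C.kBar * Real.cos A / (1 - C.kBar * y) ≤
          C.kBar * Real.cos B / (1 - C.kBar * y) + 2 * C.kBar * P.ePhi / (1 - C.kBar * y) := by
        rw [← add_div]
        refine div_le_div_of_nonneg_right ?_ hden'.le
        nlinarith [mul_le_mul_of_nonneg_left hcos C.kBar_nonneg]
      have h2 : 2 * C.kBar * P.ePhi / (1 - C.kBar * y) ≤ 2 * C.kBar * P.ePhi / (1 - P.lam) := by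
        refine div_le_div_of_nonneg_left ?_ hden (by linarith)
        have := C.kBar_nonneg
        positivity
      have h3 : 2 * C.kBar * P.ePhi / (1 - P.lam) = 2 * C.kBar / (1 - P.lam) * P.ePhi := by ring
      linarith
    refine (abs_add_le _ _).trans ?_
    simp only [kVehLow, Params.kV, Params.vMin]
    change |k * (Real.cos (χ z + a) / (1 - k * z))| ≤ C.kBar * Real.cos A / (1 - C.kBar * y) at t1
    linarith
  obtain ⟨m₁, hm₁, h₁⟩ := key _ (Or.inl rfl)
  obtain ⟨m₂, hm₂, h₂⟩ := key _ (Or.inr rfl)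
  refine ⟨min m₁ m₂, lt_min hm₁ hm₂, fun d hd k a hk ha => ?_⟩
  rcases hd with rfl | rfl
  · linarith [h₁ k a hk ha, min_le_left m₁ m₂]
  · linarith [h₂ k a hk ha, min_le_right m₁ m₂]

/-- Expressions in the derivative of `χ` are close to their values for one-sided derivatives. -/
theorem eventually_deriv_tube (hχ : IsDesignFunction P C χ) {t : ℝ} {x : State}
    {X Y : Type*} [TopologicalSpace X] [TopologicalSpace Y] {F : ℝ × X → Y → ℝ} {x₀ : X}
    {K : Set Y} (hK : IsCompact K)
    (hF : ∀ d, ∀ k ∈ K, ContinuousAt (fun q : (ℝ × X) × Y => F q.1 q.2) ((d, x₀), k))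
    {f : ℝ × State → X} (hf : Tendsto f (near t x) (𝓝 x₀)) {η : ℝ} (hη : 0 < η) :
    ∀ᶠ q in near t x, ∃ d, (d = rightDeriv χ x.2.1 ∨ d = leftDeriv χ x.2.1) ∧
      ∀ k ∈ K, |F (deriv χ q.2.2.1, f q) k - F (d, x₀) k| < η := by
  have key : ∀ d, ∃ ρ > 0, ∀ᶠ q in near t x, ∀ d', |d' - d| < ρ →
      ∀ k ∈ K, |F (d', f q) k - F (d, x₀) k| < η := by
    intro d
    have h1 := eventually_forall_abs_sub_lt (x₀ := (d, x₀)) hK (hF d) hη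
    rw [nhds_prod_eq, eventually_prod_iff] at h1
    obtain ⟨pa, ha, pb, hb, h⟩ := h1
    obtain ⟨ρ, hρ, hball⟩ := Metric.eventually_nhds_iff.1 ha
    refine ⟨ρ, hρ, ?_⟩
    filter_upwards [hf.eventually hb] with q hq d' hd' k hk
    exact h (hball (by rwa [Real.dist_eq])) hq k hk
  obtain ⟨ρ₁, hρ₁, h₁⟩ := key (rightDeriv χ x.2.1)
  obtain ⟨ρ₂, hρ₂, h₂⟩ := key (leftDeriv χ x.2.1)
  have h3 : ∀ᶠ q in near t x, DifferentiableAt ℝ χ q.2.2.1 ∧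
      ∃ d, (d = rightDeriv χ x.2.1 ∨ d = leftDeriv χ x.2.1) ∧
        |deriv χ q.2.2.1 - d| < min ρ₁ ρ₂ :=
    eventually_near_of_snd ((tendsto_nearAE_normal x).eventually
      (hχ.eventually_deriv x.2.1 (lt_min hρ₁ hρ₂)))
  filter_upwards [h₁, h₂, h3] with q h₁ h₂ h3
  obtain ⟨-, d, hd, hlt⟩ := h3
  refine ⟨d, hd, ?_⟩
  rcases hd with rfl | rfl
  · exact h₁ _ (hlt.trans_le (min_le_left _ _))
  · exact h₂ _ (hlt.trans_le (min_le_right _ _))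

theorem sign_eq_of_mul_pos {g x : ℝ} (hg : g = 1 ∨ g = -1) (h : 0 < g * x) : Real.sign x = g := by
  rcases hg with rfl | rfl
  · exact Real.sign_of_pos (by linarith)
  · exact Real.sign_of_neg (by linarith)

theorem eventually_near_nonneg (t : ℝ) (x : State) : ∀ᶠ q in near t x, 0 ≤ q.1 :=
  tendsto_fst.eventually eventually_mem_nhdsWithin

theorem tendsto_near_slidingVar (hχ : IsDesignFunction P C χ) (he : e.Admissible P w) {t : ℝ}
    (ht : 0 ≤ t) (x : State) : Tendsto (fun q : ℝ × State => slidingVar χ e q.1 q.2)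
      (near t x) (𝓝 (slidingVar χ e t x)) :=
  (tendsto_slidingVar hχ he ht x).mono_left (near_le t x)

theorem slidingDot_eq (t : ℝ) (x : State) : slidingDot P C χ w e u t x =
    w.v P t * (C.κ x.1 * (Real.cos (x.2.2 - w.φ t) / (1 - C.κ x.1 * x.2.1)) +
      deriv χ x.2.1 * Real.sin (x.2.2 - w.φ t) -
      (Real.tan (u t x + w.β t) - Real.tan (w.φ t)) / P.L) - e.dφh t := by
  simp only [slidingDot, field, thetaDot, sDot, zDot, turnRate, Slip.v]
  ring

theorem maxLaw_outer (hχ : IsDesignFunction P C χ) (hw : w.Admissible P) (he : e.Admissible P w) :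
    OuterLaw P C χ w e (maxLaw P χ e) 0 := by
  intro g hg
  refine ⟨w.β, hw.β_cont, hw.β_le, fun t ht x _ _ hS => turnLim_iff.2 ?_⟩
  refine (tendsto_near_of_continuousOn (hw.turnRate_cont (abs_dmax_mul hg)) ht x).congr' ?_
  filter_upwards [((tendsto_near_slidingVar hχ he ht x).const_mul g).eventually
    (lt_mem_nhds hS)] with q hq
  rw [maxLaw, sign_eq_of_mul_pos hg hq]

/-- With `σ = 0` the decay clause is void, so `1` is an arbitrary value of its rate. For the
barrier, the strict inequality leaves a slack `m`, which absorbs the change of the curvature and `χ`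
terms of `dS/dt` from the given state to nearby ones. -/
theorem maxLaw_inner (hχ : IsDesignFunction P C χ) (hm : StrictlyMaintainable P C χ)
    (hw : w.Admissible P) (he : e.Admissible P w) :
    InnerLaw P C χ w e (maxLaw P χ e) 0 1 where
  σ_nonneg := le_rfl
  σ_lt := by linarith [hχ.ePhi_lt]
  ε_pos := one_pos
  decay := fun t _ x _ _ g _ h1 h2 => absurd h1 (not_lt.2 h2)
  barrier := by
    intro t ht x hx hz hS g hg
    have hS0 : slidingVar χ e t x = 0 := abs_nonpos_iff.1 hS
    obtain ⟨m, hm0, hslack⟩ := hm.exists_slack hχ hz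
    set F : ℝ × ℝ × ℝ → ℝ × ℝ → ℝ := fun p k =>
      k.1 * (Real.cos (χ p.2.1 + (p.2.2 + k.2)) / (1 - k.1 * p.2.1)) +
        p.1 * Real.sin (χ p.2.1 + (p.2.2 + k.2)) with hF
    have hcont := hχ.cont
    have htube := eventually_deriv_tube (t := t) (x := x) (F := F) (x₀ := (x.2.1, 0))
      (K := Icc (-C.kBar) C.kBar ×ˢ Icc (-P.ePhi) P.ePhi) hχ (isCompact_Icc.prod isCompact_Icc)
      (fun d k hk => by
        have : 1 - k.1 * x.2.1 ≠ 0 := (one_sub_mul_pos (abs_le.2 ⟨hk.1.1, hk.1.2⟩)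
          (hz.trans_lt P.lam_lt)).ne'
        simp only [hF]
        fun_prop (disch := exact this))
      (f := fun q => (q.2.2.1, slidingVar χ e q.1 q.2))
      (by
        refine Tendsto.prodMk_nhds (((continuous_fst.comp continuous_snd).tendsto _).comp
          (tendsto_near_snd t x)) ?_
        rw [← hS0]
        exact tendsto_near_slidingVar hχ he ht x) hm0
    filter_upwards [htube, eventually_near_nonneg t x,
      eventually_near_of_snd (C.eventually_regular hx)] with q hq hτ hreg hpos
    obtain ⟨d, hd, hq⟩ := hq
    have hv := hw.v_pos hτ
    have hvm : P.vMin ≤ w.v P q.1 := (speed_bounds (hw.φ_le _ hτ) (hw.vs_le _ hτ)).1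
    have hk := C.abs_κ_le hreg
    have ha : |e.φh q.1 - w.φ q.1| ≤ P.ePhi := by rw [abs_sub_comm]; exact he.φ_err _ hτ
    have h1 := hq (C.κ q.2.1, e.φh q.1 - w.φ q.1) ⟨abs_le.1 hk, abs_le.1 ha⟩
    have h2 := hslack d hd _ _ hk ha
    have hθ : χ q.2.2.1 + (slidingVar χ e q.1 q.2 + (e.φh q.1 - w.φ q.1)) =
        q.2.2.2 - w.φ q.1 := by rw [slidingVar]; ring
    simp only [hF, hθ, zero_add] at h1
    set Y := C.κ q.2.1 * (Real.cos (q.2.2.2 - w.φ q.1) / (1 - C.κ q.2.1 * q.2.2.1)) +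
      deriv χ q.2.2.1 * Real.sin (q.2.2.2 - w.φ q.1) with hY
    have h3 : |Y| ≤ P.kV - Real.tan P.phiBar / P.L - P.dphiBar / P.vMin := by
      have := abs_sub_abs_le_abs_sub Y (C.κ q.2.1 * (Real.cos (χ x.2.1 + (e.φh q.1 - w.φ q.1)) /
        (1 - C.κ q.2.1 * x.2.1)) + d * Real.sin (χ x.2.1 + (e.φh q.1 - w.φ q.1)))
      linarith
    rw [slidingDot_eq, maxLaw, sign_eq_of_mul_pos hg hpos, ← hY]
    have h4 : g * (w.v P q.1 * (Y - (Real.tan (P.dmax * g + w.β q.1) - Real.tan (w.φ q.1)) / P.L)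
        - e.dφh q.1) = w.v P q.1 * (g * Y - (Real.tan (P.dmax + g * w.β q.1) -
          Real.tan (g * w.φ q.1)) / P.L) - g * e.dφh q.1 := by
      rw [← tan_sub_sign hg]; ring
    rw [h4]
    have h5 := kV_le_tan (abs_mul_sign hg (hw.β_le _ hτ))
    have h6 : Real.tan (g * w.φ q.1) / P.L ≤ Real.tan P.phiBar / P.L :=
      div_le_div_of_nonneg_right ((le_abs_self _).trans
        (abs_tan_le (abs_mul_sign hg (hw.φ_le _ hτ)) P.phiBar_lt)) P.L_pos.le
    have h7 := (abs_le.1 (abs_mul_sign hg h3)).2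
    have h8 := (abs_le.1 (abs_mul_sign hg (he.dφh_le _ hτ))).1
    have h9 : P.dphiBar ≤ w.v P q.1 * (P.dphiBar / P.vMin) := by
      rw [mul_div_assoc', le_div_iff₀ P.vMin_pos, mul_comm]
      exact mul_le_mul_of_nonneg_right hvm P.dphiBar_nonneg
    have h10 : g * Y - (Real.tan (P.dmax + g * w.β q.1) - Real.tan (g * w.φ q.1)) / P.L ≤
        -(P.dphiBar / P.vMin) := by
      rw [sub_div]; linarith
    have h11 := mul_le_mul_of_nonneg_left h10 hv.le
    linarith

end

/-! ### The mixed law -/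

section
variable {P : Params}

theorem sat_mul {g : ℝ} (hg : g = 1 ∨ g = -1) (x : ℝ) : sat P (g * x) = g * sat P x := by
  have hd := P.dmax_pos
  rcases hg with rfl | rfl
  · simp
  · simp only [sat, neg_one_mul]
    rcases le_total x P.dmax with h1 | h1 <;> rcases le_total (-P.dmax) x with h2 | h2
    · rw [min_eq_right h1, max_eq_right h2, min_eq_right (by linarith), max_eq_right (by linarith)]
    · rw [min_eq_right h1, max_eq_left h2, min_eq_left (by linarith), max_eq_right (by linarith),
        neg_neg]
    · rw [min_eq_left h1, max_eq_right (by linarith : -P.dmax ≤ P.dmax),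
        min_eq_right (by linarith), max_eq_left (by linarith)]
    · linarith

theorem abs_sat_le (x : ℝ) : |sat P x| ≤ P.dmax :=
  abs_le.2 ⟨le_max_left _ _, max_le (by linarith [P.dmax_pos]) (min_le_left _ _)⟩

theorem continuous_sat : Continuous (sat P) := by
  unfold sat; fun_prop

theorem sat_of_le {x : ℝ} (h : P.dmax ≤ x) : sat P x = P.dmax := by
  rw [sat, min_eq_left h, max_eq_right (by linarith [P.dmax_pos])]

theorem sat_of_abs_le {x : ℝ} (h : |x| ≤ P.dmax) : sat P x = x := by
  rw [sat, min_eq_right (abs_le.1 h).2, max_eq_right (abs_le.1 h).1]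

theorem tan_sub_tan {x y : ℝ} (hx : Real.cos x ≠ 0) (hy : Real.cos y ≠ 0) :
    Real.tan x - Real.tan y = Real.sin (x - y) / (Real.cos x * Real.cos y) := by
  rw [Real.tan_eq_sin_div_cos, Real.tan_eq_sin_div_cos, div_sub_div _ _ hx hy, Real.sin_sub]

/-- The increment of the tangent over an interval is maximal at the end of the range. -/
theorem tan_sub_tan_le {a h D : ℝ} (hh : 0 ≤ h) (hD : D < Real.pi / 2) (ha : a ≤ D)
    (ha' : h - D ≤ a) :
    Real.tan a - Real.tan (a - h) ≤ Real.tan D - Real.tan (D - h) := by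
  have hpi := Real.pi_pos
  have c1 : 0 < Real.cos a := Real.cos_pos_of_mem_Ioo ⟨by linarith, by linarith⟩
  have c2 : 0 < Real.cos (a - h) := Real.cos_pos_of_mem_Ioo ⟨by linarith, by linarith⟩
  have c3 : 0 < Real.cos D := Real.cos_pos_of_mem_Ioo ⟨by linarith, by linarith⟩
  have c4 : 0 < Real.cos (D - h) := Real.cos_pos_of_mem_Ioo ⟨by linarith, by linarith⟩
  rw [tan_sub_tan c1.ne' c2.ne', tan_sub_tan c3.ne' c4.ne', sub_sub_cancel, sub_sub_cancel]
  -- The increment equals `sin h / (cos a * cos (a - h))`. Turning the product into a sum shows that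
  -- the denominator is least at `a = D`, since `|2 * a - h| ≤ 2 * D - h`.
  have hprod : ∀ x, 2 * (Real.cos x * Real.cos (x - h)) = Real.cos (2 * x - h) + Real.cos h := by
    intro x
    have h1 := Real.cos_add x (x - h)
    have h2 := Real.cos_sub x (x - h)
    rw [sub_sub_cancel] at h2
    rw [show 2 * x - h = x + (x - h) by ring, h1, h2]
    ring
  have hcos : Real.cos (2 * D - h) ≤ Real.cos (2 * a - h) := by
    rw [← Real.cos_abs (2 * a - h)]
    exact Real.cos_le_cos_of_nonneg_of_le_pi (abs_nonneg _) (by linarith)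
      (abs_le.2 ⟨by linarith, by linarith⟩)
  refine div_le_div_of_nonneg_left (Real.sin_nonneg_of_nonneg_of_le_pi hh (by linarith))
    (mul_pos c3 c4) ?_
  linarith [hprod a, hprod D]

theorem tan_sub_le_of_abs_le {φ φh : ℝ} (h1 : |φ| ≤ P.phiBar) (h2 : |φh| ≤ P.phiBar)
    (h : |φ - φh| ≤ P.ePhi) :
    (Real.tan φ - Real.tan φh) / P.L ≤ Real.sin P.ePhi / (P.L * Real.cos P.phiBar ^ 2) := by
  have hpi := Real.pi_pos
  have hc0 := P.cos_phiBar_pos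
  have hc1 := cos_le_of_abs_le h1 P.phiBar_lt
  have hc2 := cos_le_of_abs_le h2 P.phiBar_lt
  have he : P.ePhi < Real.pi / 2 := P.ePhi_le.trans_lt P.phiBar_lt
  have hs : 0 ≤ Real.sin P.ePhi :=
    Real.sin_nonneg_of_nonneg_of_le_pi P.ePhi_nonneg (by linarith)
  rw [tan_sub_tan (hc0.trans_le hc1).ne' (hc0.trans_le hc2).ne', div_div, mul_comm P.L]
  have h3 : Real.sin (φ - φh) ≤ Real.sin P.ePhi :=
    Real.sin_le_sin_of_le_of_le_pi_div_two (by linarith [(abs_le.1 h).1]) he.le (abs_le.1 h).2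
  have h4 : Real.cos P.phiBar ^ 2 ≤ Real.cos φ * Real.cos φh := by
    rw [sq]; exact mul_le_mul hc1 hc2 hc0.le (hc0.trans_le hc1).le
  exact div_le_div₀ hs h3 (mul_pos (pow_pos hc0 2) P.L_pos)
    (mul_le_mul_of_nonneg_right h4 P.L_pos.le)

/-- The decay of the sliding variable under the mixed law. -/
theorem mixed_decay {M H ε kl p q X E φ φh β βh : ℝ} (hε : 0 < ε)
    (hroom : M + H + Real.tan P.phiBar / P.L ≤ P.kV - ε)
    (hkl : M + Real.sin P.ePhi / (P.L * Real.cos P.phiBar ^ 2)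
      + (Real.tan P.dmax - Real.tan (P.dmax - P.eBeta)) / P.L + ε ≤ kl)
    (hq0 : 0 ≤ q) (hq1 : q ≤ 1) (hp : p = (1 - q) * P.kVeh + q * kl) (hX : |X| ≤ H) (hE : |E| ≤ M)
    (hφ : |φ| ≤ P.phiBar) (hφh : |φh| ≤ P.phiBar) (hφe : |φ - φh| ≤ P.ePhi)
    (hβ : |β| ≤ P.betaBar) (hβh : |βh| ≤ P.betaBar) (hβe : |β - βh| ≤ P.eBeta) :
    E + X - (Real.tan (sat P (Real.arctan (q * (Real.tan φh + P.L * X) + P.L * p) - βh) + β)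
      - Real.tan φ) / P.L ≤ -ε := by
  have hL := P.L_pos
  have hpi := Real.pi_pos
  have hM : 0 ≤ M := (abs_nonneg E).trans hE
  have hH : 0 ≤ H := (abs_nonneg X).trans hX
  have hE' := (abs_le.1 hE).2
  have hX' := abs_le.1 hX
  have hβ' := abs_le.1 hβ
  have hβe' := abs_le.1 hβe
  have hβh' := abs_le.1 hβh
  have hd := P.dmax_pos
  have hdb := P.dmax_add_lt
  have hbd := P.betaBar_lt
  have hb0 := P.betaBar_nonneg
  have heb := P.eBeta_le
  have heb0 := P.eBeta_nonneg
  have htanφ : Real.tan φ / P.L ≤ Real.tan P.phiBar / P.L :=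
    div_le_div_of_nonneg_right ((le_abs_self _).trans (abs_tan_le hφ P.phiBar_lt)) hL.le
  have htanφh : -Real.tan P.phiBar ≤ Real.tan φh :=
    (abs_le.1 (abs_tan_le hφh P.phiBar_lt)).1
  have htan0 : 0 ≤ Real.tan P.phiBar :=
    Real.tan_nonneg_of_nonneg_of_le_pi_div_two P.phiBar_nonneg P.phiBar_lt.le
  have hkVL : P.L * P.kV = Real.tan (P.dmax - P.betaBar) := mul_div_cancel₀ _ hL.ne'
  have hkVehL : P.L * P.kVeh = Real.tan P.dmax := mul_div_cancel₀ _ hL.ne'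
  have hmono : ∀ x y, -(Real.pi / 2) < x → x ≤ y → y < Real.pi / 2 → Real.tan x ≤ Real.tan y :=
    fun x y hx hxy hy => Real.strictMonoOn_tan.monotoneOn ⟨hx, hxy.trans_lt hy⟩
      ⟨hx.trans_le hxy, hy⟩ hxy
  have hsinterm : 0 ≤ Real.sin P.ePhi / (P.L * Real.cos P.phiBar ^ 2) := by
    have := Real.sin_nonneg_of_nonneg_of_le_pi P.ePhi_nonneg
      (by linarith [P.ePhi_le.trans_lt P.phiBar_lt])
    positivity
  have htanterm : 0 ≤ (Real.tan P.dmax - Real.tan (P.dmax - P.eBeta)) / P.L :=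
    div_nonneg (sub_nonneg.2 (hmono _ _ (by linarith) (by linarith) (by linarith))) hL.le
  have hkl0 : 0 ≤ kl := by linarith
  have hkVeh0 : 0 ≤ P.kVeh := div_nonneg P.tan_dmax_pos.le hL.le
  have hp0 : 0 ≤ p := by
    rw [hp]; exact add_nonneg (mul_nonneg (by linarith) hkVeh0) (mul_nonneg hq0 hkl0)
  set Υ := q * (Real.tan φh + P.L * X) + P.L * p with hΥ
  have hroomL : P.L * M + P.L * H + Real.tan P.phiBar ≤ P.L * P.kV - P.L * ε := by
    have := mul_le_mul_of_nonneg_left hroom hL.le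
    rw [mul_add, mul_add, mul_sub, mul_div_cancel₀ _ hL.ne'] at this
    exact this
  -- The nonlinear part cannot outweigh `L * kV`, so the saturation on the side opposite to the sign
  -- of `S` never acts.
  have hΥlow : -(P.L * P.kV) < Υ := by
    have h1 : -(Real.tan P.phiBar + P.L * H) ≤ Real.tan φh + P.L * X := by
      nlinarith [mul_le_mul_of_nonneg_left hX'.1 hL.le]
    have h2 : q * -(Real.tan P.phiBar + P.L * H) ≤ q * (Real.tan φh + P.L * X) :=
      mul_le_mul_of_nonneg_left h1 hq0
    have h3 : 0 ≤ Real.tan P.phiBar + P.L * H := by positivity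
    have h4 : q * (Real.tan P.phiBar + P.L * H) ≤ 1 * (Real.tan P.phiBar + P.L * H) :=
      mul_le_mul_of_nonneg_right hq1 h3
    have h5 := mul_nonneg hL.le hp0
    have h6 := mul_pos hL hε
    have h7 := mul_nonneg hL.le hM
    linarith
  set a := Real.arctan Υ with ha
  have hatan : Real.tan a = Υ := Real.tan_arctan Υ
  have halow : -(P.dmax - P.betaBar) < a := by
    rw [ha, ← Real.arctan_tan (x := -(P.dmax - P.betaBar)) (by linarith) (by linarith)]
    refine Real.arctan_strictMono ?_
    rw [Real.tan_neg, ← hkVL]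
    exact hΥlow
  -- the case of the large actual steering angle
  have hlarge : ∀ y, P.kV ≤ Real.tan y / P.L →
      E + X - (Real.tan y - Real.tan φ) / P.L ≤ -ε := by
    intro y hy
    rw [sub_div]
    linarith
  rcases le_or_gt P.dmax (a - βh) with hge | hlt
  · rw [sat_of_le hge]
    exact hlarge _ (kV_le_tan hβ)
  rw [sat_of_abs_le (abs_le.2 ⟨by linarith, hlt.le⟩)]
  -- If `a ≥ dmax`, the compensation error, at most `eBeta ≤ betaBar`, leaves the actual angle at
  -- least `dmax - betaBar`.
  rcases le_or_gt P.dmax a with hge | hlt'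
  · exact hlarge _ (div_le_div_of_nonneg_right
      (hmono _ _ (by linarith) (by linarith) (by linarith)) hL.le)
  have h1 : Real.tan (a - P.eBeta) ≤ Real.tan (a - βh + β) :=
    hmono _ _ (by linarith) (by linarith) (by linarith)
  have h2 := tan_sub_tan_le (a := a) heb0 P.dmax_lt hlt'.le (by linarith)
  have h3 : (Υ - (Real.tan P.dmax - Real.tan (P.dmax - P.eBeta))) / P.L ≤
      Real.tan (a - βh + β) / P.L := div_le_div_of_nonneg_right (by linarith) hL.le
  have h4 : Υ / P.L = q * (Real.tan φh / P.L + X) + p := by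
    rw [hΥ]; field_simp
  have h5 := tan_sub_le_of_abs_le hφ hφh hφe
  rw [sub_div, h4] at h3
  rw [sub_div] at h5 ⊢
  have h6 : P.kV ≤ P.kVeh - (Real.tan P.dmax - Real.tan (P.dmax - P.eBeta)) / P.L := by
    rw [Params.kVeh, sub_div, sub_sub_cancel]
    exact div_le_div_of_nonneg_right (hmono _ _ (by linarith) (by linarith) (by linarith)) hL.le
  set A := (Real.tan P.dmax - Real.tan (P.dmax - P.eBeta)) / P.L with hA
  -- A convex combination of two modes: pure maximal amplitude, weight `1 - q`, covered by `hroom`,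
  -- and compensated lower amplitude, weight `q`, covered by `hkl`.
  have h7 : (1 - q) * (M + X + Real.tan φ / P.L - P.kVeh + A) ≤ (1 - q) * (-ε) :=
    mul_le_mul_of_nonneg_left (by linarith) (by linarith)
  have h8 : q * (M + (Real.tan φ / P.L - Real.tan φh / P.L) - kl + A) ≤ q * (-ε) :=
    mul_le_mul_of_nonneg_left (by linarith) hq0
  rw [hp] at h3
  linarith

end

/-! ### Decay under the mixed law, and its limit far from the sliding surface. -/

section
variable {P : Params} {C : RefPath} {w : Slip} {χ : ℝ → ℝ} {e : Estimates} {σ ε : ℝ}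
  {kl : ℝ → ℝ} {p : ℝ → ℝ → ℝ}

/-- The steering angle and its bias cancel, so `mu` measures only how well `Ξ` approximates the
remaining terms of `v⁻¹ Ṡ`. -/
theorem Config.Admissible.sum_eq {z : ℝ} {c : Config} (hc : c.Admissible P C χ σ z) :
    (c.v P)⁻¹ * c.SDot P C z + (Real.tan (c.δ + c.β) - Real.tan c.φ) / P.L - c.Xi P C z =
      C.κ c.s * (Real.cos (c.θ - c.φ) / (1 - C.κ c.s * z)) + c.d * Real.sin (c.θ - c.φ)
        - c.dφh / c.v P - c.Xi P C z := by
  have hv : c.v P ≠ 0 := (speed_pos hc.φ_le hc.vs_le).ne'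
  have hL := P.L_pos.ne'
  simp only [Config.SDot, thetaDot, sDot, zDot, turnRate]
  field_simp
  ring

theorem Config.Admissible.abs_terms_le (hχ : IsDesignFunction P C χ) {z : ℝ}
    (hz : C.kBar * |z| ≤ P.lam) {c : Config} (hc : c.Admissible P C χ σ z) (φ : ℝ) {V : ℝ}
    (hV : P.vMin ≤ V) :
    |C.κ c.s * (Real.cos (c.θ - φ) / (1 - C.κ c.s * z)) + c.d * Real.sin (c.θ - φ)
        - c.dφh / V| ≤
      C.kBar / (1 - C.kBar * |z|) + (rightDeriv χ z + leftDeriv χ z) + P.dphiBar / P.vMin := by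
  have h1 := abs_div_one_sub_le (y := Real.cos (c.θ - φ)) (C.abs_κ_le hc.s_mem)
    (hz.trans_lt P.lam_lt)
  have hden : 0 < 1 - C.kBar * |z| := by linarith [P.lam_lt]
  have h2 : C.kBar * |Real.cos (c.θ - φ)| / (1 - C.kBar * |z|) ≤ C.kBar / (1 - C.kBar * |z|) :=
    div_le_div_of_nonneg_right (mul_le_of_le_one_right C.kBar_nonneg (Real.abs_cos_le_one _)) hden.le
  have hr := hχ.rightDeriv_nonneg z
  have hl := hχ.leftDeriv_nonneg z
  have h3 : |c.d * Real.sin (c.θ - φ)| ≤ rightDeriv χ z + leftDeriv χ z := by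
    rw [abs_mul]
    refine (mul_le_of_le_one_right (abs_nonneg _) (Real.abs_sin_le_one _)).trans ?_
    rcases hc.d_eq with h | h <;> rw [h, abs_of_nonneg (by assumption)] <;> linarith
  have h4 : |c.dφh / V| ≤ P.dphiBar / P.vMin := by
    have hV0 : 0 < V := P.vMin_pos.trans_le hV
    rw [abs_div, abs_of_pos hV0]
    exact div_le_div₀ P.dphiBar_nonneg hc.dφh_le P.vMin_pos hV
  have h5 := abs_sub (C.κ c.s * (Real.cos (c.θ - φ) / (1 - C.κ c.s * z)) +
    c.d * Real.sin (c.θ - φ)) (c.dφh / V)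
  have h6 := abs_add_le (C.κ c.s * (Real.cos (c.θ - φ) / (1 - C.κ c.s * z)))
    (c.d * Real.sin (c.θ - φ))
  linarith

theorem Config.Xi_eq (z : ℝ) (c : Config) : c.Xi P C z =
    C.κ c.s * (Real.cos (c.θ - c.φh) / (1 - C.κ c.s * z)) + c.d * Real.sin (c.θ - c.φh)
        - c.dφh / P.vrw := by
  rw [Config.Xi, BicycleTracking.Xi, mul_div_assoc]

theorem Params.vMin_le_vrw (P : Params) : P.vMin ≤ P.vrw := by
  rw [Params.vMin]; linarith [P.vBar_nonneg]

theorem Config.Admissible.le_eta (hχ : IsDesignFunction P C χ) {z : ℝ}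
    (hz : C.kBar * |z| ≤ P.lam) {c : Config} (hc : c.Admissible P C χ σ z) :
    |c.Xi P C z| ≤ eta P C χ σ z := by
  -- An explicit upper bound, since the supremum of an unbounded set would be the default zero.
  refine le_csSup ⟨C.kBar / (1 - C.kBar * |z|) + (rightDeriv χ z + leftDeriv χ z)
    + P.dphiBar / P.vMin, ?_⟩ ⟨c, hc, rfl⟩
  rintro _ ⟨c', hc', rfl⟩
  rw [Config.Xi_eq]
  exact hc'.abs_terms_le hχ hz _ P.vMin_le_vrw

theorem Config.Admissible.le_mu (hχ : IsDesignFunction P C χ) {z : ℝ}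
    (hz : C.kBar * |z| ≤ P.lam) {c : Config} (hc : c.Admissible P C χ σ z) :
    |C.κ c.s * (Real.cos (c.θ - c.φ) / (1 - C.κ c.s * z)) + c.d * Real.sin (c.θ - c.φ)
        - c.dφh / c.v P - c.Xi P C z| ≤ mu P C χ σ z := by
  rw [← hc.sum_eq]
  refine le_csSup ⟨C.kBar / (1 - C.kBar * |z|) + (rightDeriv χ z + leftDeriv χ z)
    + P.dphiBar / P.vMin + (C.kBar / (1 - C.kBar * |z|) + (rightDeriv χ z + leftDeriv χ z)
    + P.dphiBar / P.vMin), ?_⟩ ⟨c, hc, rfl⟩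
  rintro _ ⟨c', hc', rfl⟩
  rw [hc'.sum_eq, Config.Xi_eq]
  refine (abs_sub _ _).trans (add_le_add (hc'.abs_terms_le hχ hz _ ?_)
    (hc'.abs_terms_le hχ hz _ P.vMin_le_vrw))
  exact (speed_bounds hc'.φ_le hc'.vs_le).1

/-- The argument of the arctangent in the mixed law. -/
def mixedArg (P : Params) (χ kl : ℝ → ℝ) (p : ℝ → ℝ → ℝ) (g k d z S φh dφ : ℝ) : ℝ :=
  (P.kVeh - p |S| z) / (P.kVeh - kl z) * (Real.tan φh + P.L *
    (k * (Real.cos (χ z + S) / (1 - k * z)) + d * Real.sin (χ z + S) - dφ / P.vrw))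
    + P.L * p |S| z * g

theorem mixedLaw_eq {t : ℝ} {x : State} {g : ℝ} (hg : g = 1 ∨ g = -1)
    (hS : 0 < g * slidingVar χ e t x) : mixedLaw P C χ kl p e t x =
      sat P (Real.arctan (mixedArg P χ kl p g (C.κ x.1) (deriv χ x.2.1) x.2.1
        (slidingVar χ e t x) (e.φh t) (e.dφh t)) - e.βh t) := by
  have h : x.2.2 - e.φh t = χ x.2.1 + slidingVar χ e t x := by rw [slidingVar]; ring
  simp only [mixedLaw, mixedArg, sign_eq_of_mul_pos hg hS, Xi, h, mul_div_assoc]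

theorem mixedArg_sign {g k d z S φh dφ : ℝ} (hg : g = 1 ∨ g = -1) :
    mixedArg P χ kl p g k d z S φh dφ = g * ((P.kVeh - p |S| z) / (P.kVeh - kl z) *
      (Real.tan (g * φh) + P.L * (g * (k * (Real.cos (χ z + S) / (1 - k * z)) +
        d * Real.sin (χ z + S) - dφ / P.vrw))) + P.L * p |S| z) := by
  have hgg := sq_eq_one_of_sign hg
  have ht : Real.tan (g * φh) = g * Real.tan φh := by rw [mul_comm, tan_mul_sign hg]
  rw [ht, mixedArg]
  linear_combination (-((P.kVeh - p |S| z) / (P.kVeh - kl z) * (Real.tan φh + P.L *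
    (k * (Real.cos (χ z + S) / (1 - k * z)) + d * Real.sin (χ z + S) - dφ / P.vrw)))) * hgg

theorem tan_sat_sign {g Υ βh β : ℝ} (hg : g = 1 ∨ g = -1) :
    g * Real.tan (sat P (Real.arctan (g * Υ) - βh) + β) =
      Real.tan (sat P (Real.arctan Υ - g * βh) + g * β) := by
  have hgg := sq_eq_one_of_sign hg
  have ha : Real.arctan (g * Υ) = g * Real.arctan Υ := by
    rcases hg with rfl | rfl
    · simp
    · rw [neg_one_mul, Real.arctan_neg, neg_one_mul]
  rw [ha, show g * Real.arctan Υ - βh = g * (Real.arctan Υ - g * βh) by linear_combination βh * hgg,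
    sat_mul hg, show g * sat P (Real.arctan Υ - g * βh) + β =
      (sat P (Real.arctan Υ - g * βh) + g * β) * g by linear_combination (-β) * hgg,
    tan_mul_sign hg, ← mul_assoc, hgg, one_mul]

theorem MixingOK.continuous (hp : MixingOK P C σ kl p) :
    Continuous fun q : ℝ × ℝ => p |q.1| q.2 :=
  hp.cont.comp_continuous (f := fun q : ℝ × ℝ => (|q.1|, q.2)) (by fun_prop)
    fun q => ⟨mem_Ici.2 (abs_nonneg q.1), mem_univ _⟩

/-- The rate of the sliding variable for frozen values of the slips and of their estimates,
`k = (κ, φ, β, φ̂, β̂, dφ̂)`. -/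
def mixedRate (P : Params) (χ kl : ℝ → ℝ) (p : ℝ → ℝ → ℝ) (g : ℝ) (q : ℝ × ℝ × ℝ)
    (k : ℝ × ℝ × ℝ × ℝ × ℝ × ℝ) : ℝ :=
  k.1 * (Real.cos (χ q.2.1 + (q.2.2 + (k.2.2.2.1 - k.2.1))) / (1 - k.1 * q.2.1)) +
    q.1 * Real.sin (χ q.2.1 + (q.2.2 + (k.2.2.2.1 - k.2.1))) -
    Real.tan (sat P (Real.arctan (mixedArg P χ kl p g k.1 q.1 q.2.1 q.2.2 k.2.2.2.1 k.2.2.2.2.2)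
      - k.2.2.2.2.1) + k.2.2.1) / P.L

/-- Curvature and `dφ̂` need not have limits, so instead of passing to limits in them one lets all
these quantities range over a compact box, uniformly. -/
def mixedParams (P : Params) (C : RefPath) : Set (ℝ × ℝ × ℝ × ℝ × ℝ × ℝ) :=
  Icc (-C.kBar) C.kBar ×ˢ Icc (-P.phiBar) P.phiBar ×ˢ Icc (-P.betaBar) P.betaBar ×ˢ
    Icc (-P.phiBar) P.phiBar ×ˢ Icc (-P.betaBar) P.betaBar ×ˢ Icc (-P.dphiBar) P.dphiBar

theorem mixedRate_continuousAt (hχ : IsDesignFunction P C χ) (hA : AmplitudeOK P C χ σ ε kl)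
    (hp : MixingOK P C σ kl p) {g d z S : ℝ} (hz : C.kBar * |z| ≤ P.lam)
    {k : ℝ × ℝ × ℝ × ℝ × ℝ × ℝ} (hk : k ∈ mixedParams P C) :
    ContinuousAt (fun q : (ℝ × ℝ × ℝ) × ℝ × ℝ × ℝ × ℝ × ℝ × ℝ => mixedRate P χ kl p g q.1 q.2)
      ((d, z, S), k) := by
  obtain ⟨hk1, -, hk3, hk4, -⟩ := hk
  have h1 : 1 - k.1 * z ≠ 0 := (one_sub_mul_pos (abs_le.2 ⟨hk1.1, hk1.2⟩)
    (hz.trans_lt P.lam_lt)).ne'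
  have h2 : P.kVeh - kl z ≠ 0 := (sub_pos.2 (hA.kl_lt z hz)).ne'
  have h3 : Real.cos k.2.2.2.1 ≠ 0 := (cos_pos_of_abs_le (abs_le.2 ⟨hk4.1, hk4.2⟩)).ne'
  have h4 : ∀ x, Real.cos (sat P x + k.2.2.1) ≠ 0 := fun x =>
    (cos_add_pos (abs_sat_le x) (abs_le.2 ⟨hk3.1, hk3.2⟩)).ne'
  have hχc := hχ.cont
  have hklc := hA.cont
  have hpc := hp.continuous
  have hpc' : Continuous fun q : (ℝ × ℝ × ℝ) × ℝ × ℝ × ℝ × ℝ × ℝ × ℝ => p |q.1.2.2| q.1.2.1 :=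
    hpc.comp (f := fun q : (ℝ × ℝ × ℝ) × ℝ × ℝ × ℝ × ℝ × ℝ × ℝ => (q.1.2.2, q.1.2.1)) (by fun_prop)
  have htan : ContinuousAt (fun q : (ℝ × ℝ × ℝ) × ℝ × ℝ × ℝ × ℝ × ℝ × ℝ => Real.tan q.2.2.2.2.1)
      ((d, z, S), k) :=
    (Real.continuousAt_tan.2 h3).comp (f := fun q : (ℝ × ℝ × ℝ) × ℝ × ℝ × ℝ × ℝ × ℝ × ℝ =>
      q.2.2.2.2.1) (x := ((d, z, S), k)) (by fun_prop)
  have harg : ContinuousAt (fun q : (ℝ × ℝ × ℝ) × ℝ × ℝ × ℝ × ℝ × ℝ × ℝ =>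
      mixedArg P χ kl p g q.2.1 q.1.1 q.1.2.1 q.1.2.2 q.2.2.2.2.1 q.2.2.2.2.2.2) ((d, z, S), k) := by
    have e1 := hpc'.continuousAt (x := ((d, z, S), k))
    exact (((continuousAt_const.sub e1).div (by fun_prop) h2).mul
      (htan.add (continuousAt_const.mul (by fun_prop (disch := assumption))))).add
      ((continuousAt_const.mul e1).mul continuousAt_const)
  have hsat : ContinuousAt (fun q : (ℝ × ℝ × ℝ) × ℝ × ℝ × ℝ × ℝ × ℝ × ℝ =>
      sat P (Real.arctan (mixedArg P χ kl p g q.2.1 q.1.1 q.1.2.1 q.1.2.2 q.2.2.2.2.1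
        q.2.2.2.2.2.2) - q.2.2.2.2.2.1) + q.2.2.2.1) ((d, z, S), k) :=
    (continuous_sat.continuousAt.comp ((Real.continuous_arctan.continuousAt.comp harg).sub
      (by fun_prop))).add (by fun_prop)
  have htan2 := (Real.continuousAt_tan.2 (h4 (Real.arctan (mixedArg P χ kl p g k.1 d z S k.2.2.2.1
    k.2.2.2.2.2) - k.2.2.2.2.1))).comp (x := ((d, z, S), k)) hsat
  have hfst : ContinuousAt (fun q : (ℝ × ℝ × ℝ) × ℝ × ℝ × ℝ × ℝ × ℝ × ℝ =>
      q.2.1 * (Real.cos (χ q.1.2.1 + (q.1.2.2 + (q.2.2.2.2.1 - q.2.2.1))) / (1 - q.2.1 * q.1.2.1)) +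
      q.1.1 * Real.sin (χ q.1.2.1 + (q.1.2.2 + (q.2.2.2.2.1 - q.2.2.1)))) ((d, z, S), k) := by
    fun_prop (disch := assumption)
  exact hfst.sub (htan2.div_const P.L)

theorem mixedRate_le (hχ : IsDesignFunction P C χ) (hA : AmplitudeOK P C χ σ ε kl)
    (hp : MixingOK P C σ kl p) (hw : w.Admissible P) (he : e.Admissible P w)
    {g d z S s τ : ℝ} (hg : g = 1 ∨ g = -1) (hz : C.kBar * |z| ≤ P.lam) (hS : |S| ≤ σ)
    (hd : d = rightDeriv χ z ∨ d = leftDeriv χ z) (hs : s ∈ C.dom \ C.brk) (hτ : 0 ≤ τ) :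
    g * (mixedRate P χ kl p g (d, z, S) (C.κ s, w.φ τ, w.β τ, e.φh τ, e.βh τ, e.dφh τ) +
      Real.tan (w.φ τ) / P.L - e.dφh τ / w.v P τ) ≤ -ε := by
  -- The steering angle `0` is arbitrary, for it cancels by `sum_eq`.
  set c : Config := ⟨s, χ z + S + e.φh τ, w.φ τ, w.β τ, w.vs τ, e.φh τ, e.βh τ, e.dφh τ, 0, d⟩
    with hc
  have hadm : c.Admissible P C χ σ z :=
    { s_mem := hs
      S_le := by
        have : χ z + S + e.φh τ - χ z - e.φh τ = S := by ring
        simpa only [hc, this] using hS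
      φ_le := hw.φ_le τ hτ
      β_le := hw.β_le τ hτ
      vs_le := hw.vs_le τ hτ
      φ_err := he.φ_err τ hτ
      β_err := he.β_err τ hτ
      φh_le := he.φh_le τ hτ
      βh_le := he.βh_le τ hτ
      dφh_le := he.dφh_le τ hτ
      δ_le := by simpa [hc] using P.dmax_pos.le
      d_eq := hd }
  have hmu := hadm.le_mu hχ hz
  have heta := hadm.le_eta hχ hz
  rw [Config.Xi_eq] at hmu heta
  have e1 : χ z + S + e.φh τ - e.φh τ = χ z + S := by ring
  have e2 : χ z + S + e.φh τ - w.φ τ = χ z + (S + (e.φh τ - w.φ τ)) := by ring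
  simp only [hc, e1, e2] at hmu heta
  change |_ - e.dφh τ / w.v P τ - _| ≤ _ at hmu
  have hden : 0 < P.kVeh - kl z := sub_pos.2 (hA.kl_lt z hz)
  have hmem := hp.mem |S| z (abs_nonneg S) hz
  set q := (P.kVeh - p |S| z) / (P.kVeh - kl z) with hq
  have hq0 : 0 ≤ q := div_nonneg (by linarith [hmem.2]) hden.le
  have hq1 : q ≤ 1 := (div_le_one hden).2 (by linarith [hmem.1])
  have hpq : p |S| z = (1 - q) * P.kVeh + q * kl z := by
    rw [hq]; field_simp; ring
  have hdec := mixed_decay (P := P) hA.ε_pos (hA.room z hz) (hA.kl_ge z hz) hq0 hq1 hpq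
    (abs_mul_sign hg heta) (abs_mul_sign hg hmu) (abs_mul_sign hg (hw.φ_le τ hτ))
    (abs_mul_sign hg (he.φh_le τ hτ))
    (by rw [← mul_sub]; exact abs_mul_sign hg (he.φ_err τ hτ))
    (abs_mul_sign hg (hw.β_le τ hτ)) (abs_mul_sign hg (he.βh_le τ hτ))
    (by rw [← mul_sub]; exact abs_mul_sign hg (he.β_err τ hτ))
  rw [← tan_sat_sign hg, hq, ← mixedArg_sign hg,
    show Real.tan (g * w.φ τ) = g * Real.tan (w.φ τ) by rw [mul_comm, tan_mul_sign hg]] at hdec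
  simp only [mixedRate]
  refine le_trans (le_of_eq ?_) hdec
  ring

/-- The conditions on the amplitudes hold only for `z` in the domain, which nearby states may leave.
So the decay by `ε` is obtained with `z`, `S` and the slope of `χ` frozen at `x`; uniform continuity
of `mixedRate` over the box preserves half of it nearby. -/
theorem mixedLaw_decay (hχ : IsDesignFunction P C χ) (hA : AmplitudeOK P C χ σ ε kl)
    (hp : MixingOK P C σ kl p) (hw : w.Admissible P) (he : e.Admissible P w) {t : ℝ} (ht : 0 ≤ t)
    {x : State} (hx : x.1 ∈ interior C.dom) (hz : C.kBar * |x.2.1| ≤ P.lam) {g : ℝ}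
    (hg : g = 1 ∨ g = -1) (hS0 : 0 < g * slidingVar χ e t x) (hSσ : g * slidingVar χ e t x ≤ σ) :
    ∀ᶠ q in near t x,
      g * slidingDot P C χ w e (mixedLaw P C χ kl p e) q.1 q.2 ≤ -(P.vMin * (ε / 2)) := by
  have hε := hA.ε_pos
  have hSabs : |slidingVar χ e t x| ≤ σ := by
    have : |g * slidingVar χ e t x| = |slidingVar χ e t x| := by
      rw [abs_mul]; rcases hg with rfl | rfl <;> simp
    rwa [← this, abs_of_pos hS0]
  have htube := eventually_deriv_tube (t := t) (x := x) (F := mixedRate P χ kl p g)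
    (x₀ := (x.2.1, slidingVar χ e t x)) (K := mixedParams P C) hχ
    (isCompact_Icc.prod (isCompact_Icc.prod (isCompact_Icc.prod (isCompact_Icc.prod
      (isCompact_Icc.prod isCompact_Icc)))))
    (fun d k hk => mixedRate_continuousAt hχ hA hp hz hk)
    (f := fun q => (q.2.2.1, slidingVar χ e q.1 q.2))
    (Tendsto.prodMk_nhds (((continuous_fst.comp continuous_snd).tendsto _).comp
      (tendsto_near_snd t x)) (tendsto_near_slidingVar hχ he ht x)) (half_pos hε)
  have hpos := ((tendsto_near_slidingVar hχ he ht x).const_mul g).eventually (lt_mem_nhds hS0)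
  filter_upwards [htube, eventually_near_nonneg t x, hpos,
    eventually_near_of_snd (C.eventually_regular hx)] with q hq hτ hpos hreg
  obtain ⟨d, hd, hq⟩ := hq
  have hv := hw.v_pos hτ
  have hvm : P.vMin ≤ w.v P q.1 := (speed_bounds (hw.φ_le _ hτ) (hw.vs_le _ hτ)).1
  have h1 := hq (C.κ q.2.1, w.φ q.1, w.β q.1, e.φh q.1, e.βh q.1, e.dφh q.1)
    ⟨abs_le.1 (C.abs_κ_le hreg), abs_le.1 (hw.φ_le _ hτ), abs_le.1 (hw.β_le _ hτ),
      abs_le.1 (he.φh_le _ hτ), abs_le.1 (he.βh_le _ hτ), abs_le.1 (he.dφh_le _ hτ)⟩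
  have h2 := mixedRate_le hχ hA hp hw he hg hz hSabs hd hreg hτ
  have hθ : χ q.2.2.1 + (slidingVar χ e q.1 q.2 + (e.φh q.1 - w.φ q.1)) =
      q.2.2.2 - w.φ q.1 := by rw [slidingVar]; ring
  have h3 : slidingDot P C χ w e (mixedLaw P C χ kl p e) q.1 q.2 =
      w.v P q.1 * (mixedRate P χ kl p g (deriv χ q.2.2.1, q.2.2.1, slidingVar χ e q.1 q.2)
        (C.κ q.2.1, w.φ q.1, w.β q.1, e.φh q.1, e.βh q.1, e.dφh q.1) +
        Real.tan (w.φ q.1) / P.L - e.dφh q.1 / w.v P q.1) := by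
    rw [slidingDot_eq, mixedLaw_eq hg hpos]
    simp only [mixedRate, hθ]
    field_simp
    ring
  rw [h3]
  set A := mixedRate P χ kl p g (deriv χ q.2.2.1, q.2.2.1, slidingVar χ e q.1 q.2)
        (C.κ q.2.1, w.φ q.1, w.β q.1, e.φh q.1, e.βh q.1, e.dφh q.1)
  set A₀ := mixedRate P χ kl p g (d, x.2.1, slidingVar χ e t x)
        (C.κ q.2.1, w.φ q.1, w.β q.1, e.φh q.1, e.βh q.1, e.dφh q.1)
  have h4 := (abs_le.1 (abs_mul_sign hg h1.le)).2
  have h5 : g * (A + Real.tan (w.φ q.1) / P.L - e.dφh q.1 / w.v P q.1) ≤ -(ε / 2) := by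
    linarith
  have h6 := mul_le_mul_of_nonneg_left h5 hv.le
  have h7 := mul_le_mul_of_nonneg_right hvm (half_pos hε).le
  linarith

theorem eventually_nearAE_of_near {t : ℝ} {x : State} {p : ℝ × State → Prop} (ht : 0 ≤ t)
    (h : ∀ᶠ q in near t x, p q) : ∀ᶠ x' in nearAE x, p (t, x') := by
  obtain ⟨ρ, hρ, N, hN, h⟩ := eventually_near.1 h
  exact eventually_nearAE.2 ⟨ρ, hρ, N, hN, h t ht (by simpa using hρ)⟩

theorem mixedLaw_inner (hχ : IsDesignFunction P C χ) (hA : AmplitudeOK P C χ σ ε kl)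
    (hp : MixingOK P C σ kl p) (hw : w.Admissible P) (he : e.Admissible P w) :
    InnerLaw P C χ w e (mixedLaw P C χ kl p e) σ (P.vMin * (ε / 2)) where
  σ_nonneg := hA.σ_pos.le
  σ_lt := hA.σ_lt
  ε_pos := mul_pos P.vMin_pos (half_pos hA.ε_pos)
  decay := fun _ ht _ hx hz _ hg h0 hσ =>
    eventually_nearAE_of_near ht (mixedLaw_decay hχ hA hp hw he ht hx hz hg h0 hσ)
  barrier := by
    intro t ht x hx hz hS g hg
    have hle : g * slidingVar χ e t x ≤ σ := (le_abs_self _).trans (abs_mul_sign hg hS)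
    rcases hle.lt_or_eq with hlt | heq
    · filter_upwards [((tendsto_near_slidingVar hχ he ht x).const_mul g).eventually
        (gt_mem_nhds hlt)] with q h1 h2
      exact absurd h2 h1.not_gt
    · filter_upwards [mixedLaw_decay hχ hA hp hw he ht hx hz hg (heq ▸ hA.σ_pos) hle] with q h1 _
      have := mul_pos P.vMin_pos (half_pos hA.ε_pos)
      linarith

/-- If the compensation pushes the command beyond the limit, it is cut off and the bias is `β`
itself. Otherwise the residual `β - β̂` is left, at most `eBeta ≤ betaBar`. -/
theorem abs_bias_le {g β βh : ℝ} (hg : g = 1 ∨ g = -1) (hβ : |β| ≤ P.betaBar)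
    (hβh : |βh| ≤ P.betaBar) (hβe : |β - βh| ≤ P.eBeta) :
    |β + sat P (P.dmax * g - βh) - P.dmax * g| ≤ P.betaBar := by
  have hgg := sq_eq_one_of_sign hg
  have h1 : β + sat P (P.dmax * g - βh) - P.dmax * g =
      g * (g * β + sat P (P.dmax - g * βh) - P.dmax) := by
    rw [show P.dmax * g - βh = g * (P.dmax - g * βh) by linear_combination βh * hgg, sat_mul hg]
    linear_combination (-β) * hgg
  rw [h1]
  refine abs_mul_sign hg ?_
  rcases le_or_gt (g * βh) 0 with hle | hlt
  · rw [sat_of_le (by linarith), add_sub_cancel_right]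
    exact abs_mul_sign hg hβ
  · have h2 := abs_le.1 (abs_mul_sign hg hβh)
    rw [sat_of_abs_le (abs_le.2 ⟨by linarith [P.betaBar_lt], by linarith⟩),
      show g * β + (P.dmax - g * βh) - P.dmax = g * (β - βh) by ring]
    exact abs_mul_sign hg (hβe.trans P.eBeta_le)

/-- At `x` the amplitude is maximal, and the coefficient of the nonlinear part is zero. At nearby
states outside the domain this holds only in the limit, by continuity of `p`, the other factor being
bounded; hence the formulation of `OuterLaw` in terms of a limit. -/
theorem mixedLaw_outer (hχ : IsDesignFunction P C χ) (hA : AmplitudeOK P C χ σ ε kl)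
    (hp : MixingOK P C σ kl p) (hw : w.Admissible P) (he : e.Admissible P w) :
    OuterLaw P C χ w e (mixedLaw P C χ kl p e) σ := by
  intro g hg
  have hgg := sq_eq_one_of_sign hg
  refine ⟨fun t => w.β t + sat P (P.dmax * g - e.βh t) - P.dmax * g,
    ((hw.β_cont.add (continuous_sat.comp_continuousOn (continuousOn_const.sub he.βh_cont))).sub
      continuousOn_const), fun t ht => abs_bias_le hg (hw.β_le t ht) (he.βh_le t ht)
      (he.β_err t ht), fun t ht x hx hz hS => turnLim_iff.2 ?_⟩
  have hS0 : 0 < g * slidingVar χ e t x := hA.σ_pos.trans hS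
  have hSt := tendsto_near_slidingVar hχ he ht x
  have hpos := (hSt.const_mul g).eventually (lt_mem_nhds hS0)
  have hzt : Tendsto (fun q : ℝ × State => q.2.2.1) (near t x) (𝓝 x.2.1) :=
    ((continuous_fst.comp continuous_snd).tendsto _).comp (tendsto_near_snd t x)
  have hSabs : σ ≤ |slidingVar χ e t x| := by
    have : |g * slidingVar χ e t x| = |slidingVar χ e t x| := by
      rw [abs_mul]; rcases hg with rfl | rfl <;> simp
    rw [← this, abs_of_pos hS0]; exact hS.le
  have hpt : Tendsto (fun q : ℝ × State => p |slidingVar χ e q.1 q.2| q.2.2.1) (near t x)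
      (𝓝 P.kVeh) := by
    rw [← hp.at_large _ _ hSabs hz]
    exact (hp.continuous.tendsto (slidingVar χ e t x, x.2.1)).comp (hSt.prodMk_nhds hzt)
  have hden : P.kVeh - kl x.2.1 ≠ 0 := (sub_pos.2 (hA.kl_lt _ hz)).ne'
  have hqt : Tendsto (fun q : ℝ × State => (P.kVeh - p |slidingVar χ e q.1 q.2| q.2.2.1) /
      (P.kVeh - kl q.2.2.1)) (near t x) (𝓝 0) := by
    have := (hpt.const_sub P.kVeh).div (((hA.cont.tendsto _).comp hzt).const_sub P.kVeh) hden
    rw [sub_self, zero_div] at this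
    exact this
  -- the second factor is bounded
  obtain ⟨K, hK⟩ := hχ.eventually_abs_deriv_le x.2.1
  set lam' := (1 + P.lam) / 2 with hlam'
  have hlam1 : lam' < 1 := by rw [hlam']; linarith [P.lam_lt]
  have hzl : ∀ᶠ q : ℝ × State in near t x, C.kBar * |q.2.2.1| < lam' :=
    (hzt.abs.const_mul C.kBar).eventually (gt_mem_nhds (by rw [hlam']; linarith [P.lam_lt]))
  set B := Real.tan P.phiBar + P.L * (C.kBar / (1 - lam') + K + P.dphiBar / P.vrw) with hB
  have hbd : ∀ᶠ q : ℝ × State in near t x, |Real.tan (e.φh q.1) + P.L *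
      (C.κ q.2.1 * (Real.cos (χ q.2.2.1 + slidingVar χ e q.1 q.2) / (1 - C.κ q.2.1 * q.2.2.1)) +
        deriv χ q.2.2.1 * Real.sin (χ q.2.2.1 + slidingVar χ e q.1 q.2) -
          e.dφh q.1 / P.vrw)| ≤ B := by
    filter_upwards [hzl, hzt.eventually hK, eventually_near_nonneg t x,
      eventually_near_of_snd (C.eventually_regular hx)] with q h1 h2 h3 h4
    set a := χ q.2.2.1 + slidingVar χ e q.1 q.2
    have t1 := abs_tan_le (he.φh_le _ h3) P.phiBar_lt
    have t2 := abs_div_one_sub_le (y := Real.cos a) (C.abs_κ_le h4) (h1.trans hlam1)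
    have t3 : C.kBar * |Real.cos a| / (1 - C.kBar * |q.2.2.1|) ≤ C.kBar / (1 - lam') :=
      div_le_div₀ C.kBar_nonneg (mul_le_of_le_one_right C.kBar_nonneg (Real.abs_cos_le_one _))
        (by linarith) (by linarith)
    have t4 : |deriv χ q.2.2.1 * Real.sin a| ≤ K := by
      rw [abs_mul]
      exact (mul_le_of_le_one_right (abs_nonneg _) (Real.abs_sin_le_one _)).trans h2
    have t5 : |e.dφh q.1 / P.vrw| ≤ P.dphiBar / P.vrw := by
      rw [abs_div, abs_of_pos P.vrw_pos]
      exact div_le_div_of_nonneg_right (he.dφh_le _ h3) P.vrw_pos.le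
    refine (abs_add_le _ _).trans (add_le_add t1 ?_)
    rw [abs_mul, abs_of_pos P.L_pos]
    refine mul_le_mul_of_nonneg_left ?_ P.L_pos.le
    refine (abs_sub _ _).trans (add_le_add ((abs_add_le _ _).trans
      (add_le_add (t2.trans t3) t4)) t5)
  have harg : Tendsto (fun q : ℝ × State => mixedArg P χ kl p g (C.κ q.2.1) (deriv χ q.2.2.1)
      q.2.2.1 (slidingVar χ e q.1 q.2) (e.φh q.1) (e.dφh q.1)) (near t x)
      (𝓝 (Real.tan (P.dmax * g))) := by
    have h1 : Tendsto (fun q : ℝ × State => (P.kVeh - p |slidingVar χ e q.1 q.2| q.2.2.1) /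
        (P.kVeh - kl q.2.2.1) * (Real.tan (e.φh q.1) + P.L *
      (C.κ q.2.1 * (Real.cos (χ q.2.2.1 + slidingVar χ e q.1 q.2) / (1 - C.κ q.2.1 * q.2.2.1)) +
        deriv χ q.2.2.1 * Real.sin (χ q.2.2.1 + slidingVar χ e q.1 q.2) -
          e.dφh q.1 / P.vrw))) (near t x) (𝓝 0) := by
      have h2 := hqt.norm.mul_const B
      rw [norm_zero, zero_mul] at h2
      refine squeeze_zero_norm' ?_ h2
      filter_upwards [hbd] with q hq
      rw [norm_mul]
      exact mul_le_mul_of_nonneg_left hq (norm_nonneg _)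
    have h3 := h1.add ((hpt.const_mul P.L).mul_const g)
    have h4 : 0 + P.L * P.kVeh * g = Real.tan (P.dmax * g) := by
      rw [tan_mul_sign hg, Params.kVeh, mul_div_cancel₀ _ P.L_pos.ne']; ring
    rw [h4] at h3
    exact h3
  have hd := P.dmax_lt
  have hd0 := P.dmax_pos
  have harctan : Real.arctan (Real.tan (P.dmax * g)) = P.dmax * g := by
    have := abs_le.1 (abs_dmax_mul (P := P) hg)
    exact Real.arctan_tan (by linarith) (by linarith)
  have hu : Tendsto (fun q : ℝ × State => mixedLaw P C χ kl p e q.1 q.2) (near t x)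
      (𝓝 (sat P (P.dmax * g - e.βh t))) := by
    have h1 := (continuous_sat (P := P)).tendsto _ |>.comp
      (((Real.continuous_arctan.tendsto _).comp harg).sub
        (tendsto_near_of_continuousOn he.βh_cont ht x))
    rw [harctan] at h1
    refine h1.congr' ?_
    filter_upwards [hpos] with q hq
    rw [mixedLaw_eq hg hq]
    rfl
  have hv := tendsto_near_of_continuousOn hw.v_cont ht x
  have hφ := tendsto_near_of_continuousOn hw.φ_cont ht x
  have hβ := tendsto_near_of_continuousOn hw.β_cont ht x
  have hc1 : Real.cos (sat P (P.dmax * g - e.βh t) + w.β t) ≠ 0 :=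
    (cos_add_pos (abs_sat_le _) (hw.β_le t ht)).ne'
  have hc2 : Real.cos (w.φ t) ≠ 0 := (cos_pos_of_abs_le (hw.φ_le t ht)).ne'
  have hlim := (hv.div_const P.L).mul ((((Real.continuousAt_tan.2 hc1).tendsto).comp
    (hu.add hβ)).sub (((Real.continuousAt_tan.2 hc2).tendsto).comp hφ))
  have hval : turnRate P (w.v P t) (w.φ t)
      (w.β t + sat P (P.dmax * g - e.βh t) - P.dmax * g) (P.dmax * g) =
      w.v P t / P.L * (Real.tan (sat P (P.dmax * g - e.βh t) + w.β t) - Real.tan (w.φ t)) := by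
    rw [turnRate, show P.dmax * g + (w.β t + sat P (P.dmax * g - e.βh t) - P.dmax * g) =
      sat P (P.dmax * g - e.βh t) + w.β t by ring]
  rw [hval]
  exact hlim

end

end BicycleTracking

end

theorem mainTheorem8
    (P : BicycleTracking.Params) (C : BicycleTracking.RefPath)
    (hclosest : C.ClosestWellDefined P.lam)
    (hcurv : C.kBar < P.kVeh)
    (χ : ℝ → ℝ) (hχ : BicycleTracking.IsDesignFunction P C χ)
    (hmaint : BicycleTracking.StrictlyMaintainable P C χ)
    (w : BicycleTracking.Slip) (hw : w.Admissible P)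
    (e : BicycleTracking.Estimates) (he : e.Admissible P w)
    (x₀ : BicycleTracking.State)
    (hinit : BicycleTracking.InitialOK P C x₀ (BicycleTracking.slidingVar χ e 0 x₀)) :
    BicycleTracking.TracksExponentially P C χ w (BicycleTracking.maxLaw P χ e) x₀ ∧
    ∀ (σ ε : ℝ) (kl : ℝ → ℝ) (p : ℝ → ℝ → ℝ),
      BicycleTracking.AmplitudeOK P C χ σ ε kl →
      BicycleTracking.MixingOK P C σ kl p →
      BicycleTracking.TracksExponentially P C χ w
        (BicycleTracking.mixedLaw P C χ kl p e) x₀ := by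
  have hK := hmaint.kBar_lt hχ
  exact ⟨BicycleTracking.tracks_of_laws hclosest hχ hw he hK
      (BicycleTracking.maxLaw_inner hχ hmaint hw he)
      (BicycleTracking.maxLaw_outer hχ hw he) hinit,
    fun σ ε kl p hA hp => BicycleTracking.tracks_of_laws hclosest hχ hw he hK
      (BicycleTracking.mixedLaw_inner hχ hA hp hw he)
      (BicycleTracking.mixedLaw_outer hχ hA hp hw he) hinit⟩
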